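/- Let $d,k\ge 1$ be integers, let $I=[-1,1]$, and let $\Phi=(\varphi_1,\dots,\varphi_k):I^d\to\mathbb R^k$ be smooth (that is, $\Phi$ extends to a $C^\infty$ map on an open neighbourhood of $I^d$ in $\mathbb R^d$). Let $S_1,S_2\subset I^d$ be closed cubes (with sides parallel to the axes and positive side length), and for $i=1,2$ put $$E_if(x,t)=\int_{S_i}e^{2\pi i(x\cdot\xi+t\cdot\Phi(\xi))}f(\xi)\,d\xi,\qquad (x,t)\in\mathbb R^d\times\mathbb R^k .$$ For $\nu_1,\nu_2\in I^d$ let $\mathbf D(\nu_1,\nu_2)$ be the $k\times d$ matrix whose $i$-th row is $\nabla\varphi_i(\nu_2)-\nabla\varphi_i(\nu_1)$, let $H\varphi_i$ be the Hessian matrix of $\varphi_i$, and for $t\in\mathbb R^k$, $\nu\in I^d$ set $$\mathbf M(t,\nu_1,\nu_2,\nu)=\begin{pmatrix}0&\mathbf D(\nu_1,\nu_2)\\ \mathbf D(\nu_1,\nu_2)^{t}&\sum_{i=1}^k t_iH\varphi_i(\nu)\end{pmatrix},$$ where $\mathbf D(\nu_1,\nu_2)^{t}$ is the transpose. Assume that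 $$\det\mathbf M(t,\nu_1,\nu_2,\nu)\ne0\quad\text{for all }\nu_1\in S_1,\ \nu_2\in S_2,\ t\in\mathbb R^k\text{ with }|t|=1,\text{ and }\nu\in\{\nu_1,\nu_2\}.$$ Let $p,q\in(0,\infty]$ satisfy $q\ge2$ and $$\frac1p+\frac{d+3k}{d+k}\,\frac1{2q}\le1$$ (with $1/\infty=0$). Then there is a constant $C<\infty$, depending only on $d,k,\Phi,S_1,S_2,p,q$, such that for all $f,g\in L^p(\mathbb R^d)$ (complex-valued) the product $E_1f\,E_2g$ belongs to $L^q(\mathbb R^{d+k})$ and $$\|E_1f\,E_2g\|_{L^q(\mathbb R^{d+k})}\le C\,\|f\|_{L^p(\mathbb R^d)}\,\|g\|_{L^p(\mathbb R^d)} .$$ -/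

import Mathlib

open MeasureTheory
open scoped ENNReal NNReal ContDiff Matrix

namespace BilinearExtension

/-- The cube `I^d = [-1,1]^d` in `ℝ^d`. -/
def unitCube (d : ℕ) : Set (EuclideanSpace ℝ (Fin d)) :=
  {ξ | ∀ j, ξ j ∈ Set.Icc (-1 : ℝ) 1}

/-- `S` is a closed (axis-parallel) cube of positive side length `s`, with lowest corner `a`. -/
def IsClosedCube {d : ℕ} (S : Set (EuclideanSpace ℝ (Fin d))) : Prop :=
  ∃ (a : EuclideanSpace ℝ (Fin d)) (s : ℝ), 0 < s ∧
    S = {ξ | ∀ j, ξ j ∈ Set.Icc (a j) (a j + s)}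

/-- A map is smooth on a (not necessarily open) set if it is `C^∞` on an open neighbourhood. -/
def SmoothOnNhd {d k : ℕ} (Φ : EuclideanSpace ℝ (Fin d) → EuclideanSpace ℝ (Fin k))
    (A : Set (EuclideanSpace ℝ (Fin d))) : Prop :=
  ∃ U : Set (EuclideanSpace ℝ (Fin d)), IsOpen U ∧ A ⊆ U ∧ ContDiffOn ℝ ∞ Φ U

/-- The partial derivative `∂_j φ (ξ)`. -/
noncomputable def partialDeriv {d : ℕ} (φ : EuclideanSpace ℝ (Fin d) → ℝ) (j : Fin d)
    (ξ : EuclideanSpace ℝ (Fin d)) : ℝ :=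
  fderiv ℝ φ ξ (EuclideanSpace.single j (1 : ℝ))

/-- The Hessian matrix `Hφ(ν) = (∂_i ∂_j φ(ν))_{i,j}`. -/
noncomputable def hessian {d : ℕ} (φ : EuclideanSpace ℝ (Fin d) → ℝ)
    (ν : EuclideanSpace ℝ (Fin d)) : Matrix (Fin d) (Fin d) ℝ :=
  Matrix.of fun i j => partialDeriv (partialDeriv φ j) i ν

/-- The `k × d` matrix `D(ν₁, ν₂)`, whose `i`-th row is `∇φ_i(ν₂) - ∇φ_i(ν₁)`. -/
noncomputable def gradDiff {d k : ℕ}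
    (Φ : EuclideanSpace ℝ (Fin d) → EuclideanSpace ℝ (Fin k))
    (ν₁ ν₂ : EuclideanSpace ℝ (Fin d)) : Matrix (Fin k) (Fin d) ℝ :=
  Matrix.of fun i j =>
    partialDeriv (fun ξ => Φ ξ i) j ν₂ - partialDeriv (fun ξ => Φ ξ i) j ν₁

/-- The bordered matrix `M(t, ν₁, ν₂, ν)`. -/
noncomputable def borderedMatrix {d k : ℕ}
    (Φ : EuclideanSpace ℝ (Fin d) → EuclideanSpace ℝ (Fin k))
    (t : EuclideanSpace ℝ (Fin k)) (ν₁ ν₂ ν : EuclideanSpace ℝ (Fin d)) :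
    Matrix (Fin k ⊕ Fin d) (Fin k ⊕ Fin d) ℝ :=
  Matrix.fromBlocks 0 (gradDiff Φ ν₁ ν₂) (gradDiff Φ ν₁ ν₂)ᵀ
    (∑ i, t i • hessian (fun ξ => Φ ξ i) ν)

/-- The extension operator over `S`:
`(x, t) ↦ ∫_S e^{2πi(x·ξ + t·Φ(ξ))} f(ξ) dξ`. -/
noncomputable def extensionOp {d k : ℕ}
    (Φ : EuclideanSpace ℝ (Fin d) → EuclideanSpace ℝ (Fin k))
    (S : Set (EuclideanSpace ℝ (Fin d))) (f : EuclideanSpace ℝ (Fin d) → ℂ)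
    (z : EuclideanSpace ℝ (Fin d) × EuclideanSpace ℝ (Fin k)) : ℂ :=
  ∫ ξ in S, Complex.exp (2 * (Real.pi : ℂ) * Complex.I *
    (((inner ℝ z.1 ξ + inner ℝ z.2 (Φ ξ) : ℝ)) : ℂ)) * f ξ

end BilinearExtension

namespace BilinearExtension

set_option linter.unusedSectionVars false

/-! ### Non-stationary phase with parameters. -/

section Oscillatory

variable {E X : Type*} [NormedAddCommGroup E] [InnerProductSpace ℝ E] [FiniteDimensional ℝ E]
  [MeasurableSpace E] [BorelSpace E] [NormedAddCommGroup X] [NormedSpace ℝ X]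

/-! For `q = ∞` the estimate is the trivial `L¹ × L¹ → L^∞`. Interpolation with it
(`enorm_integral_mul_extFun_le`) and Hölder on the bounded cubes reduce everything to `L^{p₀} ×
L^{p₀} → L²` with `p₀ = 4(d+k)/(3d+k)` (`critExp`). By compactness (`critEstimate_of_isCompact`) `f`
and `g` may be supported near single points `ν₁`, `ν₂`.

Plancherel turns the squared `L²` norm into an integral over quadruples with `x + z = x' + z'` and
`Φ x + Φ z = Φ x' + Φ z'`. The delta function in the second constraint is replaced by a Gaussian of
width `Λ⁻¹`; its kernel is positive, so `f` and `g` may be replaced by their absolute values. The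
result is `quadForm`, to be bounded uniformly in `Λ`.

For fixed `z` there remains a bilinear form in `(x, x')`: averaging over the set `defect Φ z x x' =
0`, of codimension `k`. The central estimate, `exists_restricted_estimate`, bounds it on indicators
of `A` and `A'` by `(|A||A'|)^(d/(d+k))`. For `k < d` the kernel is split at a frequency `l`: the
low part is pointwise `O(l^k)`, the high part has `L²` size `O(l^((k-d)/2))`, and the two balance at
`l = (|A||A'|)^(-1/(d+k))`. For `k = d` bounds on row and column integrals suffice.

The `L²` bound is a `T*T` argument. With `D = Φ'(ν₂) - Φ'(ν₁)`, the kernel of `T*T` at `(x', y)` is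
treated in two regimes. If `D(x' - y)` is not small relative to `x' - y`, the defects of `x'` and
`y` differ by a multiple of `|x' - y|`, and at every `x` one of the two factors is small
(`exists_ttKernel_far_le`). Otherwise one integrates by parts in `x`: after normalisation the
gradient of the phase is close to `-Dᵗτ + (σ·H)w` with `w` nearly in `ker D` and `|σ| = 1`.
Invertibility of the bordered matrix says exactly that `Dw = 0` and `Dᵗτ + (σ·H)w = 0` force `τ = 0`
and `w = 0`, so there is no stationary point (`exists_norm_integral_defect_le`).

Restricted estimates become strong ones without loss. Fixing a variable in each of the four sets and
taking geometric means gives an extra factor `min(|A|,|A'|)^(1/2)` in place of a symmetric one,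
which gains when the dyadic levels differ, and the sum over level sets converges at the endpoint
(`exists_tsum_dyadic_le`, `exists_quadForm_le_of_restricted`). -/

lemma exists_contDiff_eq_inv {c : ℝ} (hc : 0 < c) :
    ∃ h : ℝ → ℝ, ContDiff ℝ ∞ h ∧ ∀ s, c ≤ s → h s * s = 1 := by
  refine ⟨fun s => Real.smoothTransition ((2 / c) * s - 1) * s⁻¹, ?_, ?_⟩
  · rw [contDiff_iff_contDiffAt]
    intro s
    by_cases hs : s = 0
    · subst hs
      have : (fun s : ℝ => Real.smoothTransition ((2 / c) * s - 1) * s⁻¹) =ᶠ[nhds 0]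
          fun _ => 0 := by
        have h0 : ∀ᶠ s : ℝ in nhds 0, (2 / c) * s - 1 < 0 := by
          apply ContinuousAt.eventually_lt (by fun_prop) (by fun_prop)
          norm_num
        filter_upwards [h0] with s hs
        rw [Real.smoothTransition.zero_of_nonpos hs.le, zero_mul]
      exact contDiffAt_const.congr_of_eventuallyEq this
    · exact ((Real.smoothTransition.contDiff.comp (by fun_prop)).contDiffAt).mul
        (contDiffAt_inv ℝ hs)
  · intro s hs
    have hs0 : 0 < s := hc.trans_le hs
    have : (1 : ℝ) ≤ (2 / c) * s - 1 := by
      have : (2 / c) * c ≤ (2 / c) * s := by gcongr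
      rw [div_mul_cancel₀ _ hc.ne'] at this
      linarith
    simp only [Real.smoothTransition.one_of_one_le this, one_mul]
    field_simp

/-- Integration by parts against an oscillating exponential, in the direction `v`. -/
lemma integral_mul_exp_fderiv {φ : E → ℝ} {A : E → ℂ} (Λ : ℝ) (v : E)
    (hA : ContDiff ℝ 1 A) (hAc : HasCompactSupport A) (hφ : ContDiff ℝ 1 φ) :
    ∫ x, A x * ((fderiv ℝ φ x v : ℝ) : ℂ) * (Λ * Complex.I) *
        Complex.exp (((Λ * φ x : ℝ) : ℂ) * Complex.I) =
      -∫ x, fderiv ℝ A x v * Complex.exp (((Λ * φ x : ℝ) : ℂ) * Complex.I) := by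
  set e : E → ℂ := fun x => Complex.exp (((Λ * φ x : ℝ) : ℂ) * Complex.I) with he
  have hder : ∀ x, HasFDerivAt e
      (e x • (Complex.I • (Complex.ofRealCLM.comp (Λ • fderiv ℝ φ x)))) x := by
    intro x
    have h1 : HasFDerivAt (fun x => Λ * φ x) (Λ • fderiv ℝ φ x) x :=
      ((hφ.differentiable one_ne_zero x).hasFDerivAt).const_mul Λ
    have h2 := (Complex.ofRealCLM.hasFDerivAt (x := Λ * φ x)).comp x h1
    exact (h2.mul_const Complex.I).cexp
  have hec : Continuous e := continuous_iff_continuousAt.2 fun x => (hder x).continuousAt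
  have hfd : ∀ x, fderiv ℝ e x v = e x * (Complex.I * (Λ * (fderiv ℝ φ x v : ℝ))) := by
    intro x
    rw [(hder x).fderiv]
    simp
  have hφ' : Continuous fun x => fderiv ℝ φ x v :=
    (hφ.continuous_fderiv one_ne_zero).clm_apply continuous_const
  have hA' : Continuous fun x => fderiv ℝ A x v :=
    (hA.continuous_fderiv one_ne_zero).clm_apply continuous_const
  have key := integral_mul_fderiv_eq_neg_fderiv_mul_of_integrable (μ := volume) (f := A) (g := e)
    (v := v) ?_ ?_ ?_ (fun x _ => hA.differentiable one_ne_zero x)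
    (fun x _ => (hder x).differentiableAt)
  · rw [← key]
    congr 1 with x
    rw [hfd]
    ring
  · exact (hA'.mul hec).integrable_of_hasCompactSupport
      ((hAc.fderiv_apply ℝ v).mul_right)
  · have : Continuous fun x => fderiv ℝ e x v := by
      simp_rw [hfd]
      fun_prop
    exact (hA.continuous.mul this).integrable_of_hasCompactSupport hAc.mul_right
  · exact (hA.continuous.mul hec).integrable_of_hasCompactSupport hAc.mul_right

/-- Non-stationary phase, uniformly for parameters in a compact set. -/
theorem exists_norm_integral_oscillatory_le_pow {φ : E × X → ℝ} (hφ : ContDiff ℝ ∞ φ)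
    {K : Set E} {Θ : Set X} (hK : IsCompact K) (hΘ : IsCompact Θ)
    (hgrad : ∀ x ∈ K, ∀ θ ∈ Θ, ∃ v, fderiv ℝ φ (x, θ) (v, 0) ≠ 0) (M : ℕ) :
    ∀ a : E × X → ℂ, ContDiff ℝ ∞ a → (∀ x ∉ K, ∀ θ, a (x, θ) = 0) →
      ∃ C : ℝ, 0 ≤ C ∧ ∀ θ ∈ Θ, ∀ Λ : ℝ, 0 < Λ →
        ‖∫ x, a (x, θ) * Complex.exp (((Λ * φ (x, θ) : ℝ) : ℂ) * Complex.I)‖ * Λ ^ M ≤ C := by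
  classical
  set b := stdOrthonormalBasis ℝ E with hb
  set g : Fin (Module.finrank ℝ E) → E × X → ℝ := fun i p => fderiv ℝ φ p (b i, 0) with hg
  have hφd : ContDiff ℝ ∞ (fderiv ℝ φ) := hφ.fderiv_right (by simp)
  have hgs : ∀ i, ContDiff ℝ ∞ (g i) := fun i => hφd.clm_apply contDiff_const
  set N : E × X → ℝ := fun p => ∑ i, g i p ^ 2 with hN
  have hNs : ContDiff ℝ ∞ N := ContDiff.sum fun i _ => (hgs i).pow 2
  have hNpos : ∀ p ∈ K ×ˢ Θ, 0 < N p := by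
    rintro ⟨x, θ⟩ ⟨hx, hθ⟩
    obtain ⟨v, hv⟩ := hgrad x hx θ hθ
    by_contra hcon
    have h0 : N (x, θ) = 0 := le_antisymm (not_lt.1 hcon) (Finset.sum_nonneg fun i _ => sq_nonneg _)
    have h1 : ∀ i, g i (x, θ) = 0 := fun i => by
      have := (Finset.sum_eq_zero_iff_of_nonneg (fun i _ => sq_nonneg (g i (x, θ)))).1 h0 i
        (Finset.mem_univ i)
      simpa using this
    apply hv
    have : ((v, 0) : E × X) = ∑ i, b.repr v i • ((b i, 0) : E × X) := by
      ext
      · simp only [Prod.fst_sum, Prod.smul_fst, b.sum_repr]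
      · simp [Prod.snd_sum]
    rw [this, map_sum]
    refine Finset.sum_eq_zero fun i _ => ?_
    rw [map_smul]
    have := h1 i
    simp only [hg] at this
    rw [this, smul_zero]
  obtain ⟨c, hc, hcN⟩ : ∃ c > 0, ∀ p ∈ K ×ˢ Θ, c ≤ N p := by
    rcases (K ×ˢ Θ).eq_empty_or_nonempty with he | hne
    · exact ⟨1, one_pos, by simp [he]⟩
    · obtain ⟨p, hp, hmin⟩ := (hK.prod hΘ).exists_isMinOn hne hNs.continuous.continuousOn
      exact ⟨N p, hNpos p hp, fun q hq => hmin hq⟩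
  -- `N` may vanish away from `K ×ˢ Θ`, so `1 / N` is replaced by the globally smooth `h ∘ N`, which
  -- agrees with it where `N ≥ c`. All amplitudes then stay smooth on the whole space.
  obtain ⟨h, hhs, hh⟩ := exists_contDiff_eq_inv hc
  induction M with
  | zero =>
    intro a ha haK
    obtain ⟨B, hB⟩ := (hK.prod hΘ).exists_bound_of_continuousOn ha.continuous.continuousOn
    refine ⟨|B| * volume.real K, by positivity, fun θ hθ Λ _ => ?_⟩
    rw [pow_zero, mul_one]
    have h1 : ∫ x, a (x, θ) * Complex.exp (((Λ * φ (x, θ) : ℝ) : ℂ) * Complex.I) =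
        ∫ x in K, a (x, θ) * Complex.exp (((Λ * φ (x, θ) : ℝ) : ℂ) * Complex.I) := by
      rw [setIntegral_eq_integral_of_forall_compl_eq_zero]
      intro x hx
      rw [haK x hx, zero_mul]
    rw [h1]
    refine norm_setIntegral_le_of_norm_le_const hK.measure_lt_top fun x hx => ?_
    rw [norm_mul, Complex.norm_exp_ofReal_mul_I, mul_one]
    exact (hB (x, θ) ⟨hx, hθ⟩).trans (le_abs_self B)
  | succ M ih =>
    intro a ha haK
    -- Chosen so that `∑ A i * g i = a`: the amplitude becomes the derivative of the phase along a
    -- vector field. One integration by parts then gains a factor `Λ` and replaces `a` by the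
    -- divergence `L`, again smooth and vanishing off `K`.
    set A : Fin (Module.finrank ℝ E) → E × X → ℂ := fun i p =>
      a p * ((h (N p) * g i p : ℝ) : ℂ) with hA
    have hAs : ∀ i, ContDiff ℝ ∞ (A i) := fun i =>
      ha.mul (Complex.ofRealCLM.contDiff.comp ((hhs.comp hNs).mul (hgs i)))
    set L : E × X → ℂ := fun p => ∑ i, fderiv ℝ (A i) p (b i, 0) with hL
    have hLs : ContDiff ℝ ∞ L := ContDiff.sum fun i _ =>
      ((hAs i).fderiv_right (m := ∞) (by simp)).clm_apply contDiff_const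
    have hpart : ∀ {G : Type _} [NormedAddCommGroup G] [NormedSpace ℝ G] (f : E × X → G),
        ContDiff ℝ ∞ f → ∀ x θ v, fderiv ℝ (fun y => f (y, θ)) x v = fderiv ℝ f (x, θ) (v, 0) := by
      intro G _ _ f hf x θ v
      have h1 : HasFDerivAt (fun y : E => (y, θ)) (ContinuousLinearMap.inl ℝ E X) x :=
        hasFDerivAt_prodMk_left x θ
      have h2 := (hf.differentiable (by simp) (x, θ)).hasFDerivAt.comp x h1
      have h3 : fderiv ℝ (fun y => f (y, θ)) x = _ := h2.fderiv
      rw [h3]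
      simp
    have hAK : ∀ i, ∀ x ∉ K, ∀ θ, A i (x, θ) = 0 := fun i x hx θ => by
      simp [hA, haK x hx θ]
    have hLK : ∀ x ∉ K, ∀ θ, L (x, θ) = 0 := by
      intro x hx θ
      refine Finset.sum_eq_zero fun i _ => ?_
      rw [← hpart _ (hAs i)]
      have : (fun y => A i (y, θ)) =ᶠ[nhds x] fun _ => 0 := by
        filter_upwards [hK.isClosed.isOpen_compl.mem_nhds hx] with y hy using hAK i y hy θ
      rw [this.fderiv_eq]
      simp
    obtain ⟨C, hC0, hC⟩ := ih L hLs hLK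
    refine ⟨C, hC0, fun θ hθ Λ hΛ => ?_⟩
    set e : E → ℂ := fun x => Complex.exp (((Λ * φ (x, θ) : ℝ) : ℂ) * Complex.I) with he
    have hslice : ContDiff ℝ ∞ fun x : E => ((x, θ) : E × X) := contDiff_prodMk_left θ
    have hcomp : ∀ i, HasCompactSupport fun x => A i (x, θ) := fun i =>
      HasCompactSupport.intro hK fun x hx => hAK i x hx θ
    have hec : Continuous e := by
      have := hφ.continuous
      fun_prop
    have hparts : ∀ i, ∫ x, A i (x, θ) * (g i (x, θ) : ℝ) * (Λ * Complex.I) * e x =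
        -∫ x, fderiv ℝ (A i) (x, θ) (b i, 0) * e x := by
      intro i
      have := integral_mul_exp_fderiv (A := fun x => A i (x, θ))
        (φ := fun x => φ (x, θ)) Λ (b i) (((hAs i).comp hslice).of_le (by simp)) (hcomp i)
        ((hφ.comp hslice).of_le (by simp))
      simp only [hpart _ (hAs i), hpart _ hφ] at this
      exact this
    have hgc : ∀ i, Continuous fun x => g i (x, θ) := fun i =>
      (hgs i).continuous.comp hslice.continuous
    have hAc : ∀ i, Continuous fun x => A i (x, θ) := fun i =>
      (hAs i).continuous.comp hslice.continuous
    have hsum : (Λ * Complex.I) * ∫ x, a (x, θ) * e x = -∫ x, L (x, θ) * e x := by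
      have h1 : ∀ x, L (x, θ) * e x = ∑ i, fderiv ℝ (A i) (x, θ) (b i, 0) * e x := fun x => by
        simp only [hL, Finset.sum_mul]
      have hcd : ∀ i, Continuous fun x => fderiv ℝ (A i) (x, θ) (b i, 0) := fun i =>
        ((((hAs i).fderiv_right (m := ∞) (by simp)).clm_apply
          contDiff_const).continuous).comp hslice.continuous
      have h2 : ∀ i, HasCompactSupport fun x => fderiv ℝ (A i) (x, θ) (b i, 0) := fun i => by
        have := (hcomp i).fderiv_apply ℝ (b i)
        simpa only [hpart _ (hAs i)] using this
      simp_rw [h1]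
      have hi1 : ∀ i, Integrable fun x => fderiv ℝ (A i) (x, θ) (b i, 0) * e x := fun i =>
        ((hcd i).mul hec).integrable_of_hasCompactSupport (h2 i).mul_right
      have hi2 : ∀ i, Integrable fun x =>
          A i (x, θ) * (g i (x, θ) : ℝ) * (Λ * Complex.I) * e x := fun i =>
        Continuous.integrable_of_hasCompactSupport (by have := hAc i; have := hgc i; fun_prop)
          (hcomp i).mul_right.mul_right.mul_right
      rw [integral_finsetSum _ fun i _ => hi1 i, ← Finset.sum_neg_distrib]
      simp_rw [← hparts]
      rw [← integral_finsetSum _ fun i _ => hi2 i, ← integral_const_mul]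
      congr 1 with x
      rw [← Finset.sum_mul, ← Finset.sum_mul]
      have h3 : ∑ i, A i (x, θ) * ((g i (x, θ) : ℝ) : ℂ) = a (x, θ) := by
        by_cases hx : x ∈ K
        · have h4 : ∑ i, A i (x, θ) * ((g i (x, θ) : ℝ) : ℂ) =
              a (x, θ) * ((h (N (x, θ)) * N (x, θ) : ℝ) : ℂ) := by
            simp only [hA, hN]
            push_cast
            rw [Finset.mul_sum, Finset.mul_sum]
            exact Finset.sum_congr rfl fun i _ => by ring
          rw [h4, hh _ (hcN _ ⟨hx, hθ⟩)]
          simp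
        · simp [hAK _ x hx θ, haK x hx θ]
      rw [h3]
      ring
    have hnorm : Λ * ‖∫ x, a (x, θ) * e x‖ = ‖∫ x, L (x, θ) * e x‖ := by
      have := congrArg norm hsum
      rw [norm_neg, norm_mul, norm_mul, Complex.norm_I, mul_one, Complex.norm_real,
        Real.norm_of_nonneg hΛ.le] at this
      exact this
    have := hC θ hθ Λ hΛ
    rw [← hnorm] at this
    calc _ = Λ * ‖∫ x, a (x, θ) * e x‖ * Λ ^ M := by rw [pow_succ]; ring
      _ ≤ C := this

/-- Integration by parts is useful for `Λ ≥ 1`; for `Λ ≤ 1` the amplitude is simply bounded. In both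
ranges `1 + Λ ≤ 2 max(1, Λ)`, whence the factor `2 ^ M`. -/
theorem exists_norm_integral_oscillatory_le {φ : E × X → ℝ} (hφ : ContDiff ℝ ∞ φ)
    {K : Set E} {Θ : Set X} (hK : IsCompact K) (hΘ : IsCompact Θ)
    (hgrad : ∀ x ∈ K, ∀ θ ∈ Θ, ∃ v, fderiv ℝ φ (x, θ) (v, 0) ≠ 0) (M : ℕ)
    (a : E × X → ℂ) (ha : ContDiff ℝ ∞ a) (haK : ∀ x ∉ K, ∀ θ, a (x, θ) = 0) :
    ∃ C : ℝ, 0 ≤ C ∧ ∀ θ ∈ Θ, ∀ Λ : ℝ, 0 ≤ Λ →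
        ‖∫ x, a (x, θ) * Complex.exp (((Λ * φ (x, θ) : ℝ) : ℂ) * Complex.I)‖ ≤
          C * ((1 + Λ) ^ M)⁻¹ := by
  obtain ⟨B, hB⟩ := (hK.prod hΘ).exists_bound_of_continuousOn ha.continuous.continuousOn
  obtain ⟨C₁, hC₁0, hC₁⟩ := exists_norm_integral_oscillatory_le_pow hφ hK hΘ hgrad M a ha haK
  have hC₀ : ∀ θ ∈ Θ, ∀ Λ : ℝ,
      ‖∫ x, a (x, θ) * Complex.exp (((Λ * φ (x, θ) : ℝ) : ℂ) * Complex.I)‖ ≤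
        |B| * volume.real K := by
    intro θ hθ Λ
    rw [← setIntegral_eq_integral_of_forall_compl_eq_zero (s := K)
      (fun x hx => by rw [haK x hx, zero_mul])]
    refine norm_setIntegral_le_of_norm_le_const hK.measure_lt_top fun x hx => ?_
    rw [norm_mul, Complex.norm_exp_ofReal_mul_I, mul_one]
    exact (hB (x, θ) ⟨hx, hθ⟩).trans (le_abs_self B)
  refine ⟨2 ^ M * (|B| * volume.real K + C₁), by positivity, fun θ hθ Λ hΛ => ?_⟩
  set I := ‖∫ x, a (x, θ) * Complex.exp (((Λ * φ (x, θ) : ℝ) : ℂ) * Complex.I)‖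
  rw [← div_eq_mul_inv, le_div_iff₀ (by positivity)]
  have hI : 0 ≤ I := norm_nonneg _
  have h0 : I ≤ |B| * volume.real K := hC₀ θ hθ Λ
  rcases le_total Λ 1 with h | h
  · calc I * (1 + Λ) ^ M ≤ (|B| * volume.real K) * 2 ^ M := by
          gcongr
          linarith
      _ ≤ _ := by
        rw [mul_comm]
        gcongr
        linarith
  · have h1 := hC₁ θ hθ Λ (by linarith)
    calc I * (1 + Λ) ^ M ≤ I * (2 * Λ) ^ M := by
          gcongr
          linarith
      _ = 2 ^ M * (I * Λ ^ M) := by rw [mul_pow]; ring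
      _ ≤ _ := by
        gcongr
        have : 0 ≤ |B| * volume.real K := by positivity
        exact h1.trans (by linarith)

end Oscillatory

/-! ### Smooth difference quotients (Hadamard's lemma). -/

section Hadamard

variable {E F : Type*} [NormedAddCommGroup E] [NormedSpace ℝ E]
  [NormedAddCommGroup F] [NormedSpace ℝ F] [CompleteSpace F]

/-- The integral is the value at `0` of a convolution with the indicator of `[-1, 0]`, the
reflection of `[0, 1]`, so smoothness of parametrised convolutions applies. The bump `χ` equals `1`
on `[-1, 1]` and supplies the compact support. -/
lemma contDiff_intervalIntegral_param {P G : Type*} [NormedAddCommGroup P] [NormedSpace ℝ P]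
    [NormedAddCommGroup G] [NormedSpace ℝ G] [CompleteSpace G]
    {f : P × ℝ → G} (hf : ContDiff ℝ ∞ f) :
    ContDiff ℝ ∞ fun p => ∫ r in (0 : ℝ)..1, f (p, r) := by
  let χ : ContDiffBump (0 : ℝ) := ⟨1, 2, one_pos, by norm_num⟩
  let u : ℝ → ℝ := (Set.Icc (-1 : ℝ) 0).indicator 1
  have hu : LocallyIntegrable u volume :=
    ((integrable_indicator_iff measurableSet_Icc).2
      (integrableOn_const (by simp) (by simp))).locallyIntegrable
  have key := contDiffOn_convolution_right_with_param (𝕜 := ℝ) (n := ⊤) (μ := volume) (f := u)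
    (ContinuousLinearMap.lsmul ℝ ℝ) (g := fun (p : P) (r : ℝ) => χ r • f (p, r)) (s := Set.univ)
    (k := Metric.closedBall (0 : ℝ) 2) isOpen_univ (isCompact_closedBall _ _) ?_ hu ?_
  · have h2 : ContDiff ℝ ∞ fun p : P => ((p, 0) : P × ℝ) := contDiff_prodMk_left 0
    have h3 := (contDiffOn_univ.1 (by simpa using key)).comp h2
    convert h3 using 2 with p
    simp only [Function.comp, convolution, ContinuousLinearMap.lsmul_apply, zero_sub]
    rw [intervalIntegral.integral_of_le zero_le_one, ← integral_Icc_eq_integral_Ioc,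
      ← integral_indicator measurableSet_Icc, ← integral_neg_eq_self]
    congr 1 with r
    by_cases hr : -r ∈ Set.Icc (0 : ℝ) 1
    · have : r ∈ Set.Icc (-1 : ℝ) 0 := ⟨by linarith [hr.2], by linarith [hr.1]⟩
      have h1 : χ (-r) = 1 := χ.one_of_mem_closedBall (by
        rw [mem_closedBall_zero_iff, Real.norm_eq_abs, abs_of_nonneg hr.1]; exact hr.2)
      rw [Set.indicator_of_mem hr]
      simp only [u, Set.indicator_of_mem this, h1, Pi.one_apply, one_smul]
    · have : r ∉ Set.Icc (-1 : ℝ) 0 := fun h => hr ⟨by linarith [h.2], by linarith [h.1]⟩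
      rw [Set.indicator_of_notMem hr]
      simp only [u, Set.indicator_of_notMem this, zero_smul]
  · intro p x _ hx
    have : χ x = 0 := χ.zero_of_le_dist (by
      simpa using (not_le.1 (by simpa using hx : ¬ |x| ≤ 2)).le)
    simp [this]
  · have : ContDiff ℝ ∞ fun q : P × ℝ => χ q.2 • f q := (χ.contDiff.comp contDiff_snd).smul hf
    exact this.contDiffOn

/-- The averaged derivative of `Φ` along the segment from `y'` to `y`. -/
noncomputable def avgDeriv (Φ : E → F) (q : E × E) : E →L[ℝ] F :=
  ∫ r in (0 : ℝ)..1, fderiv ℝ Φ (q.2 + r • (q.1 - q.2))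

lemma contDiff_avgDeriv {Φ : E → F} (hΦ : ContDiff ℝ ∞ Φ) : ContDiff ℝ ∞ (avgDeriv Φ) := by
  have h : ContDiff ℝ ∞ fun p : (E × E) × ℝ =>
      fderiv ℝ Φ (p.1.2 + p.2 • (p.1.1 - p.1.2)) :=
    (hΦ.fderiv_right (m := ∞) (by simp)).comp (by fun_prop)
  exact contDiff_intervalIntegral_param h

lemma avgDeriv_self (Φ : E → F) (y : E) : avgDeriv Φ (y, y) = fderiv ℝ Φ y := by
  simp [avgDeriv]

/-- Differences of `Φ` become linear in the increment with smooth coefficients. Hence they can be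
rescaled by `|y - y'|` while the coefficients stay smooth across the diagonal. -/
lemma avgDeriv_apply_sub {Φ : E → F} (hΦ : ContDiff ℝ ∞ Φ) (y y' : E) :
    avgDeriv Φ (y, y') (y - y') = Φ y - Φ y' := by
  have hd : Continuous (fderiv ℝ Φ) := hΦ.continuous_fderiv (by simp)
  have hc : Continuous fun r : ℝ => fderiv ℝ Φ (y' + r • (y - y')) := hd.comp (by fun_prop)
  rw [avgDeriv, ContinuousLinearMap.intervalIntegral_apply (hc.intervalIntegrable _ _)]
  have hder : ∀ r ∈ Set.uIcc (0 : ℝ) 1, HasDerivAt (fun r : ℝ => Φ (y' + r • (y - y')))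
      (fderiv ℝ Φ (y' + r • (y - y')) (y - y')) r := by
    intro r _
    have h1 : HasDerivAt (fun r : ℝ => y' + r • (y - y')) (y - y') r := by
      simpa using ((hasDerivAt_id r).smul_const (y - y')).const_add y'
    exact (hΦ.differentiable (by simp) _).hasFDerivAt.comp_hasDerivAt r h1
  rw [intervalIntegral.integral_eq_sub_of_hasDerivAt hder
    ((hc.clm_apply continuous_const).intervalIntegrable _ _)]
  simp

end Hadamard

/-! ### Polynomially decaying weights and their integrals. -/

section Weight

variable {F : Type*} [SeminormedAddCommGroup F]

/-- Polynomial decay `(1 + μ‖u‖)^{-N}` at scale `μ⁻¹`. -/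
noncomputable def decay (N : ℕ) (μ : ℝ) (u : F) : ℝ := ((1 + μ * ‖u‖) ^ N)⁻¹

lemma decay_nonneg (N : ℕ) {μ : ℝ} (hμ : 0 ≤ μ) (u : F) : 0 ≤ decay N μ u := by
  unfold decay; positivity

lemma continuous_decay (N : ℕ) {μ : ℝ} (hμ : 0 ≤ μ) : Continuous (decay (F := F) N μ) := by
  unfold decay
  refine Continuous.inv₀ (by fun_prop) fun u => ?_
  positivity

end Weight

section Decay

variable {E F : Type*} [NormedAddCommGroup E] [InnerProductSpace ℝ E] [FiniteDimensional ℝ E]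
  [MeasurableSpace E] [BorelSpace E]
  [NormedAddCommGroup F] [InnerProductSpace ℝ F] [FiniteDimensional ℝ F]
  [MeasurableSpace F] [BorelSpace F]

lemma lintegral_decay (N : ℕ) (hN : Module.finrank ℝ F < N) :
    ∃ C : ℝ≥0, ∀ μ : ℝ, 0 < μ → ∫⁻ u : F, ENNReal.ofReal (decay N μ u) ≤
      C * ENNReal.ofReal ((μ ^ Module.finrank ℝ F)⁻¹) := by
  have hint : Integrable (fun u : F => decay N 1 u) := by
    have := integrable_one_add_norm (E := F) (μ := volume) (r := N) (by exact_mod_cast hN)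
    refine this.congr (Filter.Eventually.of_forall fun u => ?_)
    simp only [decay, one_mul]
    rw [Real.rpow_neg (by positivity), Real.rpow_natCast]
  refine ⟨(∫ u : F, decay N 1 u).toNNReal, fun μ hμ => ?_⟩
  have hsc : ∀ u : F, decay N μ u = decay N 1 (μ • u) := fun u => by
    simp [decay, norm_smul, abs_of_pos hμ]
  simp_rw [hsc]
  rw [← ofReal_integral_eq_lintegral_ofReal (hint.comp_smul hμ.ne')
    (Filter.Eventually.of_forall fun u => decay_nonneg N zero_le_one _),
    Measure.integral_comp_smul volume (fun u : F => decay N 1 u) μ, smul_eq_mul,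
    abs_of_pos (by positivity), mul_comm, ENNReal.ofReal_mul
      (integral_nonneg fun u => decay_nonneg N zero_le_one u)]
  rfl

/-- A map that contracts distances by at most a factor `2` behaves like a translation: `p` is
compared with `y - y₀`, where `y₀` nearly minimises `‖p‖`. Only distances enter, so the constant
does not depend on `p` or `S`. -/
lemma lintegral_decay_comp_le (N : ℕ) (hN : Module.finrank ℝ F < N) :
    ∃ C : ℝ≥0, ∀ μ : ℝ, 0 < μ → ∀ (S : Set F) (p : F → F), MeasurableSet S →
      (∀ y ∈ S, ∀ y' ∈ S, ‖y - y'‖ ≤ 2 * ‖p y - p y'‖) →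
      ∫⁻ y in S, ENNReal.ofReal (decay N μ (p y)) ≤
        C * ENNReal.ofReal ((μ ^ Module.finrank ℝ F)⁻¹) := by
  obtain ⟨C, hC⟩ := lintegral_decay (F := F) N hN
  refine ⟨4 ^ N * C, fun μ hμ S p hS hp => ?_⟩
  rcases S.eq_empty_or_nonempty with rfl | hne
  · simp
  -- The infimum need not be attained; an error `μ⁻¹` is invisible to the weight at scale `μ⁻¹`. It
  -- gives `1 + μ‖y - y₀‖ ≤ 4(1 + μ‖p y‖)`, hence `4 ^ N` below.
  obtain ⟨y₀, hy₀, hmin⟩ : ∃ y₀ ∈ S, ∀ y ∈ S, ‖p y₀‖ ≤ ‖p y‖ + μ⁻¹ := by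
    set s : Set ℝ := (fun y => ‖p y‖) '' S
    have hsne : s.Nonempty := hne.image _
    have hbdd : BddBelow s := ⟨0, by rintro _ ⟨y, _, rfl⟩; exact norm_nonneg _⟩
    obtain ⟨_, ⟨y₀, hy₀, rfl⟩, hlt⟩ := exists_lt_of_csInf_lt hsne
      (lt_add_of_pos_right (sInf s) (inv_pos.2 hμ))
    exact ⟨y₀, hy₀, fun y hy => hlt.le.trans (by gcongr; exact csInf_le hbdd ⟨y, hy, rfl⟩)⟩
  have hpt : ∀ y ∈ S, decay N μ (p y) ≤ 4 ^ N * decay N μ (y - y₀) := by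
    intro y hy
    have h1 : ‖y - y₀‖ ≤ 4 * ‖p y‖ + 2 * μ⁻¹ := by
      have := hp y hy y₀ hy₀
      have h2 := norm_sub_le (p y) (p y₀)
      linarith [hmin y hy]
    have h2 : μ * ‖y - y₀‖ ≤ 4 * (μ * ‖p y‖) + 2 := by
      calc μ * ‖y - y₀‖ ≤ μ * (4 * ‖p y‖ + 2 * μ⁻¹) := by gcongr
        _ = _ := by field_simp
    unfold decay
    rw [← div_eq_mul_inv, le_div_iff₀ (by positivity), mul_comm, ← div_eq_mul_inv,
      div_le_iff₀ (by positivity), ← mul_pow]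
    gcongr
    linarith
  calc ∫⁻ y in S, ENNReal.ofReal (decay N μ (p y))
      ≤ ∫⁻ y in S, ENNReal.ofReal (4 ^ N) * ENNReal.ofReal (decay N μ (y - y₀)) := by
        refine setLIntegral_mono' hS fun y hy => ?_
        rw [← ENNReal.ofReal_mul (by positivity)]
        exact ENNReal.ofReal_le_ofReal (hpt y hy)
    _ ≤ ∫⁻ y, ENNReal.ofReal (4 ^ N) * ENNReal.ofReal (decay N μ (y - y₀)) :=
        setLIntegral_le_lintegral _ _
    _ = ENNReal.ofReal (4 ^ N) * ∫⁻ y : F, ENNReal.ofReal (decay N μ y) := by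
        rw [lintegral_const_mul' _ _ ENNReal.ofReal_ne_top,
          lintegral_sub_right_eq_self (fun y : F => ENNReal.ofReal (decay N μ y))]
    _ ≤ ENNReal.ofReal (4 ^ N) * (C * ENNReal.ofReal ((μ ^ Module.finrank ℝ F)⁻¹)) := by
        gcongr
        exact hC μ hμ
    _ = _ := by
        rw [ENNReal.ofReal_pow (by norm_num)]
        push_cast
        rw [mul_assoc]
        norm_num

/-- Decay of a function that separates points in the directions of the range of `J`. -/
theorem exists_setLIntegral_decay_le (J : F →L[ℝ] E) (r : ℝ) (N : ℕ)
    (hN : Module.finrank ℝ F < N) :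
    ∃ C : ℝ≥0, ∀ (c : E) (p : E → F), Continuous p →
      (∀ x ∈ Metric.closedBall c r, ∀ y : F, x + J y ∈ Metric.closedBall c r →
        ‖y‖ ≤ 2 * ‖p (x + J y) - p x‖) → ∀ μ : ℝ, 0 < μ →
      ∫⁻ x in Metric.closedBall c r, ENNReal.ofReal (decay N μ (p x)) ≤
        C * ENNReal.ofReal ((μ ^ Module.finrank ℝ F)⁻¹) := by
  obtain ⟨C₀, hC₀⟩ := lintegral_decay_comp_le (F := F) N hN
  set Y : Set F := Metric.closedBall 0 1 with hY
  have hY0 : volume Y ≠ 0 := (Metric.measure_closedBall_pos volume _ one_pos).ne'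
  have hYt : volume Y ≠ ⊤ := measure_closedBall_lt_top.ne
  set V := volume (Metric.closedBall (0 : E) (r + ‖J‖)) with hV
  have hVt : V ≠ ⊤ := measure_closedBall_lt_top.ne
  refine ⟨((volume Y)⁻¹ * V * C₀).toNNReal, fun c p hp hsep μ hμ => ?_⟩
  rw [ENNReal.coe_toNNReal (ENNReal.mul_ne_top (ENNReal.mul_ne_top (ENNReal.inv_ne_top.2 hY0) hVt)
    ENNReal.coe_ne_top)]
  set B := Metric.closedBall c r with hB
  have hBm : MeasurableSet B := Metric.isClosed_closedBall.measurableSet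
  set W : E → ℝ≥0∞ := B.indicator fun x => ENNReal.ofReal (decay N μ (p x)) with hW
  have hWm : Measurable W := by
    refine Measurable.indicator ?_ hBm
    exact (((continuous_decay N hμ.le).comp hp).measurable).ennreal_ofReal
  have hJm : Measurable fun q : F × E => q.2 - J q.1 :=
    (continuous_snd.sub (J.continuous.comp continuous_fst)).measurable
  -- Averaging over translates by `J y`, `y ∈ Y`: the estimate is thereby reduced to the slices in
  -- the range of `J`, where `p` separates points and the previous lemma applies.
  have h1 : volume Y * ∫⁻ x, W x = ∫⁻ x, ∫⁻ y in Y, W (x - J y) := by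
    have hm : AEMeasurable (Function.uncurry fun x y => W (x - J y))
        (volume.prod (volume.restrict Y)) := (hWm.comp (hJm.comp measurable_swap)).aemeasurable
    rw [lintegral_lintegral_swap hm]
    simp_rw [lintegral_sub_right_eq_self W]
    rw [lintegral_const, Measure.restrict_apply_univ, mul_comm]
  have h2 : ∀ x, ∫⁻ y in Y, W (x - J y) ≤
      (Metric.closedBall c (r + ‖J‖)).indicator
        (fun _ => C₀ * ENNReal.ofReal ((μ ^ Module.finrank ℝ F)⁻¹)) x := by
    intro x
    by_cases hx : x ∈ Metric.closedBall c (r + ‖J‖)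
    · rw [Set.indicator_of_mem hx]
      set S : Set F := {y | x - J y ∈ B} with hS
      have hSm : MeasurableSet S :=
        (continuous_const.sub J.continuous).measurable hBm
      calc ∫⁻ y in Y, W (x - J y) ≤ ∫⁻ y, W (x - J y) := setLIntegral_le_lintegral _ _
        _ = ∫⁻ y in S, ENNReal.ofReal (decay N μ (p (x - J y))) := by
            rw [← lintegral_indicator hSm]
            rfl
        _ ≤ _ := by
          refine hC₀ μ hμ S (fun y => p (x - J y)) hSm fun y hy y' hy' => ?_
          have := hsep (x - J y') hy' (y' - y) (by
            have : x - J y' + J (y' - y) = x - J y := by rw [map_sub]; abel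
            rw [this]; exact hy)
          have h3 : x - J y' + J (y' - y) = x - J y := by rw [map_sub]; abel
          rw [h3] at this
          rwa [norm_sub_rev]
    · rw [Set.indicator_of_notMem hx]
      refine le_of_eq ?_
      rw [← lintegral_zero (μ := volume.restrict Y)]
      refine setLIntegral_congr_fun Metric.isClosed_closedBall.measurableSet fun y hy => ?_
      refine Set.indicator_of_notMem (fun h => hx ?_) _
      rw [Metric.mem_closedBall, dist_eq_norm] at h ⊢
      rw [mem_closedBall_zero_iff] at hy
      have h4 : ‖J y‖ ≤ ‖J‖ := (J.le_opNorm y).trans (by nlinarith [norm_nonneg J])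
      calc ‖x - c‖ = ‖(x - J y - c) + J y‖ := by congr 1; abel
        _ ≤ r + ‖J‖ := (norm_add_le _ _).trans (add_le_add h h4)
  have h5 : volume (Metric.closedBall c (r + ‖J‖)) = V := Measure.addHaar_closedBall_center _ _ _
  rw [← lintegral_indicator hBm]
  change ∫⁻ x, W x ≤ _
  have h6 : ∫⁻ x, W x = (volume Y)⁻¹ * (volume Y * ∫⁻ x, W x) := by
    rw [← mul_assoc, ENNReal.inv_mul_cancel hY0 hYt, one_mul]
  rw [h6, h1, mul_assoc, mul_assoc]
  gcongr
  refine (lintegral_mono h2).trans ?_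
  rw [lintegral_indicator_const Metric.isClosed_closedBall.measurableSet, h5, mul_comm]

end Decay

/-! ### First-order behaviour of the defect. -/

section Defect

variable {E F : Type*} [NormedAddCommGroup E] [NormedSpace ℝ E]
  [NormedAddCommGroup F] [NormedSpace ℝ F]

/-- The defect of `Φ` on the quadruple `x + z = x' + (x + z - x')`. -/
def defect (Φ : E → F) (z x x' : E) : F := Φ x + Φ z - Φ x' - Φ (x + z - x')

/-- To first order the defect varies by `D` in `x'` and by `-D` in `x`, where `D = Φ'(ν₂) - Φ'(ν₁)`.
Strict differentiability at the two base points makes this uniform near them. -/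
lemma exists_defect_approx {Φ : E → F} (hΦ : ContDiff ℝ ∞ Φ) (ν₁ ν₂ : E) {ε : ℝ} (hε : 0 < ε) :
    ∃ ρ > 0, ∀ z ∈ Metric.closedBall ν₂ ρ, ∀ x ∈ Metric.closedBall ν₁ (2 * ρ),
      ∀ x' ∈ Metric.closedBall ν₁ (2 * ρ), ∀ y ∈ Metric.closedBall ν₁ (2 * ρ),
      ‖defect Φ z x x' - defect Φ z x y - (fderiv ℝ Φ ν₂ - fderiv ℝ Φ ν₁) (x' - y)‖
        ≤ ε * ‖x' - y‖ ∧
      ‖defect Φ z x x' - defect Φ z y x' + (fderiv ℝ Φ ν₂ - fderiv ℝ Φ ν₁) (x - y)‖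
        ≤ ε * ‖x - y‖ := by
  have key : ∀ ν : E, ∃ δ > 0, ∀ y ∈ Metric.ball ν δ, ∀ y' ∈ Metric.ball ν δ,
      ‖Φ y - Φ y' - fderiv ℝ Φ ν (y - y')‖ ≤ ε / 2 * ‖y - y'‖ := by
    intro ν
    have h := (hΦ.contDiffAt (x := ν)).hasStrictFDerivAt (by simp)
    obtain ⟨s, hs, happ⟩ := h.approximates_deriv_on_nhds (c := (ε / 2).toNNReal)
      (Or.inr (by simpa using hε))
    obtain ⟨δ, hδ, hsub⟩ := Metric.mem_nhds_iff.1 hs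
    exact ⟨δ, hδ, fun y hy y' hy' => by
      have := happ y (hsub hy) y' (hsub hy')
      rwa [Real.coe_toNNReal _ (by positivity)] at this⟩
  obtain ⟨δ₁, hδ₁, h₁⟩ := key ν₁
  obtain ⟨δ₂, hδ₂, h₂⟩ := key ν₂
  -- The fourth point `u + z - v` is within `2ρ + ρ + 2ρ = 5ρ` of `ν₂`; the value `6` makes the
  -- inequality strict.
  refine ⟨min δ₁ δ₂ / 6, by positivity, ?_⟩
  set ρ := min δ₁ δ₂ / 6 with hρ
  have hρ0 : 0 < ρ := by positivity
  have hρ₁ : 6 * ρ ≤ δ₁ := by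
    have := min_le_left δ₁ δ₂
    linarith
  have hρ₂ : 6 * ρ ≤ δ₂ := by
    have := min_le_right δ₁ δ₂
    linarith
  intro z hz x hx x' hx' y hy
  have hin₁ : ∀ u ∈ Metric.closedBall ν₁ (2 * ρ), u ∈ Metric.ball ν₁ δ₁ := fun u hz =>
    Metric.closedBall_subset_ball (by linarith) hz
  have hin₂ : ∀ u ∈ Metric.closedBall ν₁ (2 * ρ), ∀ v ∈ Metric.closedBall ν₁ (2 * ρ),
      u + z - v ∈ Metric.ball ν₂ δ₂ := by
    intro u hu v hv
    rw [Metric.mem_closedBall, dist_eq_norm] at hu hv hz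
    rw [Metric.mem_ball, dist_eq_norm]
    calc ‖u + z - v - ν₂‖ = ‖(u - ν₁) + (z - ν₂) - (v - ν₁)‖ := by congr 1; abel
      _ ≤ ‖u - ν₁‖ + ‖z - ν₂‖ + ‖v - ν₁‖ :=
        (norm_sub_le _ _).trans (by gcongr; exact norm_add_le _ _)
      _ < δ₂ := by linarith
  constructor
  · have e₁ := h₁ x' (hin₁ _ hx') y (hin₁ _ hy)
    have e₂ := h₂ _ (hin₂ x hx x' hx') _ (hin₂ x hx y hy)
    have e₃ : x + z - x' - (x + z - y) = -(x' - y) := by abel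
    rw [e₃, norm_neg] at e₂
    have : defect Φ z x x' - defect Φ z x y - (fderiv ℝ Φ ν₂ - fderiv ℝ Φ ν₁) (x' - y) =
        -(Φ (x + z - x') - Φ (x + z - y) - fderiv ℝ Φ ν₂ (-(x' - y))) -
          (Φ x' - Φ y - fderiv ℝ Φ ν₁ (x' - y)) := by
      simp only [defect, sub_apply, map_neg]
      abel
    rw [this]
    refine (norm_sub_le _ _).trans ?_
    rw [norm_neg]
    linarith
  · have e₁ := h₁ x (hin₁ _ hx) y (hin₁ _ hy)
    have e₂ := h₂ _ (hin₂ x hx x' hx') _ (hin₂ y hy x' hx')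
    have e₃ : x + z - x' - (y + z - x') = x - y := by abel
    rw [e₃] at e₂
    have : defect Φ z x x' - defect Φ z y x' + (fderiv ℝ Φ ν₂ - fderiv ℝ Φ ν₁) (x - y) =
        (Φ x - Φ y - fderiv ℝ Φ ν₁ (x - y)) -
        (Φ (x + z - x') - Φ (y + z - x') - fderiv ℝ Φ ν₂ (x - y)) := by
      simp only [defect, sub_apply]
      abel
    rw [this]
    refine (norm_sub_le _ _).trans ?_
    linarith

end Defect

/-! ### Characters, Gaussian multipliers and their frequency splitting. -/

section Phase

/-- The character `r ↦ e^{2πir}`. -/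
noncomputable def phase (r : ℝ) : ℂ := Complex.exp (((2 * Real.pi * r : ℝ) : ℂ) * Complex.I)

@[simp] lemma norm_phase (r : ℝ) : ‖phase r‖ = 1 := Complex.norm_exp_ofReal_mul_I _

lemma continuous_phase : Continuous phase := by unfold phase; fun_prop

lemma phase_add (r s : ℝ) : phase (r + s) = phase r * phase s := by
  unfold phase
  rw [← Complex.exp_add]
  push_cast
  ring_nf

lemma phase_neg (r : ℝ) : phase (-r) = (starRingEnd ℂ) (phase r) := by
  unfold phase
  rw [← Complex.exp_conj, map_mul, Complex.conj_I, Complex.conj_ofReal]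
  push_cast
  ring_nf

lemma phase_sub (r s : ℝ) : phase (r - s) = phase r * (starRingEnd ℂ) (phase s) := by
  rw [sub_eq_add_neg, phase_add, phase_neg]

end Phase

section Kernel

variable {F : Type*} [NormedAddCommGroup F] [InnerProductSpace ℝ F] [FiniteDimensional ℝ F]
  [MeasurableSpace F] [BorelSpace F]

/-- The inverse Fourier transform of a real multiplier. -/
noncomputable def multiplierKernel (m : F → ℝ) (u : F) : ℂ := ∫ t, (m t : ℂ) * phase (inner ℝ t u)

lemma integrable_multiplierKernel {m : F → ℝ} (hm : Integrable m) (u : F) :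
    Integrable fun t => (m t : ℂ) * phase (inner ℝ t u) := by
  refine hm.ofReal.mul_bdd (c := 1) ?_ (Filter.Eventually.of_forall fun t => (norm_phase _).le)
  exact (continuous_phase.comp (by fun_prop)).aestronglyMeasurable

lemma norm_multiplierKernel_le (m : F → ℝ) (u : F) :
    ‖multiplierKernel m u‖ ≤ ∫ t, |m t| := by
  refine (norm_integral_le_integral_norm _).trans_eq ?_
  congr 1 with t
  simp

lemma continuous_multiplierKernel {m : F → ℝ} (hm : Integrable m) :
    Continuous (multiplierKernel m) := by
  refine continuous_of_dominated (bound := fun t => |m t|)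
    (fun u => (integrable_multiplierKernel hm u).aestronglyMeasurable)
    (fun u => Filter.Eventually.of_forall fun t => by simp) hm.abs
    (Filter.Eventually.of_forall fun t => ?_)
  exact continuous_const.mul (continuous_phase.comp (by fun_prop))

/-- The Gaussian multiplier at scale `Λ`. -/
noncomputable def gaussMul (Λ : ℝ) (t : F) : ℝ := Real.exp (-Real.pi * (Λ⁻¹ * ‖t‖) ^ 2)

/-- The `L¹`-normalised Gaussian at scale `Λ⁻¹`. -/
noncomputable def gaussKer (Λ : ℝ) (u : F) : ℝ :=
  Λ ^ Module.finrank ℝ F * Real.exp (-Real.pi * (Λ * ‖u‖) ^ 2)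

lemma gaussKer_nonneg {Λ : ℝ} (hΛ : 0 ≤ Λ) (u : F) : 0 ≤ gaussKer Λ u := by
  unfold gaussKer; positivity

lemma gaussKer_le {Λ : ℝ} (hΛ : 0 ≤ Λ) (u : F) : gaussKer Λ u ≤ Λ ^ Module.finrank ℝ F := by
  unfold gaussKer
  refine mul_le_of_le_one_right (by positivity) (Real.exp_le_one_iff.2 ?_)
  have := Real.pi_pos
  nlinarith [sq_nonneg (Λ * ‖u‖), mul_nonneg this.le (sq_nonneg (Λ * ‖u‖))]

lemma gaussKer_neg (Λ : ℝ) (u : F) : gaussKer Λ (-u) = gaussKer Λ u := by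
  simp [gaussKer]

lemma continuous_gaussKer (Λ : ℝ) : Continuous (gaussKer Λ : F → ℝ) := by
  unfold gaussKer; fun_prop

lemma gaussMul_pos (Λ : ℝ) (t : F) : 0 < gaussMul Λ t := Real.exp_pos _

lemma gaussMul_le_one (Λ : ℝ) (t : F) : gaussMul Λ t ≤ 1 := by
  refine Real.exp_le_one_iff.2 ?_
  have := mul_nonneg Real.pi_pos.le (sq_nonneg (Λ⁻¹ * ‖t‖))
  linarith

lemma continuous_gaussMul (Λ : ℝ) : Continuous (gaussMul Λ : F → ℝ) := by
  unfold gaussMul; fun_prop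

lemma integrable_gaussMul {Λ : ℝ} (hΛ : 0 < Λ) : Integrable (gaussMul Λ : F → ℝ) := by
  have h := GaussianFourier.integrable_cexp_neg_mul_sq_norm_add (V := F)
    (b := ((Real.pi * Λ⁻¹ ^ 2 : ℝ) : ℂ)) (by rw [Complex.ofReal_re]; positivity) 0 0
  refine h.norm.congr (Filter.Eventually.of_forall fun t => ?_)
  simp only [gaussMul, Complex.norm_exp]
  congr 1
  simp only [← Complex.ofReal_pow, ← Complex.ofReal_neg, ← Complex.ofReal_mul, inner_zero_left,
    Complex.ofReal_zero, mul_zero, add_zero, Complex.ofReal_re]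
  ring

lemma multiplierKernel_gaussMul {Λ : ℝ} (hΛ : 0 < Λ) (u : F) :
    multiplierKernel (gaussMul Λ) u = (gaussKer Λ u : ℂ) := by
  have h := fourier_gaussian_innerProductSpace (V := F)
    (b := ((Real.pi * Λ⁻¹ ^ 2 : ℝ) : ℂ)) (by rw [Complex.ofReal_re]; positivity) (-u)
  rw [Real.fourier_eq'] at h
  have h1 : multiplierKernel (gaussMul Λ) u = ∫ v : F, Complex.exp
      (↑(-2 * Real.pi * inner ℝ v (-u)) * Complex.I) •
        Complex.exp (-((Real.pi * Λ⁻¹ ^ 2 : ℝ) : ℂ) * ‖v‖ ^ 2) := by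
    unfold multiplierKernel
    congr 1 with v
    simp only [gaussMul, phase, smul_eq_mul, Complex.ofReal_exp, inner_neg_right]
    rw [mul_comm]
    congr 2
    · push_cast; ring
    · push_cast; ring
  rw [h1, h]
  have h2 : ((Real.pi : ℂ) / ((Real.pi * Λ⁻¹ ^ 2 : ℝ) : ℂ)) = ((Λ ^ 2 : ℝ) : ℂ) := by
    rw [← Complex.ofReal_div]
    congr 1
    have := Real.pi_pos.ne'
    field_simp
  have h3 : (((Λ ^ 2 : ℝ) : ℂ)) ^ ((Module.finrank ℝ F : ℂ) / 2) =
      ((Λ ^ Module.finrank ℝ F : ℝ) : ℂ) := by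
    have : ((Module.finrank ℝ F : ℂ) / 2) = (((Module.finrank ℝ F : ℝ) / 2 : ℝ) : ℂ) := by
      push_cast; rfl
    rw [this, ← Complex.ofReal_cpow (by positivity), ← Real.rpow_natCast, ← Real.rpow_mul hΛ.le]
    congr 1
    rw [show ((2 : ℕ) : ℝ) * ((Module.finrank ℝ F : ℝ) / 2) = (Module.finrank ℝ F : ℝ) by
      push_cast; ring, Real.rpow_natCast]
  rw [h2, h3, gaussKer, Complex.ofReal_mul (Λ ^ _), Complex.ofReal_exp]
  congr 2
  push_cast
  rw [norm_neg]
  have := Real.pi_pos.ne'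
  have hπ : (Real.pi : ℂ) ≠ 0 := by exact_mod_cast this
  have hΛ' : (Λ : ℂ) ≠ 0 := by exact_mod_cast hΛ.ne'
  field_simp

lemma exists_gaussKer_le_decay (N : ℕ) : ∃ C : ℝ, 0 ≤ C ∧ ∀ Λ : ℝ, 0 < Λ → ∀ u : F,
    gaussKer Λ u ≤ C * (Λ ^ Module.finrank ℝ F * decay N Λ u) := by
  refine ⟨N.factorial * Real.exp 2, by positivity, fun Λ hΛ u => ?_⟩
  set x := Λ * ‖u‖ with hx
  have hx0 : 0 ≤ x := by positivity
  have h1 : (1 + x) ^ N ≤ N.factorial * Real.exp (1 + x) := by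
    have := Real.pow_div_factorial_le_exp (1 + x) (by linarith) N
    rwa [div_le_iff₀ (by positivity), mul_comm] at this
  have h2 : Real.exp (-Real.pi * x ^ 2) ≤ Real.exp (1 - x) := by
    apply Real.exp_le_exp.2
    nlinarith [Real.pi_gt_three, sq_nonneg (x - 1 / 2), sq_nonneg x]
  have h3 : Real.exp (-Real.pi * x ^ 2) ≤ N.factorial * Real.exp 2 * ((1 + x) ^ N)⁻¹ := by
    rw [← div_eq_mul_inv, le_div_iff₀ (by positivity)]
    calc Real.exp (-Real.pi * x ^ 2) * (1 + x) ^ N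
        ≤ Real.exp (1 - x) * (N.factorial * Real.exp (1 + x)) := by gcongr
      _ = N.factorial * (Real.exp (1 - x) * Real.exp (1 + x)) := by ring
      _ = _ := by rw [← Real.exp_add]; norm_num
  unfold gaussKer decay
  rw [← hx]
  calc _ ≤ Λ ^ Module.finrank ℝ F * (N.factorial * Real.exp 2 * ((1 + x) ^ N)⁻¹) := by gcongr
    _ = _ := by ring

/-- A smooth cutoff, equal to one on the unit ball and supported in the ball of radius two. -/
noncomputable def freqCut (t : F) : ℝ := (⟨1, 2, one_pos, by norm_num⟩ : ContDiffBump (0 : F)) t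

lemma contDiff_freqCut : ContDiff ℝ ∞ (freqCut : F → ℝ) := ContDiffBump.contDiff _

lemma freqCut_nonneg (t : F) : 0 ≤ freqCut t := ContDiffBump.nonneg _

lemma freqCut_le_one (t : F) : freqCut t ≤ 1 := ContDiffBump.le_one _

lemma freqCut_eq_one {t : F} (ht : ‖t‖ ≤ 1) : freqCut t = 1 :=
  ContDiffBump.one_of_mem_closedBall _ (mem_closedBall_zero_iff.2 ht)

lemma freqCut_eq_zero {t : F} (ht : 2 ≤ ‖t‖) : freqCut t = 0 :=
  ContDiffBump.zero_of_le_dist _ (by rwa [dist_zero_right])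

/-- The part of the Gaussian multiplier at frequencies `≲ l`. -/
noncomputable def lowMul (Λ l : ℝ) (t : F) : ℝ := gaussMul Λ t * freqCut (l⁻¹ • t)

/-- The part of the Gaussian multiplier at frequencies `≳ l`. -/
noncomputable def highMul (Λ l : ℝ) (t : F) : ℝ := gaussMul Λ t * (1 - freqCut (l⁻¹ • t))

lemma continuous_freqCut_smul (l : ℝ) : Continuous fun t : F => freqCut (l⁻¹ • t) :=
  (contDiff_freqCut (F := F)).continuous.comp (continuous_const_smul _)

lemma integrable_lowMul {Λ : ℝ} (hΛ : 0 < Λ) (l : ℝ) : Integrable (lowMul Λ l : F → ℝ) :=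
  (integrable_gaussMul hΛ).mul_bdd (c := 1)
    (continuous_freqCut_smul l).aestronglyMeasurable
    (Filter.Eventually.of_forall fun t => by
      rw [Real.norm_of_nonneg (freqCut_nonneg _)]; exact freqCut_le_one _)

lemma abs_highMul_le (Λ l : ℝ) (t : F) : |highMul Λ l t| ≤ gaussMul Λ t := by
  unfold highMul
  rw [abs_mul, abs_of_pos (gaussMul_pos _ _)]
  refine mul_le_of_le_one_right (gaussMul_pos _ _).le ?_
  have h1 := freqCut_nonneg (l⁻¹ • t)
  have h2 := freqCut_le_one (l⁻¹ • t)
  rw [abs_of_nonneg (by linarith)]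
  linarith

lemma continuous_highMul (Λ l : ℝ) : Continuous (highMul Λ l : F → ℝ) :=
  (continuous_gaussMul Λ).mul (continuous_const.sub (continuous_freqCut_smul l))

lemma integrable_highMul {Λ : ℝ} (hΛ : 0 < Λ) (l : ℝ) : Integrable (highMul Λ l : F → ℝ) :=
  (integrable_gaussMul hΛ).mono' (continuous_highMul Λ l).aestronglyMeasurable
    (Filter.Eventually.of_forall fun t => abs_highMul_le Λ l t)

lemma highMul_eq_zero (Λ : ℝ) {l : ℝ} (hl : 0 < l) {t : F} (ht : ‖t‖ ≤ l) :
    highMul Λ l t = 0 := by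
  have : freqCut (l⁻¹ • t) = 1 := freqCut_eq_one (by
    rwa [norm_smul, Real.norm_of_nonneg (inv_nonneg.2 hl.le), inv_mul_le_iff₀ hl, mul_one])
  simp [highMul, this]

lemma multiplierKernel_low_add_high {Λ : ℝ} (hΛ : 0 < Λ) (l : ℝ) (u : F) :
    multiplierKernel (lowMul Λ l) u + multiplierKernel (highMul Λ l) u = (gaussKer Λ u : ℂ) := by
  rw [← multiplierKernel_gaussMul hΛ]
  unfold multiplierKernel
  rw [← integral_add (integrable_multiplierKernel (integrable_lowMul hΛ l) u)
    (integrable_multiplierKernel (integrable_highMul hΛ l) u)]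
  congr 1 with t
  simp only [lowMul, highMul]
  push_cast
  ring

/-- Rescaling `t` by `l` gives `l ^ n` times the oscillatory integral of a fixed cutoff against a
linear phase with large parameter `l‖u‖`. The remaining Gaussian depends only on `l / Λ ∈ [0, 1]`, a
compact parameter, so the constants are uniform in `Λ` and `l`. -/
lemma exists_norm_lowMul_kernel_le [Nontrivial F] (N : ℕ) :
    ∃ C : ℝ, 0 ≤ C ∧ ∀ Λ l : ℝ, 0 < l → l ≤ Λ → ∀ u : F,
      ‖multiplierKernel (lowMul Λ l) u‖ ≤ C * (l ^ Module.finrank ℝ F * decay N l u) := by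
  let φ : F × (ℝ × F) → ℝ := fun p => 2 * Real.pi * inner ℝ p.1 p.2.2
  have hφ : ContDiff ℝ ∞ φ :=
    contDiff_const.mul (contDiff_fst.inner ℝ (contDiff_snd.comp contDiff_snd))
  let a : F × (ℝ × F) → ℂ := fun p =>
    ((Real.exp (-Real.pi * (p.2.1 ^ 2 * ‖p.1‖ ^ 2)) * freqCut p.1 : ℝ) : ℂ)
  have ha : ContDiff ℝ ∞ a := by
    have h1 : ContDiff ℝ ∞ fun p : F × (ℝ × F) => freqCut p.1 :=
      contDiff_freqCut.comp contDiff_fst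
    have h2 : ContDiff ℝ ∞ fun p : F × (ℝ × F) => ‖p.1‖ ^ 2 :=
      (contDiff_norm_sq ℝ).comp contDiff_fst
    have h3 : ContDiff ℝ ∞ fun p : F × (ℝ × F) =>
      Real.exp (-Real.pi * (p.2.1 ^ 2 * ‖p.1‖ ^ 2)) * freqCut p.1 := by fun_prop
    exact Complex.ofRealCLM.contDiff.comp h3
  have haK : ∀ x ∉ Metric.closedBall (0 : F) 2, ∀ θ, a (x, θ) = 0 := by
    intro x hx θ
    have : freqCut x = 0 := freqCut_eq_zero
      (not_le.1 fun h => hx (mem_closedBall_zero_iff.2 h)).le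
    simp [a, this]
  have hgrad : ∀ x ∈ Metric.closedBall (0 : F) 2,
      ∀ θ ∈ Set.Icc (0 : ℝ) 1 ×ˢ Metric.sphere (0 : F) 1,
      ∃ v, fderiv ℝ φ (x, θ) (v, 0) ≠ 0 := by
    rintro x - ⟨r, θ⟩ ⟨-, hθ⟩
    refine ⟨θ, ?_⟩
    have h1 : HasFDerivAt φ (fderiv ℝ φ (x, (r, θ))) (x, (r, θ)) :=
      (hφ.differentiable (by simp) _).hasFDerivAt
    have h2 : HasDerivAt (fun s : ℝ => ((x + s • θ, (r, θ)) : F × (ℝ × F))) (θ, 0) 0 := by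
      have h3 : HasDerivAt (fun s : ℝ => x + s • θ) θ 0 := by
        simpa using ((hasDerivAt_id (0 : ℝ)).smul_const θ).const_add x
      exact h3.prodMk (hasDerivAt_const _ _)
    have h4 := HasFDerivAt.comp_hasDerivAt (0 : ℝ) (by simpa using h1) h2
    have h5 : HasDerivAt (fun s : ℝ => 2 * Real.pi * (inner ℝ x θ + s * inner ℝ θ θ))
        (2 * Real.pi * inner ℝ θ θ) 0 := by
      simpa using (((hasDerivAt_id (0 : ℝ)).mul_const (inner ℝ θ θ)).const_add
        (inner ℝ x θ)).const_mul (2 * Real.pi)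
    have h6 : (φ ∘ fun s : ℝ => ((x + s • θ, (r, θ)) : F × (ℝ × F))) =
        fun s : ℝ => 2 * Real.pi * (inner ℝ x θ + s * inner ℝ θ θ) := by
      ext s
      simp [φ, inner_add_left, inner_smul_left]
    rw [h6] at h4
    rw [h4.unique h5, real_inner_self_eq_norm_sq, mem_sphere_zero_iff_norm.1 hθ]
    have := Real.pi_pos
    positivity
  obtain ⟨C, hC0, hC⟩ := exists_norm_integral_oscillatory_le hφ (isCompact_closedBall _ _)
    (isCompact_Icc.prod (isCompact_sphere _ _)) hgrad N a ha haK
  refine ⟨C, hC0, fun Λ l hl hlΛ u => ?_⟩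
  have hΛ : 0 < Λ := hl.trans_le hlΛ
  obtain ⟨e, he, hu⟩ : ∃ e : F, ‖e‖ = 1 ∧ u = ‖u‖ • e := by
    by_cases hu : u = 0
    · obtain ⟨e, he⟩ := exists_norm_eq F zero_le_one
      exact ⟨e, he, by simp [hu]⟩
    · refine ⟨‖u‖⁻¹ • u, norm_smul_inv_norm hu, ?_⟩
      rw [smul_smul, mul_inv_cancel₀ (norm_ne_zero_iff.2 hu), one_smul]
  have h1 := hC (l / Λ, e) ⟨⟨by positivity, (div_le_one hΛ).2 hlΛ⟩, mem_sphere_zero_iff_norm.2 he⟩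
    (l * ‖u‖) (by positivity)
  have h2 : multiplierKernel (lowMul Λ l) u = ((l ^ Module.finrank ℝ F : ℝ) : ℂ) *
      ∫ x, a (x, (l / Λ, e)) * Complex.exp (((l * ‖u‖ * φ (x, (l / Λ, e)) : ℝ) : ℂ) *
        Complex.I) := by
    have h3 := Measure.integral_comp_inv_smul volume (fun x : F => a (x, (l / Λ, e)) *
      Complex.exp (((l * ‖u‖ * φ (x, (l / Λ, e)) : ℝ) : ℂ) * Complex.I)) l
    rw [abs_of_pos (by positivity)] at h3
    rw [← Complex.real_smul, ← h3]
    unfold multiplierKernel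
    congr 1 with t
    have h4 : inner ℝ t u = ‖u‖ * inner ℝ t e := by
      conv_lhs => rw [hu]
      rw [inner_smul_right]
    have h5 : (l * ‖u‖ * φ (l⁻¹ • t, (l / Λ, e)) : ℝ) = 2 * Real.pi * inner ℝ t u := by
      simp only [φ, h4, inner_smul_left, RCLike.conj_to_real]
      field_simp
    rw [h5]
    simp only [a, lowMul, gaussMul, phase, norm_smul, Real.norm_of_nonneg (inv_nonneg.2 hl.le)]
    congr 5
    field_simp
  rw [h2, norm_mul, Complex.norm_real, Real.norm_of_nonneg (by positivity)]
  unfold decay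
  calc _ ≤ l ^ Module.finrank ℝ F * (C * ((1 + l * ‖u‖) ^ N)⁻¹) := by gcongr
    _ = _ := by ring

/-- The high kernel is the Gaussian minus the low kernel, so both scales `Λ⁻¹` and `l⁻¹` appear. -/
lemma exists_norm_highMul_kernel_le [Nontrivial F] (N : ℕ) :
    ∃ C : ℝ, 0 ≤ C ∧ ∀ Λ l : ℝ, 0 < l → l ≤ Λ → ∀ u : F,
      ‖multiplierKernel (highMul Λ l) u‖ ≤ C * (l ^ Module.finrank ℝ F * decay N l u +
        Λ ^ Module.finrank ℝ F * decay N Λ u) := by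
  obtain ⟨C₁, h₁, hC₁⟩ := exists_norm_lowMul_kernel_le (F := F) N
  obtain ⟨C₂, h₂, hC₂⟩ := exists_gaussKer_le_decay (F := F) N
  refine ⟨C₁ + C₂, by positivity, fun Λ l hl hlΛ u => ?_⟩
  have hΛ : 0 < Λ := hl.trans_le hlΛ
  have h3 : multiplierKernel (highMul Λ l) u =
      (gaussKer Λ u : ℂ) - multiplierKernel (lowMul Λ l) u := by
    rw [← multiplierKernel_low_add_high hΛ l]; ring
  rw [h3]
  refine (norm_sub_le _ _).trans ?_
  rw [Complex.norm_real, Real.norm_of_nonneg (gaussKer_nonneg hΛ.le u)]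
  have h4 := hC₁ Λ l hl hlΛ u
  have h5 := hC₂ Λ hΛ u
  have h6 : 0 ≤ l ^ Module.finrank ℝ F * decay N l u :=
    mul_nonneg (by positivity) (decay_nonneg N hl.le u)
  have h7 : 0 ≤ Λ ^ Module.finrank ℝ F * decay N Λ u :=
    mul_nonneg (by positivity) (decay_nonneg N hΛ.le u)
  nlinarith [mul_nonneg h₁ h7, mul_nonneg h₂ h6]

end Kernel

/-! ### Consequences of the bordered-matrix condition. -/

section Nondegenerate

variable {E F : Type*} [NormedAddCommGroup E] [InnerProductSpace ℝ E] [FiniteDimensional ℝ E]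
  [NormedAddCommGroup F] [InnerProductSpace ℝ F] [FiniteDimensional ℝ F]

/-- The coordinate-free form of the invertibility of the bordered matrices: `D` is the difference
of the first derivatives and `H` the second derivative. -/
def Nondegenerate (D : E →L[ℝ] F) (H : E →L[ℝ] E →L[ℝ] F) : Prop :=
  ∀ σ : F, ‖σ‖ = 1 → ∀ (τ : F) (w : E), D w = 0 →
    (∀ v, inner ℝ τ (D v) + inner ℝ σ (H v w) = 0) → τ = 0 ∧ w = 0

/-- Taking `w = 0` in the condition shows that no nonzero `τ` is orthogonal to the range of `D`, so
`D` is onto. -/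
lemma Nondegenerate.exists_rightInverse [Nontrivial F] {D : E →L[ℝ] F} {H : E →L[ℝ] E →L[ℝ] F}
    (h : Nondegenerate D H) : ∃ J : F →L[ℝ] E, ∀ y, D (J y) = y := by
  have hsurj : LinearMap.range (D : E →ₗ[ℝ] F) = ⊤ := by
    by_contra hne
    obtain ⟨σ, hσ⟩ := exists_norm_eq F zero_le_one
    have hbot : (LinearMap.range (D : E →ₗ[ℝ] F))ᗮ ≠ ⊥ := fun hb =>
      hne (Submodule.orthogonal_eq_bot_iff.1 hb)
    obtain ⟨τ, hτ, hτ0⟩ := Submodule.exists_mem_ne_zero_of_ne_bot hbot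
    refine hτ0 (h σ hσ τ 0 (map_zero D) fun v => ?_).1
    have := (Submodule.mem_orthogonal' _ _).1 hτ (D v) ⟨v, rfl⟩
    simp [this]
  obtain ⟨J, hJ⟩ := LinearMap.exists_rightInverse_of_surjective (D : E →ₗ[ℝ] F) hsurj
  exact ⟨LinearMap.toContinuousLinearMap J, fun y => LinearMap.congr_fun hJ y⟩

/-- The derivative of the phase at the base point. -/
noncomputable def baseGrad (D : E →L[ℝ] F) (H : E →L[ℝ] E →L[ℝ] F) (q : F × F × E) : E →L[ℝ] ℝ :=
  -(innerSL ℝ q.1 ∘L D) + innerSL ℝ q.2.1 ∘L (H.flip q.2.2)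

lemma baseGrad_apply (D : E →L[ℝ] F) (H : E →L[ℝ] E →L[ℝ] F) (q : F × F × E) (v : E) :
    baseGrad D H q v = -inner ℝ q.1 (D v) + inner ℝ q.2.1 (H v q.2.2) := by
  simp [baseGrad]

/-- The compact set of normalised frequency parameters `(τ, σ, w)`. -/
def freqParam (D : E →L[ℝ] F) (ε : ℝ) : Set (F × F × E) :=
  {q | ‖q.1‖ + ‖q.2.2‖ = 1 ∧ ‖q.2.1‖ = 1 ∧ ‖D q.2.2‖ ≤ ε}

lemma isCompact_freqParam (D : E →L[ℝ] F) (ε : ℝ) : IsCompact (freqParam D ε) := by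
  refine Metric.isCompact_of_isClosed_isBounded ?_ ?_
  · have h1 : IsClosed {q : F × F × E | ‖q.1‖ + ‖q.2.2‖ = 1} :=
      isClosed_eq (by fun_prop) (by fun_prop)
    have h2 : IsClosed {q : F × F × E | ‖q.2.1‖ = 1} := isClosed_eq (by fun_prop) (by fun_prop)
    have h3 : IsClosed {q : F × F × E | ‖D q.2.2‖ ≤ ε} := isClosed_le (by fun_prop) (by fun_prop)
    exact h1.inter (h2.inter h3)
  · refine (Metric.isBounded_closedBall (x := (0 : F × F × E)) (r := 1)).subset ?_
    rintro ⟨τ, σ, w⟩ ⟨h1, h2, -⟩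
    simp only at h1 h2
    rw [mem_closedBall_zero_iff, Prod.norm_def, Prod.norm_def]
    simp only [sup_le_iff]
    have := norm_nonneg τ
    have := norm_nonneg w
    exact ⟨by linarith, by linarith, by linarith⟩

/-- The condition speaks only of `w ∈ ker D`; compactness of the normalised parameters extends it to
a cone around the kernel. There `‖D w‖ + ‖baseGrad‖` is bounded below by some `c`, so `‖D w‖ ≤ c /
2` keeps the gradient nonzero. -/
lemma Nondegenerate.exists_baseGrad_ne_zero {D : E →L[ℝ] F} {H : E →L[ℝ] E →L[ℝ] F}
    (h : Nondegenerate D H) : ∃ ε > 0, ∀ q ∈ freqParam D ε, baseGrad D H q ≠ 0 := by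
  have hcont : Continuous fun q : F × F × E => ‖D q.2.2‖ + ‖baseGrad D H q‖ := by
    unfold baseGrad
    have h1 : Continuous fun q : F × F × E => innerSL ℝ q.1 ∘L D :=
      ((innerSL ℝ).continuous.comp continuous_fst).clm_comp continuous_const
    have h2 : Continuous fun q : F × F × E => innerSL ℝ q.2.1 ∘L (H.flip q.2.2) :=
      ((innerSL ℝ).continuous.comp (by fun_prop)).clm_comp (H.flip.continuous.comp (by fun_prop))
    fun_prop
  -- With `ε = ‖D‖` the third constraint is automatic, since `‖w‖ ≤ 1`: this is the full set of
  -- normalised parameters.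
  have hK := isCompact_freqParam D ‖D‖
  have hpos : ∀ q ∈ freqParam D ‖D‖, 0 < ‖D q.2.2‖ + ‖baseGrad D H q‖ := by
    rintro ⟨τ, σ, w⟩ ⟨h1, h2, -⟩
    by_contra hcon
    have h3 := norm_nonneg (D w)
    have h4 := norm_nonneg (baseGrad D H (τ, σ, w))
    simp only at h1 h2 hcon
    have h5 : D w = 0 := norm_eq_zero.1 (by linarith)
    have h6 : baseGrad D H (τ, σ, w) = 0 := norm_eq_zero.1 (by linarith)
    have h7 := h σ h2 (-τ) w h5 fun v => by
      have := baseGrad_apply D H (τ, σ, w) v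
      rw [h6] at this
      simp only [inner_neg_left]
      simpa using this.symm
    rw [neg_eq_zero.1 h7.1, h7.2] at h1
    simp at h1
  obtain ⟨c, hc, hcle⟩ : ∃ c > 0, ∀ q ∈ freqParam D ‖D‖, c ≤ ‖D q.2.2‖ + ‖baseGrad D H q‖ := by
    rcases (freqParam D ‖D‖).eq_empty_or_nonempty with he | hne
    · exact ⟨1, one_pos, by simp [he]⟩
    · obtain ⟨q, hq, hmin⟩ := hK.exists_isMinOn hne hcont.continuousOn
      exact ⟨_, hpos q hq, fun q' hq' => hmin hq'⟩
  refine ⟨c / 2, by positivity, fun q hq h0 => ?_⟩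
  have h1 : q ∈ freqParam D ‖D‖ := by
    refine ⟨hq.1, hq.2.1, (D.le_opNorm _).trans ?_⟩
    have h2 : ‖q.2.2‖ ≤ 1 := by linarith [hq.1, norm_nonneg q.1]
    nlinarith [norm_nonneg D]
  have h2 := hcle q h1
  rw [h0, norm_zero, add_zero] at h2
  linarith [hq.2.2]

end Nondegenerate

/-! ### The normalised phase of the kernel of T*T and its decay. -/

section PhaseFunction

lemma fderiv_slice {E X G : Type*} [NormedAddCommGroup E] [NormedSpace ℝ E]
    [NormedAddCommGroup X] [NormedSpace ℝ X] [NormedAddCommGroup G] [NormedSpace ℝ G]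
    {f : E × X → G} (hf : Differentiable ℝ f) (x : E) (θ : X) (v : E) :
    fderiv ℝ (fun y => f (y, θ)) x v = fderiv ℝ f (x, θ) (v, 0) := by
  have h1 : HasFDerivAt (fun y : E => (y, θ)) (ContinuousLinearMap.inl ℝ E X) x :=
    hasFDerivAt_prodMk_left x θ
  have h2 := (hf (x, θ)).hasFDerivAt.comp x h1
  have h3 : fderiv ℝ (fun y => f (y, θ)) x = _ := h2.fderiv
  rw [h3]
  simp

variable {E F : Type*} [NormedAddCommGroup E] [InnerProductSpace ℝ E] [FiniteDimensional ℝ E]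
  [NormedAddCommGroup F] [InnerProductSpace ℝ F] [FiniteDimensional ℝ F]

/-- The smooth family of normalised phases, in terms of `x`, the positions `(x', y, z)` and the
frequencies `(τ, σ, w)`. -/
noncomputable def phaseFun (Φ : E → F) (p : E × ((E × E × E) × (F × F × E))) : ℝ :=
  2 * Real.pi * (inner ℝ p.2.2.1 (defect Φ p.2.1.2.2 p.1 p.2.1.1) +
    inner ℝ p.2.2.2.1 ((avgDeriv Φ (p.1 + p.2.1.2.2 - p.2.1.1, p.1 + p.2.1.2.2 - p.2.1.2.1) -
      avgDeriv Φ (p.2.1.1, p.2.1.2.1)) p.2.2.2.2))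

lemma contDiff_phaseFun {Φ : E → F} (hΦ : ContDiff ℝ ∞ Φ) : ContDiff ℝ ∞ (phaseFun Φ) := by
  have hA := contDiff_avgDeriv hΦ
  have h1 : ContDiff ℝ ∞ fun p : E × ((E × E × E) × (F × F × E)) =>
      defect Φ p.2.1.2.2 p.1 p.2.1.1 := by
    unfold defect
    have e1 : ContDiff ℝ ∞ fun p : E × ((E × E × E) × (F × F × E)) => Φ p.1 :=
      hΦ.comp (by fun_prop)
    have e2 : ContDiff ℝ ∞ fun p : E × ((E × E × E) × (F × F × E)) => Φ p.2.1.2.2 :=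
      hΦ.comp (by fun_prop)
    have e3 : ContDiff ℝ ∞ fun p : E × ((E × E × E) × (F × F × E)) => Φ p.2.1.1 :=
      hΦ.comp (by fun_prop)
    have e4 : ContDiff ℝ ∞ fun p : E × ((E × E × E) × (F × F × E)) =>
      Φ (p.1 + p.2.1.2.2 - p.2.1.1) := hΦ.comp (by fun_prop)
    fun_prop
  have h2 : ContDiff ℝ ∞ fun p : E × ((E × E × E) × (F × F × E)) =>
      avgDeriv Φ (p.1 + p.2.1.2.2 - p.2.1.1, p.1 + p.2.1.2.2 - p.2.1.2.1) :=
    hA.comp (by fun_prop)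
  have h3 : ContDiff ℝ ∞ fun p : E × ((E × E × E) × (F × F × E)) =>
      avgDeriv Φ (p.2.1.1, p.2.1.2.1) := hA.comp (by fun_prop)
  have h4 : ContDiff ℝ ∞ fun p : E × ((E × E × E) × (F × F × E)) => p.2.2.1 := by fun_prop
  have h5 : ContDiff ℝ ∞ fun p : E × ((E × E × E) × (F × F × E)) => p.2.2.2.1 := by fun_prop
  have h6 : ContDiff ℝ ∞ fun p : E × ((E × E × E) × (F × F × E)) => p.2.2.2.2 := by fun_prop
  exact contDiff_const.mul ((h4.inner ℝ h1).add (h5.inner ℝ ((h2.sub h3).clm_apply h6)))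

/-- Write the phase as `(t - s)·defect(x, x') + s·(defect(x, x') - defect(x, y))`. By Hadamard's
lemma the second difference is linear in `x' - y`, so dividing by `R` leaves a smooth function of
the parameters `τ = (t-s)/R`, `σ = s/|s|`, `w = |s|(x'-y)/R`. -/
lemma phaseFun_eq {Φ : E → F} (hΦ : ContDiff ℝ ∞ Φ) (x x' y z : E) (t s : F) {R : ℝ} (hR : R ≠ 0)
    (hs : s ≠ 0) :
    R * phaseFun Φ (x, (x', y, z), (R⁻¹ • (t - s), ‖s‖⁻¹ • s, (R⁻¹ * ‖s‖) • (x' - y))) =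
      2 * Real.pi * (inner ℝ t (defect Φ z x x') - inner ℝ s (defect Φ z x y)) := by
  have h1 : (avgDeriv Φ (x + z - x', x + z - y) - avgDeriv Φ (x', y)) (x' - y) =
      defect Φ z x x' - defect Φ z x y := by
    have e1 := avgDeriv_apply_sub hΦ x' y
    have e2 := avgDeriv_apply_sub hΦ (x + z - x') (x + z - y)
    have e3 : x + z - x' - (x + z - y) = -(x' - y) := by abel
    rw [e3, map_neg] at e2
    rw [sub_apply, e1, ← neg_eq_iff_eq_neg.2 e2.symm]
    simp only [defect]
    abel
  have hs' : ‖s‖ ≠ 0 := norm_ne_zero_iff.2 hs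
  simp only [phaseFun, map_smul, inner_smul_left, inner_smul_right, h1, RCLike.conj_to_real,
    inner_sub_left, inner_sub_right]
  field_simp
  ring

/-- When `x = x' = y = ν₁` and `z = ν₂` the averaged derivatives are genuine derivatives: the `τ`
term contributes `-D` and the `σ` term the second derivative of `Φ` at `ν₂`. This is where the
bordered matrix meets the oscillatory integral. -/
lemma fderiv_phaseFun_base {Φ : E → F} (hΦ : ContDiff ℝ ∞ Φ) (ν₁ ν₂ : E) (q : F × F × E) (v : E) :
    fderiv ℝ (phaseFun Φ) (ν₁, (ν₁, ν₁, ν₂), q) (v, 0) =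
      2 * Real.pi * baseGrad (fderiv ℝ Φ ν₂ - fderiv ℝ Φ ν₁) (fderiv ℝ (fderiv ℝ Φ) ν₂) q v := by
  rw [← fderiv_slice ((contDiff_phaseFun hΦ).differentiable (by simp))]
  obtain ⟨τ, σ, w⟩ := q
  have hd := hΦ.differentiable (by simp)
  have hdd : Differentiable ℝ (fderiv ℝ Φ) :=
    (hΦ.fderiv_right (m := ∞) (by simp)).differentiable (by simp)
  have hsh : HasFDerivAt (fun x : E => x + ν₂ - ν₁) (ContinuousLinearMap.id ℝ E) ν₁ :=
    ((hasFDerivAt_id ν₁).add_const ν₂).sub_const ν₁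
  have hpt : ν₁ + ν₂ - ν₁ = ν₂ := by abel
  have h1 : HasFDerivAt (fun x : E => Φ (x + ν₂ - ν₁)) (fderiv ℝ Φ ν₂) ν₁ := by
    have := HasFDerivAt.comp (g := Φ) (g' := fderiv ℝ Φ ν₂) ν₁
      (by rw [hpt]; exact (hd ν₂).hasFDerivAt) hsh
    rwa [ContinuousLinearMap.comp_id] at this
  have h2 : HasFDerivAt (fun x : E => fderiv ℝ Φ (x + ν₂ - ν₁)) (fderiv ℝ (fderiv ℝ Φ) ν₂) ν₁ := by
    have := HasFDerivAt.comp (g := fderiv ℝ Φ) (g' := fderiv ℝ (fderiv ℝ Φ) ν₂) ν₁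
      (by rw [hpt]; exact (hdd ν₂).hasFDerivAt) hsh
    rwa [ContinuousLinearMap.comp_id] at this
  have h3 : HasFDerivAt (fun x : E => defect Φ ν₂ x ν₁) (fderiv ℝ Φ ν₁ - fderiv ℝ Φ ν₂) ν₁ :=
    (((hd ν₁).hasFDerivAt.add_const _).sub_const _).sub h1
  have h4 := (innerSL ℝ τ).hasFDerivAt.comp ν₁ h3
  have h5 := (innerSL ℝ σ).hasFDerivAt.comp ν₁
    ((h2.sub_const (fderiv ℝ Φ ν₁)).clm_apply (hasFDerivAt_const w ν₁))
  have h6 := (h4.add h5).const_mul (2 * Real.pi)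
  have h7 : (fun x : E => phaseFun Φ (x, (ν₁, ν₁, ν₂), (τ, σ, w))) = fun x =>
      2 * Real.pi * (((innerSL ℝ τ) ∘ fun x : E => defect Φ ν₂ x ν₁) x +
        ((innerSL ℝ σ) ∘ fun x : E => (fderiv ℝ Φ (x + ν₂ - ν₁) - fderiv ℝ Φ ν₁) w) x) := by
    ext x
    simp [phaseFun, avgDeriv_self]
  rw [h7]
  have h8 := h6.fderiv
  simp only [Pi.add_def] at h8
  rw [h8, baseGrad_apply]
  simp [inner_sub_right]
  ring

lemma continuous_defect {Φ : E → F} (hΦ : ContDiff ℝ ∞ Φ) :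
    Continuous fun p : E × E × E => defect Φ p.1 p.2.1 p.2.2 := by
  have := hΦ.continuous
  unfold defect
  fun_prop

end PhaseFunction

section Oscillation

variable {E F : Type*} [NormedAddCommGroup E] [InnerProductSpace ℝ E] [FiniteDimensional ℝ E]
  [MeasurableSpace E] [BorelSpace E]
  [NormedAddCommGroup F] [InnerProductSpace ℝ F] [FiniteDimensional ℝ F] [Nontrivial F]

/-- Decay of the oscillatory integrals in the kernel of `T^*T`. -/
theorem exists_norm_integral_defect_le {Φ : E → F} (hΦ : ContDiff ℝ ∞ Φ) {ν₁ ν₂ : E}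
    (hND : Nondegenerate (fderiv ℝ Φ ν₂ - fderiv ℝ Φ ν₁) (fderiv ℝ (fderiv ℝ Φ) ν₂)) :
    ∃ ε > 0, ∃ ρ₀ > 0, ∀ ρ : ℝ, ρ ≤ ρ₀ → ∀ (M : ℕ) (a : E → ℝ), ContDiff ℝ ∞ a →
      (∀ x ∉ Metric.closedBall ν₁ (2 * ρ), a x = 0) →
      ∃ C : ℝ, 0 ≤ C ∧ ∀ z ∈ Metric.closedBall ν₂ ρ, ∀ x' ∈ Metric.closedBall ν₁ ρ,
        ∀ y ∈ Metric.closedBall ν₁ ρ,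
        ‖(fderiv ℝ Φ ν₂ - fderiv ℝ Φ ν₁) (x' - y)‖ ≤ ε * ‖x' - y‖ → ∀ t s : F, s ≠ 0 →
        ‖∫ x, (a x : ℂ) * phase (inner ℝ t (defect Φ z x x') - inner ℝ s (defect Φ z x y))‖ ≤
          C * ((1 + (‖t - s‖ + ‖s‖ * ‖x' - y‖)) ^ M)⁻¹ := by
  set D := fderiv ℝ Φ ν₂ - fderiv ℝ Φ ν₁ with hD
  set H := fderiv ℝ (fderiv ℝ Φ) ν₂ with hH
  obtain ⟨ε, hε, hbase⟩ := hND.exists_baseGrad_ne_zero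
  have hsm := contDiff_phaseFun hΦ
  let G : E × ((E × E × E) × (F × F × E)) → (E →L[ℝ] ℝ) := fun p =>
    (fderiv ℝ (phaseFun Φ) p).comp (ContinuousLinearMap.inl ℝ E _)
  have hG : Continuous G := (hsm.continuous_fderiv (by simp)).clm_comp continuous_const
  -- Tube lemma: nonvanishing at the base point, for all frequencies in a compact set, persists for
  -- nearby positions uniformly in the frequencies.
  have hev : ∀ᶠ b : E × (E × E × E) in nhds (ν₁, (ν₁, ν₁, ν₂)), ∀ q ∈ freqParam D ε,
      G (b.1, b.2, q) ≠ 0 := by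
    refine (isCompact_freqParam D ε).eventually_forall_of_forall_eventually
      (P := fun (b : E × (E × E × E)) q => G (b.1, b.2, q) ≠ 0) fun q hq => ?_
    have hc : Continuous fun r : (E × (E × E × E)) × (F × F × E) => G (r.1.1, r.1.2, r.2) :=
      hG.comp (by fun_prop)
    refine hc.continuousAt.eventually_ne ?_
    intro h0
    apply hbase q hq
    ext v
    have := DFunLike.congr_fun h0 v
    simp only [G, ContinuousLinearMap.comp_apply, ContinuousLinearMap.inl_apply] at this
    rw [fderiv_phaseFun_base hΦ] at this
    simpa [Real.pi_ne_zero] using this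
  obtain ⟨δ, hδ, hball⟩ := Metric.eventually_nhds_iff.1 hev
  refine ⟨ε, hε, δ / 3, by positivity, fun ρ hρ M a ha haK => ?_⟩
  have hgrad : ∀ x ∈ Metric.closedBall ν₁ (2 * ρ),
      ∀ θ ∈ (Metric.closedBall ν₁ ρ ×ˢ Metric.closedBall ν₁ ρ ×ˢ Metric.closedBall ν₂ ρ) ×ˢ
        freqParam D ε, ∃ v, fderiv ℝ (phaseFun Φ) (x, θ) (v, 0) ≠ 0 := by
    rintro x hx ⟨⟨x', y, z⟩, q⟩ ⟨⟨hx', hy, hz⟩, hq⟩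
    have h1 := hball (y := (x, (x', y, z))) (by
      simp only [Metric.mem_closedBall] at hx hx' hy hz
      have hx0 := dist_nonneg (x := x') (y := ν₁)
      simp only [Prod.dist_eq, max_lt_iff]
      exact ⟨by linarith, by linarith, by linarith, by linarith⟩) q hq
    by_contra! hcon
    apply h1
    ext v
    simpa [G] using hcon v
  obtain ⟨C, hC0, hC⟩ := exists_norm_integral_oscillatory_le hsm (isCompact_closedBall _ _)
    (((isCompact_closedBall _ _).prod ((isCompact_closedBall _ _).prod
      (isCompact_closedBall _ _))).prod (isCompact_freqParam D ε)) hgrad M (fun p => (a p.1 : ℂ))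
    (Complex.ofRealCLM.contDiff.comp (ha.comp contDiff_fst)) (fun x hx θ => by simp [haK x hx])
  refine ⟨C, hC0, fun z hz x' hx' y hy hcone t s hs => ?_⟩
  set R := ‖t - s‖ + ‖s‖ * ‖x' - y‖ with hR
  have hs' : 0 < ‖s‖ := norm_pos_iff.2 hs
  have hσ : ‖(‖s‖⁻¹ • s)‖ = 1 := norm_smul_inv_norm (𝕜 := ℝ) hs
  have hR0 : 0 ≤ R := by positivity
  rcases hR0.eq_or_lt with h0 | hRpos
  · have h1 : ‖s‖ * ‖x' - y‖ = 0 := by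
      have e1 := norm_nonneg (t - s)
      have e2 : 0 ≤ ‖s‖ * ‖x' - y‖ := by positivity
      linarith
    have h2 : ‖t - s‖ = 0 := by linarith
    have hts : t = s := sub_eq_zero.1 (norm_eq_zero.1 h2)
    have hxy : x' = y := by
      rcases mul_eq_zero.1 h1 with h | h
      · exact absurd h hs'.ne'
      · exact sub_eq_zero.1 (norm_eq_zero.1 h)
    -- If `R = 0` the phase vanishes identically, and the bound is that of the integral with large
    -- parameter `0`; any point of the parameter set serves.
    have h3 := hC ((x', y, z), (‖s‖⁻¹ • s, ‖s‖⁻¹ • s, 0)) ⟨⟨hx', hy, hz⟩, by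
      refine ⟨?_, hσ, ?_⟩
      · simp only [norm_zero, add_zero]; exact hσ
      · simpa using hε.le⟩ 0 le_rfl
    rw [← h0]
    subst hts hxy
    simpa [phase] using h3
  · have h3 := hC ((x', y, z), (R⁻¹ • (t - s), ‖s‖⁻¹ • s, (R⁻¹ * ‖s‖) • (x' - y)))
      ⟨⟨hx', hy, hz⟩, by
        refine ⟨?_, hσ, ?_⟩
        · simp only [norm_smul, norm_mul, norm_inv, Real.norm_of_nonneg hR0, norm_norm]
          rw [mul_assoc, ← mul_add, ← hR, inv_mul_cancel₀ hRpos.ne']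
        · simp only [map_smul, norm_smul, norm_mul, norm_inv, Real.norm_of_nonneg hR0, norm_norm]
          calc R⁻¹ * ‖s‖ * ‖D (x' - y)‖ ≤ R⁻¹ * ‖s‖ * (ε * ‖x' - y‖) := by gcongr
            _ = ε * (R⁻¹ * (‖s‖ * ‖x' - y‖)) := by ring
            _ ≤ ε * (R⁻¹ * R) := by
              gcongr
              rw [hR]
              linarith [norm_nonneg (t - s)]
            _ = ε := by rw [inv_mul_cancel₀ hRpos.ne', mul_one]⟩ R hR0
    simp_rw [phaseFun_eq hΦ _ _ _ _ _ _ hRpos.ne' hs] at h3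
    exact h3

end Oscillation

/-! ### Level sets and separation of the defect. -/

section Basic

variable {E F : Type*} [NormedAddCommGroup E] [InnerProductSpace ℝ E] [FiniteDimensional ℝ E]
  [MeasurableSpace E] [BorelSpace E]
  [NormedAddCommGroup F] [InnerProductSpace ℝ F] [FiniteDimensional ℝ F]
  [MeasurableSpace F] [BorelSpace F] [Nontrivial F]

/-- Bounds for the size of the level sets of the defect, in each of the two variables. -/
theorem exists_setLIntegral_defect_le {Φ : E → F} (hΦ : ContDiff ℝ ∞ Φ) {ν₁ ν₂ : E}
    {J : F →L[ℝ] E} (hJ : ∀ y, (fderiv ℝ Φ ν₂ - fderiv ℝ Φ ν₁) (J y) = y) :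
    ∃ ρ₀ > 0, ∀ ρ : ℝ, ρ ≤ ρ₀ → ∀ N : ℕ, Module.finrank ℝ F < N → ∃ C : ℝ≥0,
      ∀ z ∈ Metric.closedBall ν₂ ρ, ∀ u ∈ Metric.closedBall ν₁ (2 * ρ), ∀ μ : ℝ, 0 < μ →
      ∫⁻ x in Metric.closedBall ν₁ (2 * ρ), ENNReal.ofReal (decay N μ (defect Φ z x u)) ≤
          C * ENNReal.ofReal ((μ ^ Module.finrank ℝ F)⁻¹) ∧
      ∫⁻ x' in Metric.closedBall ν₁ (2 * ρ), ENNReal.ofReal (decay N μ (defect Φ z u x')) ≤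
          C * ENNReal.ofReal ((μ ^ Module.finrank ℝ F)⁻¹) := by
  set D := fderiv ℝ Φ ν₂ - fderiv ℝ Φ ν₁ with hD
  -- Along `J y` the linear part of the defect moves by exactly `y`, up to sign; this `ε` keeps the
  -- error below `‖y‖ / 2`, which gives the separation with constant `2`.
  set ε : ℝ := (2 * (‖J‖ + 1))⁻¹ with hε
  have hεpos : 0 < ε := by positivity
  have hεJ : ∀ y, ε * ‖J y‖ ≤ ‖y‖ / 2 := by
    intro y
    calc ε * ‖J y‖ ≤ ε * ((‖J‖ + 1) * ‖y‖) := by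
          gcongr
          exact (J.le_opNorm y).trans (by gcongr; linarith)
      _ = ‖y‖ / 2 := by rw [hε]; field_simp
  obtain ⟨ρ₀, hρ₀, happ⟩ := exists_defect_approx hΦ ν₁ ν₂ hεpos
  refine ⟨ρ₀, hρ₀, fun ρ hρ N hN => ?_⟩
  obtain ⟨C, hC⟩ := exists_setLIntegral_decay_le J (2 * ρ) N hN
  have hsub₁ : Metric.closedBall ν₁ (2 * ρ) ⊆ Metric.closedBall ν₁ (2 * ρ₀) :=
    Metric.closedBall_subset_closedBall (by linarith)
  have hsub₂ : Metric.closedBall ν₂ ρ ⊆ Metric.closedBall ν₂ ρ₀ :=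
    Metric.closedBall_subset_closedBall hρ
  have hcont := continuous_defect hΦ
  refine ⟨C, fun z hz u hu μ hμ => ⟨?_, ?_⟩⟩
  · refine hC ν₁ (fun x => defect Φ z x u) (hcont.comp (by fun_prop : Continuous
      fun x => ((z, x, u) : E × E × E))) (fun x hx y hxy => ?_) μ hμ
    have h1 := (happ z (hsub₂ hz) (x + J y) (hsub₁ hxy) u (hsub₁ hu) x (hsub₁ hx)).2
    rw [add_sub_cancel_left, hJ] at h1
    have h2 := hεJ y
    have h3 : ‖y‖ ≤ ‖defect Φ z (x + J y) u - defect Φ z x u + y‖ +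
        ‖defect Φ z (x + J y) u - defect Φ z x u‖ := by
      have := norm_sub_le (defect Φ z (x + J y) u - defect Φ z x u + y)
        (defect Φ z (x + J y) u - defect Φ z x u)
      rwa [add_sub_cancel_left] at this
    linarith
  · refine hC ν₁ (fun x => defect Φ z u x) (hcont.comp (by fun_prop : Continuous
      fun x => ((z, u, x) : E × E × E))) (fun x hx y hxy => ?_) μ hμ
    have h1 := (happ z (hsub₂ hz) u (hsub₁ hu) (x + J y) (hsub₁ hxy) x (hsub₁ hx)).1
    rw [add_sub_cancel_left, hJ] at h1
    have h2 := hεJ y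
    have h3 : ‖y‖ ≤ ‖defect Φ z u (x + J y) - defect Φ z u x - y‖ +
        ‖defect Φ z u (x + J y) - defect Φ z u x‖ := by
      have := norm_sub_le (defect Φ z u (x + J y) - defect Φ z u x)
        (defect Φ z u (x + J y) - defect Φ z u x - y)
      rw [sub_sub_cancel] at this
      linarith
    linarith

/-- Points with `D w` not small compared to `w` have well separated defects. -/
theorem exists_le_norm_defect_sub {Φ : E → F} (hΦ : ContDiff ℝ ∞ Φ) (ν₁ ν₂ : E) {ε : ℝ}
    (hε : 0 < ε) :
    ∃ ρ₀ > 0, ∀ ρ : ℝ, ρ ≤ ρ₀ → ∀ z ∈ Metric.closedBall ν₂ ρ,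
      ∀ x ∈ Metric.closedBall ν₁ (2 * ρ), ∀ x' ∈ Metric.closedBall ν₁ (2 * ρ),
      ∀ y ∈ Metric.closedBall ν₁ (2 * ρ),
      ε * ‖x' - y‖ < ‖(fderiv ℝ Φ ν₂ - fderiv ℝ Φ ν₁) (x' - y)‖ →
      ε / 2 * ‖x' - y‖ ≤ ‖defect Φ z x x' - defect Φ z x y‖ := by
  obtain ⟨ρ₀, hρ₀, happ⟩ := exists_defect_approx hΦ ν₁ ν₂ (half_pos hε)
  refine ⟨ρ₀, hρ₀, fun ρ hρ z hz x hx x' hx' y hy h => ?_⟩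
  have hsub₁ : Metric.closedBall ν₁ (2 * ρ) ⊆ Metric.closedBall ν₁ (2 * ρ₀) :=
    Metric.closedBall_subset_closedBall (by linarith)
  have h1 := (happ z (Metric.closedBall_subset_closedBall hρ hz) x (hsub₁ hx) x' (hsub₁ hx')
    y (hsub₁ hy)).1
  set A := (fderiv ℝ Φ ν₂ - fderiv ℝ Φ ν₁) (x' - y)
  have h2 := norm_sub_le (defect Φ z x x' - defect Φ z x y)
    (defect Φ z x x' - defect Φ z x y - A)
  rw [sub_sub_cancel] at h2
  linarith

end Basic

/-! ### Pointwise and integral bounds for the kernel of T*T. -/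

section Majorant

variable {V : Type*} [SeminormedAddCommGroup V]

/-- The majorant of the high-frequency kernel. -/
noncomputable def majorant (n N : ℕ) (l Λ : ℝ) (u : V) : ℝ :=
  l ^ n * decay N l u + Λ ^ n * decay N Λ u

lemma decay_antitone {W : Type*} [SeminormedAddCommGroup W] (N : ℕ) {μ : ℝ} (hμ : 0 ≤ μ) {u : V}
    {v : W} (h : ‖u‖ ≤ ‖v‖) : decay N μ v ≤ decay N μ u := by
  unfold decay; gcongr

lemma majorant_nonneg (n N : ℕ) {l Λ : ℝ} (hl : 0 ≤ l) (hΛ : 0 ≤ Λ) (u : V) :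
    0 ≤ majorant n N l Λ u :=
  add_nonneg (mul_nonneg (by positivity) (decay_nonneg N hl u))
    (mul_nonneg (by positivity) (decay_nonneg N hΛ u))

lemma majorant_antitone {W : Type*} [SeminormedAddCommGroup W] (n N : ℕ) {l Λ : ℝ} (hl : 0 ≤ l)
    (hΛ : 0 ≤ Λ) {u : V} {v : W} (h : ‖u‖ ≤ ‖v‖) : majorant n N l Λ v ≤ majorant n N l Λ u := by
  have h1 := decay_antitone N hl h
  have h2 := decay_antitone N hΛ h
  unfold majorant
  gcongr

/-- Two vectors at distance at least `2‖w‖` cannot both be shorter than `‖w‖`, so one of the factors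
is at most the majorant at `w`; the other is kept. -/
lemma majorant_mul_le {W : Type*} [SeminormedAddCommGroup W] (n N : ℕ) {l Λ : ℝ} (hl : 0 ≤ l)
    (hΛ : 0 ≤ Λ) {u v : V} {w : W} (h : 2 * ‖w‖ ≤ ‖u - v‖) :
    majorant n N l Λ u * majorant n N l Λ v ≤
      majorant n N l Λ w * (majorant n N l Λ u + majorant n N l Λ v) := by
  have hu := majorant_nonneg n N hl hΛ u
  have hv := majorant_nonneg n N hl hΛ v
  have hw := majorant_nonneg n N hl hΛ w
  have h1 := norm_sub_le u v
  rcases le_total ‖w‖ ‖u‖ with h2 | h2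
  · have := majorant_antitone n N hl hΛ h2
    nlinarith [mul_nonneg hw hu]
  · have := majorant_antitone n N hl hΛ (show ‖w‖ ≤ ‖v‖ by linarith)
    nlinarith [mul_nonneg hw hv]

end Majorant

section TTStar

variable {E F : Type*} [NormedAddCommGroup E] [InnerProductSpace ℝ E] [FiniteDimensional ℝ E]
  [MeasurableSpace E] [BorelSpace E]
  [NormedAddCommGroup F] [InnerProductSpace ℝ F] [FiniteDimensional ℝ F]
  [MeasurableSpace F] [BorelSpace F]

/-- The kernel of `T^*T`, where `T` has kernel `multiplierKernel m (defect Φ z x x')`. -/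
noncomputable def ttKernel (Φ : E → F) (a : E → ℝ) (m : F → ℝ) (z x' y : E) : ℂ :=
  ∫ x, (a x : ℂ) * (multiplierKernel m (defect Φ z x x') *
    (starRingEnd ℂ) (multiplierKernel m (defect Φ z x y)))

/-- Both kernels are expanded in frequency and the `x` integral is brought inside, where its
oscillation can be exploited. -/
lemma ttKernel_eq {Φ : E → F} (hΦ : ContDiff ℝ ∞ Φ) {a : E → ℝ} (ha : Integrable a) {m : F → ℝ}
    (hm : Integrable m) (z x' y : E) :
    ttKernel Φ a m z x' y = ∫ q : F × F, ((m q.1 * m q.2 : ℝ) : ℂ) *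
      ∫ x, (a x : ℂ) * phase (inner ℝ q.1 (defect Φ z x x') - inner ℝ q.2 (defect Φ z x y)) := by
  have h1 : ∀ x, (a x : ℂ) * (multiplierKernel m (defect Φ z x x') *
      (starRingEnd ℂ) (multiplierKernel m (defect Φ z x y))) =
      ∫ q : F × F, (a x : ℂ) * (((m q.1 * m q.2 : ℝ) : ℂ) *
        phase (inner ℝ q.1 (defect Φ z x x') - inner ℝ q.2 (defect Φ z x y))) := by
    intro x
    unfold multiplierKernel
    rw [← integral_conj, ← integral_prod_mul, ← integral_const_mul]
    congr 1 with q
    rw [phase_sub]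
    simp only [map_mul, Complex.conj_ofReal, Complex.ofReal_mul]
    ring
  unfold ttKernel
  simp_rw [h1, ← integral_const_mul]
  rw [integral_integral_swap]
  · congr 1 with q
    congr 1 with x
    ring
  · have h2 : Integrable (fun p : E × (F × F) => (a p.1 : ℂ) * ((m p.2.1 * m p.2.2 : ℝ) : ℂ))
        (volume.prod (volume.prod volume)) := by
      have h3 : Integrable (fun q : F × F => m q.1 * m q.2) (volume.prod volume) :=
        hm.mul_prod hm
      exact ha.ofReal.mul_prod h3.ofReal
    have hd := continuous_defect hΦ
    have hd1 : Continuous fun p : E × (F × F) => defect Φ z p.1 x' :=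
      hd.comp (by fun_prop : Continuous fun p : E × (F × F) => ((z, p.1, x') : E × E × E))
    have hd2 : Continuous fun p : E × (F × F) => defect Φ z p.1 y :=
      hd.comp (by fun_prop : Continuous fun p : E × (F × F) => ((z, p.1, y) : E × E × E))
    have hc : Continuous fun p : E × (F × F) =>
        phase (inner ℝ p.2.1 (defect Φ z p.1 x') - inner ℝ p.2.2 (defect Φ z p.1 y)) :=
      continuous_phase.comp (by fun_prop)
    have h4 := h2.mul_bdd (c := 1) hc.aestronglyMeasurable
      (Filter.Eventually.of_forall fun p => (norm_phase _).le)
    refine h4.congr (Filter.Eventually.of_forall fun p => ?_)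
    simp only [Function.uncurry]
    ring

lemma lintegral_decay_outside (N : ℕ) (hN : Module.finrank ℝ F < N) :
    ∃ C : ℝ≥0, ∀ l : ℝ, 0 < l → ∫⁻ s in {s : F | l ≤ ‖s‖}, ENNReal.ofReal ((‖s‖ ^ N)⁻¹) ≤
      C * ENNReal.ofReal (l ^ Module.finrank ℝ F * (l ^ N)⁻¹) := by
  obtain ⟨C, hC⟩ := lintegral_decay (F := F) N hN
  refine ⟨2 ^ N * C, fun l hl => ?_⟩
  have hS : MeasurableSet {s : F | l ≤ ‖s‖} := measurableSet_le measurable_const measurable_norm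
  have hpt : ∀ s ∈ {s : F | l ≤ ‖s‖}, (‖s‖ ^ N)⁻¹ ≤ 2 ^ N * (l ^ N)⁻¹ * decay N l⁻¹ s := by
    intro s hs
    have hs' : l ≤ ‖s‖ := hs
    have hs0 : 0 < ‖s‖ := hl.trans_le hs'
    have h1 : 2 ^ N * (l ^ N)⁻¹ * decay N l⁻¹ s = (((l + ‖s‖) / 2) ^ N)⁻¹ := by
      unfold decay
      rw [← inv_pow, ← inv_pow, ← inv_pow, ← mul_pow, ← mul_pow]
      congr 1
      field_simp
    rw [h1]
    gcongr
    linarith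
  calc ∫⁻ s in {s : F | l ≤ ‖s‖}, ENNReal.ofReal ((‖s‖ ^ N)⁻¹)
      ≤ ∫⁻ s in {s : F | l ≤ ‖s‖},
        ENNReal.ofReal (2 ^ N * (l ^ N)⁻¹) * ENNReal.ofReal (decay N l⁻¹ s) := by
        refine setLIntegral_mono' hS fun s hs => ?_
        rw [← ENNReal.ofReal_mul (by positivity)]
        exact ENNReal.ofReal_le_ofReal (hpt s hs)
    _ ≤ ∫⁻ s : F, ENNReal.ofReal (2 ^ N * (l ^ N)⁻¹) * ENNReal.ofReal (decay N l⁻¹ s) :=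
        setLIntegral_le_lintegral _ _
    _ = ENNReal.ofReal (2 ^ N * (l ^ N)⁻¹) * ∫⁻ s : F, ENNReal.ofReal (decay N l⁻¹ s) :=
        lintegral_const_mul' _ _ ENNReal.ofReal_ne_top
    _ ≤ ENNReal.ofReal (2 ^ N * (l ^ N)⁻¹) *
          (C * ENNReal.ofReal ((l⁻¹ ^ Module.finrank ℝ F)⁻¹)) := by
        gcongr
        exact hC _ (inv_pos.2 hl)
    _ = _ := by
        rw [inv_pow, inv_inv, mul_left_comm, ← ENNReal.ofReal_mul (by positivity)]
        have : (2 : ℝ) ^ N * (l ^ N)⁻¹ * l ^ Module.finrank ℝ F =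
          2 ^ N * (l ^ Module.finrank ℝ F * (l ^ N)⁻¹) := by ring
        rw [this, ENNReal.ofReal_mul (by positivity), ENNReal.ofReal_pow (by norm_num)]
        push_cast
        norm_num
        ring

variable [Nontrivial F]

/-- Of the `(k+1) + (d+1)` powers of decay, the first `k+1` integrate out `t` around `s`; the other
`d+1` are kept for a later integration in `y`. The range `l ≤ ‖s‖` comes from the vanishing of the
high multiplier below `l`. -/
lemma exists_ttKernel_near_le {Φ : E → F} (hΦ : ContDiff ℝ ∞ Φ) {a : E → ℝ} (ha : Integrable a)
    (C : ℝ) (hC : 0 ≤ C) :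
    ∃ C' : ℝ≥0, ∀ (z x' y : E), (∀ t s : F, s ≠ 0 →
        ‖∫ x, (a x : ℂ) * phase (inner ℝ t (defect Φ z x x') - inner ℝ s (defect Φ z x y))‖ ≤
          C * ((1 + (‖t - s‖ + ‖s‖ * ‖x' - y‖)) ^
            ((Module.finrank ℝ F + 1) + (Module.finrank ℝ E + 1)))⁻¹) →
      ∀ Λ l : ℝ, 0 < l → l ≤ Λ → ‖ttKernel Φ a (highMul Λ l) z x' y‖ₑ ≤
        C' * ∫⁻ s in {s : F | l ≤ ‖s‖},
          ENNReal.ofReal (decay (Module.finrank ℝ E + 1) ‖s‖ (x' - y)) := by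
  obtain ⟨C₁, hC₁⟩ := lintegral_decay (F := F) (Module.finrank ℝ F + 1) (Nat.lt_succ_self _)
  refine ⟨C.toNNReal * C₁, fun z x' y hosc Λ l hl hlΛ => ?_⟩
  have hΛ := hl.trans_le hlΛ
  set p := Module.finrank ℝ F + 1
  set r := Module.finrank ℝ E + 1
  set w := x' - y with hw
  have hS : MeasurableSet {s : F | l ≤ ‖s‖} := measurableSet_le measurable_const measurable_norm
  rw [ttKernel_eq hΦ ha (integrable_highMul hΛ l)]
  refine (enorm_integral_le_lintegral_enorm _).trans ?_
  set G : F × F → ℝ≥0∞ := fun q => {s : F | l ≤ ‖s‖}.indicator (fun s =>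
    ENNReal.ofReal (decay p 1 (q.1 - s)) * ENNReal.ofReal (decay r ‖s‖ w)) q.2 with hG
  have hpt : ∀ q : F × F, ‖((highMul Λ l q.1 * highMul Λ l q.2 : ℝ) : ℂ) * ∫ x, (a x : ℂ) *
      phase (inner ℝ q.1 (defect Φ z x x') - inner ℝ q.2 (defect Φ z x y))‖ₑ ≤
        ENNReal.ofReal C * G q := by
    rintro ⟨t, s⟩
    by_cases hs : l ≤ ‖s‖
    · have hs0 : s ≠ 0 := norm_pos_iff.1 (hl.trans_le hs)
      simp only [hG]
      rw [Set.indicator_of_mem (by exact hs), ← ENNReal.ofReal_mul (decay_nonneg _ zero_le_one _),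
        ← ENNReal.ofReal_mul hC, ← ofReal_norm]
      refine ENNReal.ofReal_le_ofReal ?_
      rw [norm_mul, Complex.norm_real, norm_mul]
      have h1 : ‖highMul Λ l t‖ ≤ 1 := (abs_highMul_le Λ l t).trans (gaussMul_le_one _ _)
      have h2 : ‖highMul Λ l s‖ ≤ 1 := (abs_highMul_le Λ l s).trans (gaussMul_le_one _ _)
      have h3 := hosc t s hs0
      have h4 : ((1 + (‖t - s‖ + ‖s‖ * ‖w‖)) ^ (p + r))⁻¹ ≤ decay p 1 (t - s) * decay r ‖s‖ w := by
        unfold decay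
        rw [← mul_inv, pow_add, one_mul]
        have e1 := norm_nonneg (t - s)
        have e2 : 0 ≤ ‖s‖ * ‖w‖ := by positivity
        gcongr <;> linarith
      calc _ ≤ 1 * 1 * (C * ((1 + (‖t - s‖ + ‖s‖ * ‖w‖)) ^ (p + r))⁻¹) := by gcongr
        _ ≤ _ := by rw [one_mul, one_mul]; gcongr
    · have : highMul Λ l s = 0 := highMul_eq_zero Λ hl (not_le.1 hs).le
      simp [this]
  refine (lintegral_mono hpt).trans ?_
  rw [lintegral_const_mul' _ _ ENNReal.ofReal_ne_top, Measure.volume_eq_prod,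
    lintegral_prod_symm]
  · have h5 : ∀ s : F, ∫⁻ t, G (t, s) ≤ {s : F | l ≤ ‖s‖}.indicator
        (fun s => C₁ * ENNReal.ofReal (decay r ‖s‖ w)) s := by
      intro s
      by_cases hs : l ≤ ‖s‖
      · simp only [hG, Set.indicator_of_mem (show s ∈ {s : F | l ≤ ‖s‖} from hs)]
        rw [lintegral_mul_const' _ _ ENNReal.ofReal_ne_top,
          lintegral_sub_right_eq_self (fun t : F => ENNReal.ofReal (decay p 1 t))]
        gcongr
        simpa using hC₁ 1 one_pos
      · simp only [hG, Set.indicator_of_notMem (show s ∉ {s : F | l ≤ ‖s‖} from hs)]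
        simp
    calc ENNReal.ofReal C * ∫⁻ s, ∫⁻ t, G (t, s)
        ≤ ENNReal.ofReal C * ∫⁻ s in {s : F | l ≤ ‖s‖},
          C₁ * ENNReal.ofReal (decay r ‖s‖ w) := by
          rw [← lintegral_indicator hS]
          gcongr with s
          exact h5 s
      _ = _ := by
        rw [lintegral_const_mul' _ _ ENNReal.coe_ne_top, ENNReal.coe_mul, mul_assoc]
        rfl
  · have h6 : Measurable fun q : F × F =>
        ENNReal.ofReal (decay p 1 (q.1 - q.2)) * ENNReal.ofReal (decay r ‖q.2‖ w) := by
      have e1 : Measurable fun q : F × F => decay p 1 (q.1 - q.2) :=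
        ((continuous_decay p zero_le_one).comp (by fun_prop)).measurable
      have e2 : Measurable fun q : F × F => decay r ‖q.2‖ w := by
        unfold decay; fun_prop
      exact e1.ennreal_ofReal.mul e2.ennreal_ofReal
    exact (h6.indicator (measurable_snd hS)).aemeasurable

/-- Bound for the kernel of `T^*T` when the defects are separated. -/
lemma exists_ttKernel_far_le {Φ : E → F} (hΦ : ContDiff ℝ ∞ Φ) {B : Set E} (hB : MeasurableSet B)
    {a : E → ℝ} (ha0 : ∀ x, 0 ≤ a x) (ha1 : ∀ x, a x ≤ 1) (haB : ∀ x ∉ B, a x = 0) (N : ℕ)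
    (C : ℝ≥0) :
    ∃ C' : ℝ≥0, ∀ (z x' y : E), (∀ μ : ℝ, 0 < μ →
        ∫⁻ x in B, ENNReal.ofReal (decay N μ (defect Φ z x x')) ≤
          C * ENNReal.ofReal ((μ ^ Module.finrank ℝ F)⁻¹) ∧
        ∫⁻ x in B, ENNReal.ofReal (decay N μ (defect Φ z x y)) ≤
          C * ENNReal.ofReal ((μ ^ Module.finrank ℝ F)⁻¹)) →
      ∀ w : E, (∀ x ∈ B, 2 * ‖w‖ ≤ ‖defect Φ z x x' - defect Φ z x y‖) →
      ∀ Λ l : ℝ, 0 < l → l ≤ Λ → ‖ttKernel Φ a (highMul Λ l) z x' y‖ₑ ≤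
        C' * ENNReal.ofReal (majorant (Module.finrank ℝ F) N l Λ w) := by
  obtain ⟨K, hK0, hK⟩ := exists_norm_highMul_kernel_le (F := F) N
  refine ⟨(K * K).toNNReal * (4 * C), fun z x' y hbas w hsep Λ l hl hlΛ => ?_⟩
  have hΛ := hl.trans_le hlΛ
  set n := Module.finrank ℝ F
  -- The majorant, composed with the defect, has mass `O(1)` in `x` at both scales: the factor `μ ^
  -- n` cancels the size of the sublevel set at scale `μ⁻¹`.
  have hmaj : ∀ u : E, (∀ μ : ℝ, 0 < μ →
        ∫⁻ x in B, ENNReal.ofReal (decay N μ (defect Φ z x u)) ≤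
          C * ENNReal.ofReal ((μ ^ n)⁻¹)) →
      ∫⁻ x in B, ENNReal.ofReal (majorant n N l Λ (defect Φ z x u)) ≤ 2 * C := by
    intro u hu
    have e : ∀ μ : ℝ, 0 < μ → ∫⁻ x in B, ENNReal.ofReal (μ ^ n * decay N μ (defect Φ z x u)) ≤ C := by
      intro μ hμ
      simp_rw [ENNReal.ofReal_mul (show 0 ≤ μ ^ n by positivity)]
      rw [lintegral_const_mul' _ _ ENNReal.ofReal_ne_top]
      calc _ ≤ ENNReal.ofReal (μ ^ n) * (C * ENNReal.ofReal ((μ ^ n)⁻¹)) := by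
            gcongr; exact hu μ hμ
        _ = C := by
          rw [mul_left_comm, ← ENNReal.ofReal_mul (by positivity),
            mul_inv_cancel₀ (by positivity), ENNReal.ofReal_one, mul_one]
    have hm : Measurable fun x => l ^ n * decay N l (defect Φ z x u) :=
      (continuous_const.mul ((continuous_decay N hl.le).comp ((continuous_defect hΦ).comp
        (by fun_prop : Continuous fun x => ((z, x, u) : E × E × E))))).measurable
    have hsum : ∀ x, ENNReal.ofReal (majorant n N l Λ (defect Φ z x u)) =
        ENNReal.ofReal (l ^ n * decay N l (defect Φ z x u)) +
          ENNReal.ofReal (Λ ^ n * decay N Λ (defect Φ z x u)) := fun x =>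
      ENNReal.ofReal_add (mul_nonneg (by positivity) (decay_nonneg N hl.le _))
        (mul_nonneg (by positivity) (decay_nonneg N hΛ.le _))
    simp_rw [hsum]
    rw [lintegral_add_left hm.ennreal_ofReal, two_mul]
    exact add_le_add (e l hl) (e Λ hΛ)
  refine (enorm_integral_le_lintegral_enorm _).trans ?_
  have hpt : ∀ x, ‖(a x : ℂ) * (multiplierKernel (highMul Λ l) (defect Φ z x x') *
      (starRingEnd ℂ) (multiplierKernel (highMul Λ l) (defect Φ z x y)))‖ₑ ≤
      B.indicator (fun x => ENNReal.ofReal (K * K) * ENNReal.ofReal (majorant n N l Λ w) *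
        (ENNReal.ofReal (majorant n N l Λ (defect Φ z x x')) +
          ENNReal.ofReal (majorant n N l Λ (defect Φ z x y)))) x := by
    intro x
    by_cases hx : x ∈ B
    · rw [Set.indicator_of_mem hx, ← ENNReal.ofReal_mul (by positivity),
        ← ENNReal.ofReal_add (majorant_nonneg n N hl.le hΛ.le _) (majorant_nonneg n N hl.le hΛ.le _),
        ← ENNReal.ofReal_mul (mul_nonneg (by positivity) (majorant_nonneg n N hl.le hΛ.le _)),
        ← ofReal_norm]
      refine ENNReal.ofReal_le_ofReal ?_
      rw [norm_mul, norm_mul, RCLike.norm_conj, Complex.norm_real, Real.norm_of_nonneg (ha0 x)]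
      have h1 := hK Λ l hl hlΛ (defect Φ z x x')
      have h2 := hK Λ l hl hlΛ (defect Φ z x y)
      have h3 := majorant_mul_le n N hl.le hΛ.le (hsep x hx)
      calc _ ≤ 1 * ((K * majorant n N l Λ (defect Φ z x x')) *
            (K * majorant n N l Λ (defect Φ z x y))) := by
            exact mul_le_mul (ha1 x) (mul_le_mul h1 h2 (norm_nonneg _)
              (mul_nonneg hK0 (majorant_nonneg n N hl.le hΛ.le _))) (by positivity) zero_le_one
        _ = K * K * (majorant n N l Λ (defect Φ z x x') *
            majorant n N l Λ (defect Φ z x y)) := by ring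
        _ ≤ K * K * (majorant n N l Λ w * (majorant n N l Λ (defect Φ z x x') +
            majorant n N l Λ (defect Φ z x y))) := by gcongr
        _ = _ := by ring
    · rw [Set.indicator_of_notMem hx, haB x hx]
      simp
  refine (lintegral_mono hpt).trans ?_
  rw [lintegral_indicator hB, lintegral_const_mul' _ _
    (ENNReal.mul_ne_top ENNReal.ofReal_ne_top ENNReal.ofReal_ne_top)]
  have hm : Measurable fun x => ENNReal.ofReal (majorant n N l Λ (defect Φ z x x')) := by
    have hc : Continuous fun x => defect Φ z x x' := (continuous_defect hΦ).comp
        (by fun_prop : Continuous fun x => ((z, x, x') : E × E × E))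
    have h1 := (continuous_decay (F := F) N hl.le).comp hc
    have h2 := (continuous_decay (F := F) N hΛ.le).comp hc
    exact ((continuous_const.mul h1).add (continuous_const.mul h2)).measurable.ennreal_ofReal
  rw [lintegral_add_left hm]
  calc _ ≤ ENNReal.ofReal (K * K) * ENNReal.ofReal (majorant n N l Λ w) * (2 * C + 2 * C) := by
        gcongr
        · exact hmaj x' fun μ hμ => (hbas μ hμ).1
        · exact hmaj y fun μ hμ => (hbas μ hμ).2
    _ = _ := by
        rw [ENNReal.coe_mul, ENNReal.coe_mul]
        change ENNReal.ofReal (K * K) * _ * _ = ENNReal.ofReal (K * K) * _ * _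
        push_cast
        ring

end TTStar

section Restricted

variable {E F : Type*} [NormedAddCommGroup E] [InnerProductSpace ℝ E] [FiniteDimensional ℝ E]
  [MeasurableSpace E] [BorelSpace E]
  [NormedAddCommGroup F] [InnerProductSpace ℝ F] [FiniteDimensional ℝ F]
  [MeasurableSpace F] [BorelSpace F]

lemma exists_lintegral_majorant_le (hFE : Module.finrank ℝ F ≤ Module.finrank ℝ E) {c : ℝ}
    (hc : 0 < c) : ∃ C : ℝ≥0, ∀ (x' : E) (Λ l : ℝ), 0 < l → l ≤ Λ →
      ∫⁻ y : E, ENNReal.ofReal (majorant (Module.finrank ℝ F) (Module.finrank ℝ E + 1) l Λ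
        (c • (x' - y))) ≤
      C * ENNReal.ofReal (l ^ Module.finrank ℝ F * (l ^ Module.finrank ℝ E)⁻¹) := by
  set n := Module.finrank ℝ F
  set d := Module.finrank ℝ E
  obtain ⟨C, hC⟩ := lintegral_decay (F := E) (d + 1) (Nat.lt_succ_self _)
  refine ⟨2 * (C * ((c ^ d)⁻¹).toNNReal), fun x' Λ l hl hlΛ => ?_⟩
  have hΛ := hl.trans_le hlΛ
  have e : ∀ μ : ℝ, 0 < μ → ∫⁻ y : E, ENNReal.ofReal (μ ^ n * decay (d + 1) μ (c • (x' - y))) ≤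
      C * ((c ^ d)⁻¹).toNNReal * ENNReal.ofReal (μ ^ n * (μ ^ d)⁻¹) := by
    intro μ hμ
    have h1 : ∀ y : E, decay (d + 1) μ (c • (x' - y)) = decay (d + 1) (μ * c) (x' - y) := by
      intro y
      unfold decay
      rw [norm_smul, Real.norm_of_nonneg hc.le, mul_assoc]
    simp_rw [h1, ENNReal.ofReal_mul (show 0 ≤ μ ^ n by positivity)]
    rw [lintegral_const_mul' _ _ ENNReal.ofReal_ne_top,
      lintegral_sub_left_eq_self (fun y : E => ENNReal.ofReal (decay (d + 1) (μ * c) y))]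
    calc _ ≤ ENNReal.ofReal (μ ^ n) * (C * ENNReal.ofReal (((μ * c) ^ d)⁻¹)) := by
          gcongr
          exact hC _ (by positivity)
      _ = _ := by
        rw [mul_pow, mul_inv, ENNReal.ofReal_mul (show 0 ≤ (μ ^ d)⁻¹ by positivity)]
        change _ = C * ENNReal.ofReal ((c ^ d)⁻¹) * _
        ring
  -- As `n ≤ d`, the power `μ ^ (n - d)` does not increase with `μ`, so the scale `l` dominates.
  have hmono : Λ ^ n * (Λ ^ d)⁻¹ ≤ l ^ n * (l ^ d)⁻¹ := by
    obtain ⟨j, hj⟩ := Nat.exists_eq_add_of_le hFE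
    rw [hj, pow_add, pow_add, mul_inv, mul_inv, ← mul_assoc, ← mul_assoc,
      mul_inv_cancel₀ (by positivity), mul_inv_cancel₀ (by positivity), one_mul, one_mul]
    gcongr
  have hm : Measurable fun y : E => l ^ n * decay (d + 1) l (c • (x' - y)) :=
    (continuous_const.mul ((continuous_decay _ hl.le).comp
      (by fun_prop : Continuous fun y : E => c • (x' - y)))).measurable
  have hsum : ∀ y : E, ENNReal.ofReal (majorant n (d + 1) l Λ (c • (x' - y))) =
      ENNReal.ofReal (l ^ n * decay (d + 1) l (c • (x' - y))) +
        ENNReal.ofReal (Λ ^ n * decay (d + 1) Λ (c • (x' - y))) := fun y =>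
    ENNReal.ofReal_add (mul_nonneg (by positivity) (decay_nonneg _ hl.le _))
      (mul_nonneg (by positivity) (decay_nonneg _ hΛ.le _))
  simp_rw [hsum]
  rw [lintegral_add_left hm.ennreal_ofReal]
  calc _ ≤ C * ((c ^ d)⁻¹).toNNReal * ENNReal.ofReal (l ^ n * (l ^ d)⁻¹) +
        C * ((c ^ d)⁻¹).toNNReal * ENNReal.ofReal (l ^ n * (l ^ d)⁻¹) :=
        add_le_add (e l hl) ((e Λ hΛ).trans (by gcongr))
    _ = _ := by push_cast; ring

variable [Nontrivial F]

/-- Each `y` falls into the cone around `ker D`, where oscillation helps, or outside it, where the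
defects separate. Both contributions integrate in `y` to `l ^ (k - d)`, which is the squared `L²`
size of the high-frequency operator. -/
theorem exists_lintegral_ttKernel_le {Φ : E → F} (hΦ : ContDiff ℝ ∞ Φ) {ν₁ ν₂ : E}
    (hND : Nondegenerate (fderiv ℝ Φ ν₂ - fderiv ℝ Φ ν₁) (fderiv ℝ (fderiv ℝ Φ) ν₂))
    (hFE : Module.finrank ℝ F < Module.finrank ℝ E) :
    ∃ ρ₀ > 0, ∀ ρ : ℝ, 0 < ρ → ρ ≤ ρ₀ → ∀ a : E → ℝ, ContDiff ℝ ∞ a → (∀ x, 0 ≤ a x) →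
      (∀ x, a x ≤ 1) → (∀ x ∉ Metric.closedBall ν₁ (2 * ρ), a x = 0) →
      ∃ C : ℝ≥0, ∀ z ∈ Metric.closedBall ν₂ ρ, ∀ x' ∈ Metric.closedBall ν₁ ρ, ∀ Λ l : ℝ,
        0 < l → l ≤ Λ →
        ∫⁻ y in Metric.closedBall ν₁ ρ, ‖ttKernel Φ a (highMul Λ l) z x' y‖ₑ ≤
          C * ENNReal.ofReal (l ^ Module.finrank ℝ F * (l ^ Module.finrank ℝ E)⁻¹) := by
  obtain ⟨J, hJ⟩ := hND.exists_rightInverse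
  obtain ⟨ε, hε, ρ₁, hρ₁, hosc⟩ := exists_norm_integral_defect_le hΦ hND
  obtain ⟨ρ₂, hρ₂, hbas⟩ := exists_setLIntegral_defect_le hΦ hJ
  obtain ⟨ρ₃, hρ₃, hsep⟩ := exists_le_norm_defect_sub hΦ ν₁ ν₂ hε
  set n := Module.finrank ℝ F with hn
  set d := Module.finrank ℝ E with hd
  refine ⟨min ρ₁ (min ρ₂ ρ₃), by positivity, fun ρ hρ hρle a has ha0 ha1 haB => ?_⟩
  have hle₁ : ρ ≤ ρ₁ := hρle.trans (min_le_left _ _)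
  have hle₂ : ρ ≤ ρ₂ := hρle.trans ((min_le_right _ _).trans (min_le_left _ _))
  have hle₃ : ρ ≤ ρ₃ := hρle.trans ((min_le_right _ _).trans (min_le_right _ _))
  have hai : Integrable a := has.continuous.integrable_of_hasCompactSupport
    (HasCompactSupport.intro (isCompact_closedBall _ _) haB)
  obtain ⟨C₁, hC₁0, hC₁⟩ := hosc ρ hle₁ ((n + 1) + (d + 1)) a has haB
  obtain ⟨C₂, hC₂⟩ := exists_ttKernel_near_le hΦ hai C₁ hC₁0
  obtain ⟨C₃, hC₃⟩ := hbas ρ hle₂ (d + 1) (by omega)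
  obtain ⟨C₄, hC₄⟩ := exists_ttKernel_far_le hΦ Metric.isClosed_closedBall.measurableSet ha0 ha1 haB
    (d + 1) C₃
  obtain ⟨C₅, hC₅⟩ := exists_lintegral_majorant_le (E := E) (F := F) hFE.le
    (show 0 < ε / 4 by positivity)
  obtain ⟨C₆, hC₆⟩ := lintegral_decay_outside (F := F) d hFE
  obtain ⟨C₇, hC₇⟩ := lintegral_decay (F := E) (d + 1) (Nat.lt_succ_self _)
  refine ⟨C₂ * (C₇ * C₆) + C₄ * C₅, fun z hz x' hx' Λ l hl hlΛ => ?_⟩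
  have hsub : Metric.closedBall ν₁ ρ ⊆ Metric.closedBall ν₁ (2 * ρ) :=
    Metric.closedBall_subset_closedBall (by linarith)
  have hS : MeasurableSet {s : F | l ≤ ‖s‖} := measurableSet_le measurable_const measurable_norm
  set near : E → ℝ≥0∞ := fun y => C₂ * ∫⁻ s in {s : F | l ≤ ‖s‖},
    ENNReal.ofReal (decay (d + 1) ‖s‖ (x' - y)) with hnear
  set far : E → ℝ≥0∞ := fun y =>
    C₄ * ENNReal.ofReal (majorant n (d + 1) l Λ ((ε / 4) • (x' - y))) with hfar
  have hpt : ∀ y ∈ Metric.closedBall ν₁ ρ,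
      ‖ttKernel Φ a (highMul Λ l) z x' y‖ₑ ≤ near y + far y := by
    intro y hy
    by_cases hcone : ‖(fderiv ℝ Φ ν₂ - fderiv ℝ Φ ν₁) (x' - y)‖ ≤ ε * ‖x' - y‖
    · exact (hC₂ z x' y (hC₁ z hz x' hx' y hy hcone) Λ l hl hlΛ).trans le_self_add
    · refine (hC₄ z x' y (fun μ hμ => ⟨(hC₃ z hz x' (hsub hx') μ hμ).1,
        (hC₃ z hz y (hsub hy) μ hμ).1⟩) ((ε / 4) • (x' - y)) (fun x hx => ?_) Λ l hl hlΛ).trans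
        le_add_self
      rw [norm_smul, Real.norm_of_nonneg (by positivity)]
      have := hsep ρ hle₃ z hz x hx x' (hsub hx') y (hsub hy) (not_le.1 hcone)
      linarith
  have hmeas : Measurable fun q : E × F => ENNReal.ofReal (decay (d + 1) ‖q.2‖ (x' - q.1)) := by
    have : Measurable fun q : E × F => decay (d + 1) ‖q.2‖ (x' - q.1) := by
      unfold decay; fun_prop
    exact this.ennreal_ofReal
  have hnm : Measurable near := by
    refine Measurable.const_mul ?_ _
    exact hmeas.lintegral_prod_right'
  calc ∫⁻ y in Metric.closedBall ν₁ ρ, ‖ttKernel Φ a (highMul Λ l) z x' y‖ₑ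
      ≤ ∫⁻ y in Metric.closedBall ν₁ ρ, (near y + far y) :=
        setLIntegral_mono' Metric.isClosed_closedBall.measurableSet hpt
    _ ≤ ∫⁻ y, (near y + far y) := setLIntegral_le_lintegral _ _
    _ = (∫⁻ y, near y) + ∫⁻ y, far y := lintegral_add_left hnm _
    _ ≤ C₂ * (C₇ * (C₆ * ENNReal.ofReal (l ^ n * (l ^ d)⁻¹))) +
          C₄ * (C₅ * ENNReal.ofReal (l ^ n * (l ^ d)⁻¹)) := by
        refine add_le_add ?_ ?_
        · simp only [hnear]
          rw [lintegral_const_mul' _ _ ENNReal.coe_ne_top, lintegral_lintegral_swap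
            hmeas.aemeasurable]
          gcongr
          -- Integrating in `y` first yields `‖s‖ ^ (-d)`, which is integrable over `‖s‖ ≥ l` in
          -- dimension `k` because `k < d`.
          calc ∫⁻ s in {s : F | l ≤ ‖s‖}, ∫⁻ y, ENNReal.ofReal (decay (d + 1) ‖s‖ (x' - y))
              ≤ ∫⁻ s in {s : F | l ≤ ‖s‖}, C₇ * ENNReal.ofReal ((‖s‖ ^ d)⁻¹) := by
                refine setLIntegral_mono' hS fun s hs => ?_
                rw [lintegral_sub_left_eq_self
                  (fun y : E => ENNReal.ofReal (decay (d + 1) ‖s‖ y))]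
                exact hC₇ _ (hl.trans_le hs)
            _ ≤ _ := by
                rw [lintegral_const_mul' _ _ ENNReal.coe_ne_top]
                gcongr
                exact hC₆ l hl
        · simp only [hfar]
          rw [lintegral_const_mul' _ _ ENNReal.coe_ne_top]
          gcongr
          exact hC₅ x' Λ l hl hlΛ
    _ = _ := by push_cast; ring

/-- The `T^*T` argument for the bilinear form of an averaging operator on indicator functions. -/
lemma enorm_setIntegral_le_of_kernel {g : E → E → ℂ} (hgc : Continuous fun p : E × E => g p.1 p.2)
    {Kb : ℝ} (hKb0 : 0 ≤ Kb) (hgb : ∀ x x', ‖g x x'‖ ≤ Kb) {A A' B : Set E}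
    (hA : MeasurableSet A) (hA' : MeasurableSet A') (hA't : volume A' ≠ ⊤) (hA'B : A' ⊆ B)
    {a : E → ℝ} (ha : Integrable a) (ha0 : ∀ x, 0 ≤ a x) (haA : ∀ x ∈ A, a x = 1) (W : ℝ≥0∞)
    (hW : ∀ x' ∈ B, ∫⁻ y in B, ‖∫ x, (a x : ℂ) * (g x x' * (starRingEnd ℂ) (g x y))‖ₑ ≤ W) :
    ‖∫ x in A, ∫ x' in A', g x x'‖ₑ ≤
      (volume A) ^ (1 / 2 : ℝ) * (volume A' * W) ^ (1 / 2 : ℝ) := by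
  set G : E → ℂ := fun x => ∫ x' in A', g x x' with hG
  have hGm : StronglyMeasurable G := hgc.stronglyMeasurable.integral_prod_right'
  have : IsFiniteMeasure (volume.restrict A') := ⟨by simpa using hA't.lt_top⟩
  have hint : Integrable (fun p : E × (E × E) => (a p.1 : ℂ) * (g p.1 p.2.1 *
      (starRingEnd ℂ) (g p.1 p.2.2)))
      (volume.prod ((volume.restrict A').prod (volume.restrict A'))) := by
    have h1 : Integrable (fun p : E × (E × E) => (a p.1 : ℂ))
        (volume.prod ((volume.restrict A').prod (volume.restrict A'))) :=
      (ha.ofReal (𝕜 := ℂ)).comp_fst _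
    have e1 : Continuous fun p : E × (E × E) => g p.1 p.2.1 :=
      hgc.comp (by fun_prop : Continuous fun p : E × (E × E) => (p.1, p.2.1))
    have e2 : Continuous fun p : E × (E × E) => g p.1 p.2.2 :=
      hgc.comp (by fun_prop : Continuous fun p : E × (E × E) => (p.1, p.2.2))
    have e3 : Continuous fun p : E × (E × E) => g p.1 p.2.1 * (starRingEnd ℂ) (g p.1 p.2.2) :=
      e1.mul (Complex.continuous_conj.comp e2)
    have e4 : ∀ p : E × (E × E), ‖g p.1 p.2.1 * (starRingEnd ℂ) (g p.1 p.2.2)‖ ≤ Kb * Kb := by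
      intro p
      rw [norm_mul, RCLike.norm_conj]
      exact mul_le_mul (hgb _ _) (hgb _ _) (norm_nonneg _) hKb0
    exact h1.mul_bdd e3.aestronglyMeasurable (Filter.Eventually.of_forall e4)
  have hGG : ∀ x, (a x : ℂ) * (G x * (starRingEnd ℂ) (G x)) =
      ∫ q : E × E, (a x : ℂ) * (g x q.1 * (starRingEnd ℂ) (g x q.2))
        ∂((volume.restrict A').prod (volume.restrict A')) := by
    intro x
    simp only [hG]
    rw [← integral_conj, ← integral_prod_mul, ← integral_const_mul]
  have hGi : Integrable fun x => a x * ‖G x‖ ^ 2 := by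
    have h1 := hint.integral_prod_left.norm
    refine h1.congr (Filter.Eventually.of_forall fun x => ?_)
    simp only
    rw [← hGG, norm_mul, norm_mul, RCLike.norm_conj, Complex.norm_real, Real.norm_of_nonneg (ha0 x)]
    ring
  -- Since `a = 1` on `A`, the square over `A` is at most the integral weighted by `a` over the
  -- whole space. Expanding that square produces the `T*T` kernel with amplitude `a`, which in the
  -- application is smooth, unlike the indicator of `A`.
  have hmain : ∫⁻ x in A, ‖G x‖ₑ ^ (2 : ℝ) ≤ volume A' * W := by
    calc ∫⁻ x in A, ‖G x‖ₑ ^ (2 : ℝ) ≤ ∫⁻ x in A, ENNReal.ofReal (a x * ‖G x‖ ^ 2) := by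
          refine setLIntegral_mono' hA fun x hx => ?_
          rw [haA x hx, one_mul, ENNReal.ofReal_pow (norm_nonneg _), ofReal_norm]
          norm_cast
      _ ≤ ∫⁻ x, ENNReal.ofReal (a x * ‖G x‖ ^ 2) := setLIntegral_le_lintegral _ _
      _ = ENNReal.ofReal (∫ x, a x * ‖G x‖ ^ 2) :=
          (ofReal_integral_eq_lintegral_ofReal hGi (Filter.Eventually.of_forall fun x =>
            mul_nonneg (ha0 x) (sq_nonneg _))).symm
      _ = ‖∫ x, (a x : ℂ) * (G x * (starRingEnd ℂ) (G x))‖ₑ := by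
          have h1 : ∀ x, (a x : ℂ) * (G x * (starRingEnd ℂ) (G x)) =
              ((a x * ‖G x‖ ^ 2 : ℝ) : ℂ) := fun x => by
            rw [Complex.mul_conj, Complex.normSq_eq_norm_sq, Complex.ofReal_mul]
          simp_rw [h1]
          rw [integral_complex_ofReal, ← ofReal_norm, Complex.norm_real, Real.norm_of_nonneg
            (integral_nonneg fun x => mul_nonneg (ha0 x) (sq_nonneg _))]
      _ = ‖∫ q : E × E, (∫ x : E, (a x : ℂ) * (g x q.1 * (starRingEnd ℂ) (g x q.2)))
            ∂((volume.restrict A').prod (volume.restrict A'))‖ₑ := by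
          simp_rw [hGG]
          rw [integral_integral_swap hint]
      -- Schur-type bound by integrals along rows.
      _ ≤ ∫⁻ q : E × E, ‖∫ x, (a x : ℂ) * (g x q.1 * (starRingEnd ℂ) (g x q.2))‖ₑ
            ∂((volume.restrict A').prod (volume.restrict A')) :=
          enorm_integral_le_lintegral_enorm _
      _ ≤ ∫⁻ x' in A', ∫⁻ y in A', ‖∫ x, (a x : ℂ) * (g x x' * (starRingEnd ℂ) (g x y))‖ₑ := lintegral_prod_le _
      _ ≤ ∫⁻ _ in A', W := by
          refine setLIntegral_mono' hA' fun x' hx' => ?_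
          exact (lintegral_mono_set hA'B).trans (hW x' (hA'B hx'))
      _ = volume A' * W := by rw [setLIntegral_const, mul_comm]
  calc ‖∫ x in A, G x‖ₑ ≤ ∫⁻ x in A, ‖G x‖ₑ := enorm_integral_le_lintegral_enorm _
    _ = ∫⁻ x in A, (1 * ‖G x‖ₑ) := by simp
    _ ≤ (∫⁻ _ in A, (1 : ℝ≥0∞) ^ (2 : ℝ)) ^ (1 / 2 : ℝ) *
          (∫⁻ x in A, ‖G x‖ₑ ^ (2 : ℝ)) ^ (1 / 2 : ℝ) :=
        ENNReal.lintegral_mul_le_Lp_mul_Lq _ Real.HolderConjugate.two_two aemeasurable_const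
          hGm.enorm.aemeasurable
    _ ≤ _ := by
        gcongr
        simp

lemma enorm_setIntegral_high_le {Φ : E → F} (hΦ : ContDiff ℝ ∞ Φ) {A A' B : Set E}
    (hA : MeasurableSet A) (hA' : MeasurableSet A') (hA't : volume A' ≠ ⊤) (hA'B : A' ⊆ B)
    {a : E → ℝ} (ha : Integrable a) (ha0 : ∀ x, 0 ≤ a x) (haA : ∀ x ∈ A, a x = 1) {m : F → ℝ}
    (hm : Integrable m) (z : E) (W : ℝ≥0∞)
    (hW : ∀ x' ∈ B, ∫⁻ y in B, ‖ttKernel Φ a m z x' y‖ₑ ≤ W) :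
    ‖∫ x in A, ∫ x' in A', multiplierKernel m (defect Φ z x x')‖ₑ ≤
      (volume A) ^ (1 / 2 : ℝ) * (volume A' * W) ^ (1 / 2 : ℝ) :=
  enorm_setIntegral_le_of_kernel (g := fun x x' => multiplierKernel m (defect Φ z x x'))
    ((continuous_multiplierKernel hm).comp ((continuous_defect hΦ).comp
      (by fun_prop : Continuous fun p : E × E => ((z, p.1, p.2) : E × E × E))))
    (integral_nonneg fun t => abs_nonneg (m t)) (fun x x' => norm_multiplierKernel_le m _)
    hA hA' hA't hA'B ha ha0 haA W hW

/-- The Gaussian is the sum of its low and high parts; the low part is estimated by its supremum,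
whereas the high part must keep its sign changes and stays inside the norm. -/
lemma lintegral_gaussKer_le_split {Φ : E → F} (hΦ : ContDiff ℝ ∞ Φ) {A A' : Set E}
    (hAt : volume A ≠ ⊤) (hA't : volume A' ≠ ⊤) (z : E) {Λ l K : ℝ} (hΛ : 0 < Λ)
    (hK : ∀ u : F, ‖multiplierKernel (lowMul Λ l) u‖ ≤ K) :
    ∫⁻ x in A, ∫⁻ x' in A', ENNReal.ofReal (gaussKer Λ (defect Φ z x x')) ≤
      ENNReal.ofReal K * (volume A * volume A') +
        ‖∫ x in A, ∫ x' in A', multiplierKernel (highMul Λ l) (defect Φ z x x')‖ₑ := by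
  have : IsFiniteMeasure (volume.restrict A) := ⟨by simpa using hAt.lt_top⟩
  have : IsFiniteMeasure (volume.restrict A') := ⟨by simpa using hA't.lt_top⟩
  set π := (volume.restrict A).prod (volume.restrict A') with hπ
  have hdc : Continuous fun p : E × E => defect Φ z p.1 p.2 := (continuous_defect hΦ).comp
    (by fun_prop : Continuous fun p : E × E => ((z, p.1, p.2) : E × E × E))
  have hint : ∀ m : F → ℝ, Integrable m →
      Integrable (fun p : E × E => multiplierKernel m (defect Φ z p.1 p.2)) π := fun m hm =>
    Integrable.of_bound ((continuous_multiplierKernel hm).comp hdc).aestronglyMeasurable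
      (∫ t, |m t|) (Filter.Eventually.of_forall fun p => norm_multiplierKernel_le m _)
  have hgi : Integrable (fun p : E × E => gaussKer Λ (defect Φ z p.1 p.2)) π :=
    Integrable.of_bound ((continuous_gaussKer Λ).comp hdc).aestronglyMeasurable
      (Λ ^ Module.finrank ℝ F) (Filter.Eventually.of_forall fun p => by
        rw [Real.norm_of_nonneg (gaussKer_nonneg hΛ.le _)]
        exact gaussKer_le hΛ.le _)
  have h1 : ∫⁻ x in A, ∫⁻ x' in A', ENNReal.ofReal (gaussKer Λ (defect Φ z x x')) =
      ∫⁻ p, ENNReal.ofReal (gaussKer Λ (defect Φ z p.1 p.2)) ∂π :=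
    lintegral_lintegral ((continuous_gaussKer Λ).comp hdc).measurable.ennreal_ofReal.aemeasurable
  rw [h1, ← ofReal_integral_eq_lintegral_ofReal hgi
    (Filter.Eventually.of_forall fun p => gaussKer_nonneg hΛ.le _)]
  have h2 : ((∫ p, gaussKer Λ (defect Φ z p.1 p.2) ∂π : ℝ) : ℂ) =
      (∫ p, multiplierKernel (lowMul Λ l) (defect Φ z p.1 p.2) ∂π) +
        ∫ x in A, ∫ x' in A', multiplierKernel (highMul Λ l) (defect Φ z x x') := by
    rw [integral_integral (hint _ (integrable_highMul hΛ l)),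
      ← integral_add (hint _ (integrable_lowMul hΛ l)) (hint _ (integrable_highMul hΛ l)),
      ← integral_complex_ofReal]
    congr 1 with p
    exact (multiplierKernel_low_add_high hΛ l _).symm
  have h3 : ENNReal.ofReal (∫ p, gaussKer Λ (defect Φ z p.1 p.2) ∂π) =
      ‖((∫ p, gaussKer Λ (defect Φ z p.1 p.2) ∂π : ℝ) : ℂ)‖ₑ := by
    rw [← ofReal_norm, Complex.norm_real, Real.norm_of_nonneg
      (integral_nonneg fun p => gaussKer_nonneg hΛ.le _)]
  rw [h3, h2]
  refine (enorm_add_le _ _).trans ?_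
  gcongr
  refine (enorm_integral_le_lintegral_enorm _).trans ?_
  calc ∫⁻ p, ‖multiplierKernel (lowMul Λ l) (defect Φ z p.1 p.2)‖ₑ ∂π
      ≤ ∫⁻ _, ENNReal.ofReal K ∂π := by
        refine lintegral_mono fun p => ?_
        rw [← ofReal_norm]
        exact ENNReal.ofReal_le_ofReal (hK _)
    _ = _ := by
      rw [lintegral_const, hπ, ← Set.univ_prod_univ, Measure.prod_prod]
      simp

/-- The restricted-type estimate for the averaging operator with kernel a Gaussian in the
defect, uniformly in the scale. -/
theorem exists_restricted_estimate {Φ : E → F} (hΦ : ContDiff ℝ ∞ Φ) {ν₁ ν₂ : E}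
    (hND : Nondegenerate (fderiv ℝ Φ ν₂ - fderiv ℝ Φ ν₁) (fderiv ℝ (fderiv ℝ Φ) ν₂)) :
    ∃ ρ₀ > 0, ∀ ρ, 0 < ρ → ρ ≤ ρ₀ → ∃ C : ℝ≥0, ∀ z ∈ Metric.closedBall ν₂ ρ, ∀ A A' : Set E,
      MeasurableSet A → MeasurableSet A' →
      A ⊆ Metric.closedBall ν₁ ρ → A' ⊆ Metric.closedBall ν₁ ρ → ∀ Λ : ℝ, 0 < Λ →
      ∫⁻ x in A, ∫⁻ x' in A', ENNReal.ofReal (gaussKer Λ (defect Φ z x x')) ≤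
        C * (volume A * volume A') ^ ((Module.finrank ℝ E : ℝ) /
          (Module.finrank ℝ E + Module.finrank ℝ F)) := by
  obtain ⟨J, hJ⟩ := hND.exists_rightInverse
  set n := Module.finrank ℝ F with hn
  set d := Module.finrank ℝ E with hd
  have hn0 : 0 < n := Module.finrank_pos
  have hnd : n ≤ d := by
    refine LinearMap.finrank_le_finrank_of_injective (f := (J : F →ₗ[ℝ] E)) fun y y' h => ?_
    have h' : J y = J y' := h
    rw [← hJ y, h', hJ y']
  -- If `k = d` the `s` integral of the `T*T` bound diverges logarithmically, but the defect is then
  -- locally invertible in each variable. Row and column integrals are bounded, so the form is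
  -- `O(|A|)` and `O(|A'|)`, and the geometric mean has exponent `1/2 = d/(d+k)`.
  rcases hnd.eq_or_lt with heq | hlt
  · obtain ⟨ρ₂, hρ₂, hbas⟩ := exists_setLIntegral_defect_le hΦ hJ
    obtain ⟨K, hK0, hK⟩ := exists_gaussKer_le_decay (F := F) (n + 1)
    refine ⟨ρ₂, hρ₂, fun ρ hρ hρle => ?_⟩
    obtain ⟨C, hC⟩ := hbas ρ hρle (n + 1) (Nat.lt_succ_self _)
    refine ⟨K.toNNReal * C, fun z hz A A' hA hA' hAB hA'B Λ hΛ => ?_⟩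
    have hsub : Metric.closedBall ν₁ ρ ⊆ Metric.closedBall ν₁ (2 * ρ) :=
      Metric.closedBall_subset_closedBall (by linarith)
    have hg : ∀ u : F, ENNReal.ofReal (gaussKer Λ u) ≤
        ENNReal.ofReal (K * Λ ^ n) * ENNReal.ofReal (decay (n + 1) Λ u) := fun u => by
      rw [← ENNReal.ofReal_mul (by positivity)]
      refine ENNReal.ofReal_le_ofReal ((hK Λ hΛ u).trans_eq (by ring))
    have hfin : ∀ I : ℝ≥0∞, I ≤ C * ENNReal.ofReal ((Λ ^ n)⁻¹) →
        ENNReal.ofReal (K * Λ ^ n) * I ≤ K.toNNReal * C := by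
      intro I hI
      calc _ ≤ ENNReal.ofReal (K * Λ ^ n) * (C * ENNReal.ofReal ((Λ ^ n)⁻¹)) := by gcongr
        _ = ENNReal.ofReal (K * Λ ^ n * (Λ ^ n)⁻¹) * C := by
          rw [ENNReal.ofReal_mul (show 0 ≤ K * Λ ^ n by positivity)]
          ring
        _ = _ := by
          rw [mul_assoc, mul_inv_cancel₀ (by positivity), mul_one]
          rfl
    have h1 : ∀ x ∈ A, ∫⁻ x' in A', ENNReal.ofReal (gaussKer Λ (defect Φ z x x')) ≤
        K.toNNReal * C := by
      intro x hx
      refine (lintegral_mono fun x' => hg _).trans ?_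
      rw [lintegral_const_mul' _ _ ENNReal.ofReal_ne_top]
      exact hfin _ ((lintegral_mono_set (hA'B.trans hsub)).trans (hC z hz x (hsub (hAB hx)) Λ hΛ).2)
    have h2 : ∀ x' ∈ A', ∫⁻ x in A, ENNReal.ofReal (gaussKer Λ (defect Φ z x x')) ≤
        K.toNNReal * C := by
      intro x' hx'
      refine (lintegral_mono fun x => hg _).trans ?_
      rw [lintegral_const_mul' _ _ ENNReal.ofReal_ne_top]
      exact hfin _ ((lintegral_mono_set (hAB.trans hsub)).trans (hC z hz x' (hsub (hA'B hx')) Λ hΛ).1)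
    set I := ∫⁻ x in A, ∫⁻ x' in A', ENNReal.ofReal (gaussKer Λ (defect Φ z x x')) with hI
    have h3 : I ≤ K.toNNReal * C * volume A :=
      (setLIntegral_mono' hA h1).trans_eq (setLIntegral_const _ _)
    have h4 : I ≤ K.toNNReal * C * volume A' := by
      have hdc : Continuous fun p : E × E => defect Φ z p.1 p.2 := (continuous_defect hΦ).comp
        (by fun_prop : Continuous fun p : E × E => ((z, p.1, p.2) : E × E × E))
      rw [hI, lintegral_lintegral_swap
        ((continuous_gaussKer Λ).comp hdc).measurable.ennreal_ofReal.aemeasurable]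
      exact (setLIntegral_mono' hA' h2).trans_eq (setLIntegral_const _ _)
    have hexp : (d : ℝ) / (d + n) = 1 / 2 := by
      rw [heq]
      have : (d : ℝ) ≠ 0 := by
        have : 0 < d := heq ▸ hn0
        positivity
      field_simp
      norm_num
    rw [hexp]
    have h5 : I = (I * I) ^ (1 / 2 : ℝ) := by
      rw [← pow_two, ← ENNReal.rpow_natCast, ← ENNReal.rpow_mul]
      norm_num
    rw [h5]
    calc (I * I) ^ (1 / 2 : ℝ)
        ≤ ((K.toNNReal * C * volume A) * (K.toNNReal * C * volume A')) ^ (1 / 2 : ℝ) := by gcongr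
      _ = ((K.toNNReal * C : ℝ≥0∞) ^ (2 : ℝ) * (volume A * volume A')) ^ (1 / 2 : ℝ) := by
        congr 1
        rw [show (2 : ℝ) = ((2 : ℕ) : ℝ) by norm_num, ENNReal.rpow_natCast]
        ring
      _ = _ := by
        rw [ENNReal.mul_rpow_of_nonneg _ _ (by norm_num), ← ENNReal.rpow_mul]
        norm_num
  · obtain ⟨ρ₁, hρ₁, hTT⟩ := exists_lintegral_ttKernel_le hΦ hND hlt
    obtain ⟨K, hK0, hK⟩ := exists_norm_lowMul_kernel_le (F := F) 0
    refine ⟨ρ₁, hρ₁, fun ρ hρ hρle => ?_⟩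
    let χ : ContDiffBump ν₁ := ⟨ρ, 2 * ρ, hρ, by linarith⟩
    obtain ⟨C, hC⟩ := hTT ρ hρ hρle χ χ.contDiff (fun x => χ.nonneg) (fun x => χ.le_one)
      (fun x hx => χ.zero_of_le_dist (not_le.1 hx).le)
    refine ⟨1 + K.toNNReal + (C : ℝ≥0) ^ (1 / 2 : ℝ), fun z hz A A' hA hA' hAB hA'B Λ hΛ => ?_⟩
    have hAt : volume A ≠ ⊤ := ((measure_mono hAB).trans_lt measure_closedBall_lt_top).ne
    have hA't : volume A' ≠ ⊤ := ((measure_mono hA'B).trans_lt measure_closedBall_lt_top).ne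
    set V := volume A * volume A' with hV
    have hVt : V ≠ ⊤ := ENNReal.mul_ne_top hAt hA't
    set e : ℝ := (d : ℝ) / (d + n) with he
    rcases eq_or_ne V 0 with hV0 | hV0
    · have h0 : ∫⁻ x in A, ∫⁻ x' in A', ENNReal.ofReal (gaussKer Λ (defect Φ z x x')) = 0 := by
        rcases mul_eq_zero.1 hV0 with h | h
        · rw [Measure.restrict_eq_zero.2 h, lintegral_zero_measure]
        · simp [Measure.restrict_eq_zero.2 h]
      rw [h0]
      exact zero_le
    set v := V.toReal with hv
    have hv0 : 0 < v := ENNReal.toReal_pos hV0 hVt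
    have hVv : V = ENNReal.ofReal v := (ENNReal.ofReal_toReal hVt).symm
    -- The low part contributes `l ^ n * v` and the high part `(v * l ^ (n - d)) ^ (1/2)`; they
    -- agree exactly when `l ^ (n + d) = v⁻¹`, and both are then `v ^ (d/(d+n))`.
    set l : ℝ := v ^ (-(1 / ((d : ℝ) + n))) with hl
    have hl0 : 0 < l := Real.rpow_pos_of_pos hv0 _
    have hdn : (0 : ℝ) < d + n := by positivity
    have hln : l ^ n * v = v ^ e := by
      rw [hl, ← Real.rpow_natCast, ← Real.rpow_mul hv0.le]
      nth_rewrite 2 [← Real.rpow_one v]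
      rw [← Real.rpow_add hv0]
      congr 1
      rw [he]
      field_simp
      ring
    have hlow : ENNReal.ofReal (l ^ n) * V = V ^ e := by
      rw [hVv, ← ENNReal.ofReal_mul (by positivity), hln, ENNReal.ofReal_rpow_of_pos hv0]
    have hhigh : (V * ENNReal.ofReal (l ^ n * (l ^ d)⁻¹)) ^ (1 / 2 : ℝ) = V ^ e := by
      rw [hVv, ← ENNReal.ofReal_mul hv0.le, ENNReal.ofReal_rpow_of_pos (by positivity),
        ENNReal.ofReal_rpow_of_pos hv0]
      congr 1
      have h1 : v * (l ^ n * (l ^ d)⁻¹) = v ^ (2 * e) := by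
        rw [mul_comm v, mul_right_comm, hln, hl, ← Real.rpow_natCast, ← Real.rpow_mul hv0.le,
          ← Real.rpow_neg hv0.le, ← Real.rpow_add hv0]
        congr 1
        rw [he]
        field_simp
        ring
      rw [h1, ← Real.rpow_mul hv0.le]
      congr 1
      ring
    rcases le_or_gt Λ l with hΛl | hlΛ
    -- If the Gaussian scale is already below `l` no splitting is needed: the whole kernel is at
    -- most `Λ ^ n ≤ l ^ n`.
    · calc ∫⁻ x in A, ∫⁻ x' in A', ENNReal.ofReal (gaussKer Λ (defect Φ z x x'))
          ≤ ∫⁻ x in A, ∫⁻ x' in A', ENNReal.ofReal (l ^ n) := by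
            refine lintegral_mono fun x => lintegral_mono fun x' => ENNReal.ofReal_le_ofReal ?_
            exact (gaussKer_le hΛ.le _).trans (by gcongr)
        _ = ENNReal.ofReal (l ^ n) * V := by
            rw [setLIntegral_const, setLIntegral_const, hV]
            ring
        _ = 1 * V ^ e := by rw [hlow, one_mul]
        _ ≤ _ := by
            gcongr
            push_cast
            exact le_add_right le_self_add
    · refine (lintegral_gaussKer_le_split hΦ hAt hA't z hΛ (K := K * l ^ n) (l := l)
        fun u => ?_).trans ?_
      · have := hK Λ l hl0 hlΛ.le u
        simpa [decay] using this
      · have h1 := enorm_setIntegral_high_le hΦ hA hA' hA't hA'B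
          (χ.continuous.integrable_of_hasCompactSupport χ.hasCompactSupport)
          (fun x => χ.nonneg) (fun x hx => χ.one_of_mem_closedBall (hAB hx))
          (integrable_highMul hΛ l) z _ (fun x' hx' => hC z hz x' hx' Λ l hl0 hlΛ.le)
        have h2 : (volume A) ^ (1 / 2 : ℝ) *
            (volume A' * (C * ENNReal.ofReal (l ^ n * (l ^ d)⁻¹))) ^ (1 / 2 : ℝ) =
            (C : ℝ≥0∞) ^ (1 / 2 : ℝ) * V ^ e := by
          rw [← ENNReal.mul_rpow_of_nonneg _ _ (by norm_num), ← hhigh,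
            ← ENNReal.mul_rpow_of_nonneg _ _ (by norm_num)]
          congr 1
          rw [hV]
          ring
        rw [h2] at h1
        calc _ ≤ ENNReal.ofReal (K * l ^ n) * V + (C : ℝ≥0∞) ^ (1 / 2 : ℝ) * V ^ e := by
              gcongr
          _ = (K.toNNReal + (C : ℝ≥0∞) ^ (1 / 2 : ℝ)) * V ^ e := by
              rw [ENNReal.ofReal_mul hK0, mul_assoc, hlow, add_mul]
              rfl
          _ ≤ _ := by
              gcongr
              push_cast
              rw [ENNReal.coe_rpow_of_nonneg _ (by norm_num)]
              gcongr
              exact le_add_self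

end Restricted

/-! ### The positive quadrilinear form and its symmetries. -/

section QuadForm

variable {E F : Type*} [NormedAddCommGroup E] [InnerProductSpace ℝ E] [FiniteDimensional ℝ E]
  [MeasurableSpace E] [BorelSpace E]
  [NormedAddCommGroup F] [InnerProductSpace ℝ F] [FiniteDimensional ℝ F]
  [MeasurableSpace F] [BorelSpace F]

/-- The Gaussian weight of the quadruple `x + (η - x) = x' + (η - x')`. -/
noncomputable def quadWeight (Φ : E → F) (Λ : ℝ) (η x x' : E) : ℝ≥0∞ :=
  ENNReal.ofReal (gaussKer Λ (Φ x + Φ (η - x) - Φ x' - Φ (η - x')))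

/-- The positive quadrilinear form that controls the `L²` norm of a product of extensions. -/
noncomputable def quadForm (Φ : E → F) (Λ : ℝ) (f₁ g₁ f₂ g₂ : E → ℝ≥0∞) : ℝ≥0∞ :=
  ∫⁻ η, ∫⁻ x, ∫⁻ x', f₁ x * g₁ (η - x) * (f₂ x' * g₂ (η - x')) * quadWeight Φ Λ η x x'

lemma measurable_quadWeight {Φ : E → F} (hΦ : Continuous Φ) (Λ : ℝ) :
    Measurable fun p : E × E × E => quadWeight Φ Λ p.1 p.2.1 p.2.2 := by
  have : Continuous fun p : E × E × E =>
      gaussKer Λ (Φ p.2.1 + Φ (p.1 - p.2.1) - Φ p.2.2 - Φ (p.1 - p.2.2)) :=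
    (continuous_gaussKer Λ).comp (by fun_prop)
  exact this.measurable.ennreal_ofReal

lemma quadWeight_swap (Φ : E → F) (Λ : ℝ) (η x x' : E) :
    quadWeight Φ Λ η x x' = quadWeight Φ Λ η x' x := by
  unfold quadWeight
  rw [← gaussKer_neg]
  congr 2
  abel

lemma quadWeight_reflect (Φ : E → F) (Λ : ℝ) (η x x' : E) :
    quadWeight Φ Λ η (η - x) (η - x') = quadWeight Φ Λ η x x' := by
  unfold quadWeight
  rw [sub_sub_cancel, sub_sub_cancel]
  congr 2
  abel

lemma measurable_quadForm_integrand {Φ : E → F} (hΦ : Continuous Φ) (Λ : ℝ)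
    {f₁ g₁ f₂ g₂ : E → ℝ≥0∞} (hf₁ : Measurable f₁) (hg₁ : Measurable g₁) (hf₂ : Measurable f₂)
    (hg₂ : Measurable g₂) : Measurable fun p : E × E × E =>
      f₁ p.2.1 * g₁ (p.1 - p.2.1) * (f₂ p.2.2 * g₂ (p.1 - p.2.2)) *
        quadWeight Φ Λ p.1 p.2.1 p.2.2 := by
  have := measurable_quadWeight hΦ Λ
  fun_prop

lemma quadForm_swap {Φ : E → F} (hΦ : Continuous Φ) (Λ : ℝ)
    {f₁ g₁ f₂ g₂ : E → ℝ≥0∞} (hf₁ : Measurable f₁) (hg₁ : Measurable g₁) (hf₂ : Measurable f₂)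
    (hg₂ : Measurable g₂) : quadForm Φ Λ f₁ g₁ f₂ g₂ = quadForm Φ Λ f₂ g₂ f₁ g₁ := by
  unfold quadForm
  congr 1 with η
  rw [lintegral_lintegral_swap]
  · congr 1 with x
    congr 1 with x'
    rw [quadWeight_swap]
    ring
  · exact ((measurable_quadForm_integrand hΦ Λ hf₁ hg₁ hf₂ hg₂).comp
      (by fun_prop : Measurable fun q : E × E => ((η, q) : E × E × E))).aemeasurable

lemma quadForm_reflect (Φ : E → F) (Λ : ℝ) (f₁ g₁ f₂ g₂ : E → ℝ≥0∞) :
    quadForm Φ Λ f₁ g₁ f₂ g₂ = quadForm Φ Λ g₁ f₁ g₂ f₂ := by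
  unfold quadForm
  congr 1 with η
  rw [← lintegral_sub_left_eq_self _ η]
  congr 1 with x
  rw [← lintegral_sub_left_eq_self _ η]
  congr 1 with x'
  rw [quadWeight_reflect, sub_sub_cancel, sub_sub_cancel]
  ring

lemma quadForm_mono (Φ : E → F) (Λ : ℝ) {f₁ g₁ f₂ g₂ f₁' g₁' f₂' g₂' : E → ℝ≥0∞}
    (h₁ : ∀ x, f₁ x ≤ f₁' x) (h₂ : ∀ x, g₁ x ≤ g₁' x) (h₃ : ∀ x, f₂ x ≤ f₂' x)
    (h₄ : ∀ x, g₂ x ≤ g₂' x) : quadForm Φ Λ f₁ g₁ f₂ g₂ ≤ quadForm Φ Λ f₁' g₁' f₂' g₂' := by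
  unfold quadForm
  gcongr
  · exact h₁ _
  · exact h₂ _
  · exact h₃ _
  · exact h₄ _

/-- Countable additivity in one slot is enough: the symmetries `quadForm_swap` and
`quadForm_reflect` bring any slot to the first place. -/
lemma quadForm_tsum_first {Φ : E → F} (hΦ : Continuous Φ) (Λ : ℝ) (c : ℤ → ℝ≥0∞)
    {u : ℤ → E → ℝ≥0∞} {g₁ f₂ g₂ : E → ℝ≥0∞} (hu : ∀ i, Measurable (u i)) (hg₁ : Measurable g₁)
    (hf₂ : Measurable f₂) (hg₂ : Measurable g₂) :
    quadForm Φ Λ (fun x => ∑' i, c i * u i x) g₁ f₂ g₂ =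
      ∑' i, c i * quadForm Φ Λ (u i) g₁ f₂ g₂ := by
  set I : ℤ → E × E × E → ℝ≥0∞ := fun i p => c i * (u i p.2.1 * g₁ (p.1 - p.2.1) *
    (f₂ p.2.2 * g₂ (p.1 - p.2.2)) * quadWeight Φ Λ p.1 p.2.1 p.2.2) with hI
  have hIm : ∀ i, Measurable (I i) := fun i =>
    (measurable_quadForm_integrand hΦ Λ (hu i) hg₁ hf₂ hg₂).const_mul _
  have hI2 : ∀ i, Measurable fun q : E × E => ∫⁻ x', I i (q.1, q.2, x') := fun i =>
    ((hIm i).comp (by fun_prop : Measurable fun r : (E × E) × E =>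
      ((r.1.1, r.1.2, r.2) : E × E × E))).lintegral_prod_right'
  have hI3 : ∀ i, Measurable fun η : E => ∫⁻ x, ∫⁻ x', I i (η, x, x') := fun i =>
    (hI2 i).lintegral_prod_right'
  have h1 : ∀ η x x', (∑' i, c i * u i x) * g₁ (η - x) * (f₂ x' * g₂ (η - x')) *
      quadWeight Φ Λ η x x' = ∑' i, I i (η, x, x') := by
    intro η x x'
    rw [← ENNReal.tsum_mul_right, ← ENNReal.tsum_mul_right, ← ENNReal.tsum_mul_right]
    congr 1 with i
    simp only [hI]
    ring
  unfold quadForm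
  simp_rw [h1]
  have h2 : ∀ η x, ∫⁻ x', ∑' i, I i (η, x, x') = ∑' i, ∫⁻ x', I i (η, x, x') := fun η x =>
    lintegral_tsum fun i => ((hIm i).comp (by fun_prop : Measurable fun x' : E =>
      ((η, x, x') : E × E × E))).aemeasurable
  simp_rw [h2]
  have h3 : ∀ η, ∫⁻ x, ∑' i, ∫⁻ x', I i (η, x, x') = ∑' i, ∫⁻ x, ∫⁻ x', I i (η, x, x') :=
    fun η => lintegral_tsum fun i => ((hI2 i).comp (by fun_prop : Measurable fun x : E =>
      ((η, x) : E × E))).aemeasurable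
  simp_rw [h3]
  rw [lintegral_tsum fun i => (hI3 i).aemeasurable]
  congr 1 with i
  have hm := measurable_quadForm_integrand hΦ Λ (hu i) hg₁ hf₂ hg₂
  have hm2 : Measurable fun q : E × E => ∫⁻ x', u i q.2 * g₁ (q.1 - q.2) *
      (f₂ x' * g₂ (q.1 - x')) * quadWeight Φ Λ q.1 q.2 x' :=
    (hm.comp (by fun_prop : Measurable fun r : (E × E) × E =>
      ((r.1.1, r.1.2, r.2) : E × E × E))).lintegral_prod_right'
  have hm3 : Measurable fun η : E => ∫⁻ x, ∫⁻ x', u i x * g₁ (η - x) *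
      (f₂ x' * g₂ (η - x')) * quadWeight Φ Λ η x x' := hm2.lintegral_prod_right'
  simp only [hI]
  rw [← lintegral_const_mul _ hm3]
  congr 1 with η
  have hm4 : Measurable fun x : E => ∫⁻ x', u i x * g₁ (η - x) *
      (f₂ x' * g₂ (η - x')) * quadWeight Φ Λ η x x' :=
    hm2.comp (by fun_prop : Measurable fun x : E => ((η, x) : E × E))
  rw [← lintegral_const_mul _ hm4]
  congr 1 with x
  exact lintegral_const_mul _ (hm.comp (by fun_prop : Measurable fun x' : E =>
    ((η, x, x') : E × E × E)))

lemma quadForm_tsum {Φ : E → F} (hΦ : Continuous Φ) (Λ : ℝ) (c : ℤ → ℝ≥0∞)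
    {u v : ℤ → E → ℝ≥0∞} (hu : ∀ i, Measurable (u i)) (hv : ∀ i, Measurable (v i)) :
    quadForm Φ Λ (fun x => ∑' i, c i * u i x) (fun x => ∑' i, c i * v i x)
        (fun x => ∑' i, c i * u i x) (fun x => ∑' i, c i * v i x) =
      ∑' i, ∑' j, ∑' i', ∑' j', c i * (c j * (c i' * (c j' *
        quadForm Φ Λ (u i) (v j) (u i') (v j')))) := by
  have hU : Measurable fun x => ∑' i, c i * u i x :=
    Measurable.tsum fun i => (hu i).const_mul _
  have hV : Measurable fun x => ∑' i, c i * v i x :=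
    Measurable.tsum fun i => (hv i).const_mul _
  rw [quadForm_tsum_first hΦ Λ c hu hV hU hV]
  congr 1 with i
  rw [quadForm_reflect, quadForm_tsum_first hΦ Λ c hv (hu i) hV hU, ← ENNReal.tsum_mul_left]
  congr 1 with j
  rw [quadForm_reflect, quadForm_swap hΦ Λ (hu i) (hv j) hU hV,
    quadForm_tsum_first hΦ Λ c hu hV (hu i) (hv j), ← ENNReal.tsum_mul_left,
    ← ENNReal.tsum_mul_left]
  congr 1 with i'
  rw [quadForm_reflect, quadForm_tsum_first hΦ Λ c hv (hu i') (hv j) (hu i),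
    ← ENNReal.tsum_mul_left, ← ENNReal.tsum_mul_left, ← ENNReal.tsum_mul_left]
  congr 1 with j'
  rw [quadForm_reflect, quadForm_swap hΦ Λ (hu i') (hv j') (hu i) (hv j)]

/-- Discard the constraint `η - x' ∈ B'` and substitute `z = η - x`. For each `z ∈ B` there remains
the bilinear form in `(x, x')` covered by the restricted estimate. -/
lemma quadForm_indicator_le {Φ : E → F} (hΦ : Continuous Φ) (Λ : ℝ) {A A' B B' : Set E}
    (hA : MeasurableSet A) (hA' : MeasurableSet A') (hB : MeasurableSet B) (W : ℝ≥0∞)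
    (hW : ∀ z ∈ B, ∫⁻ x in A, ∫⁻ x' in A', ENNReal.ofReal (gaussKer Λ (defect Φ z x x')) ≤ W) :
    quadForm Φ Λ (A.indicator 1) (B.indicator 1) (A'.indicator 1) (B'.indicator 1) ≤
      W * volume B := by
  set I : E → E → E → ℝ≥0∞ := fun z x x' => A.indicator 1 x * B.indicator 1 z *
    (A'.indicator 1 x' * ENNReal.ofReal (gaussKer Λ (defect Φ z x x'))) with hI
  have hdm : Measurable fun p : E × E × E => ENNReal.ofReal (gaussKer Λ (defect Φ p.1 p.2.1 p.2.2)) := by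
    have : Continuous fun p : E × E × E => gaussKer Λ (defect Φ p.1 p.2.1 p.2.2) := by
      unfold defect
      exact (continuous_gaussKer Λ).comp (by fun_prop)
    exact this.measurable.ennreal_ofReal
  have hA1 : Measurable (A.indicator (1 : E → ℝ≥0∞)) := measurable_one.indicator hA
  have hA1' : Measurable (A'.indicator (1 : E → ℝ≥0∞)) := measurable_one.indicator hA'
  have hB1 : Measurable (B.indicator (1 : E → ℝ≥0∞)) := measurable_one.indicator hB
  have hIm : Measurable fun p : E × E × E => I p.1 p.2.1 p.2.2 := by
    simp only [hI]
    fun_prop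
  have hJ : Measurable fun q : E × E => ∫⁻ x', I q.1 q.2 x' :=
    (hIm.comp (by fun_prop : Measurable fun r : (E × E) × E =>
      ((r.1.1, r.1.2, r.2) : E × E × E))).lintegral_prod_right'
  calc quadForm Φ Λ (A.indicator 1) (B.indicator 1) (A'.indicator 1) (B'.indicator 1)
      ≤ ∫⁻ η, ∫⁻ x, ∫⁻ x', I (η - x) x x' := by
        unfold quadForm
        refine lintegral_mono fun η => lintegral_mono fun x => lintegral_mono fun x' => ?_
        simp only [hI]
        have h1 : B'.indicator (1 : E → ℝ≥0∞) (η - x') ≤ 1 :=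
          Set.indicator_le_self' (fun _ _ => zero_le_one) _
        have h2 : quadWeight Φ Λ η x x' = ENNReal.ofReal (gaussKer Λ (defect Φ (η - x) x x')) := by
          unfold quadWeight defect
          rw [add_sub_cancel]
        rw [h2, mul_assoc]
        gcongr
        exact mul_le_of_le_one_right zero_le h1
    _ = ∫⁻ x, ∫⁻ η, ∫⁻ x', I (η - x) x x' :=
        lintegral_lintegral_swap (hJ.comp (by fun_prop : Measurable fun q : E × E =>
          ((q.1 - q.2, q.2) : E × E))).aemeasurable
    _ = ∫⁻ x, ∫⁻ z, ∫⁻ x', I z x x' := by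
        congr 1 with x
        exact lintegral_sub_right_eq_self (fun z => ∫⁻ x', I z x x') x
    _ = ∫⁻ z, ∫⁻ x, ∫⁻ x', I z x x' :=
        lintegral_lintegral_swap (hJ.comp measurable_swap).aemeasurable
    _ = ∫⁻ z in B, ∫⁻ x in A, ∫⁻ x' in A', ENNReal.ofReal (gaussKer Λ (defect Φ z x x')) := by
        rw [← lintegral_indicator hB]
        congr 1 with z
        by_cases hz : z ∈ B
        · rw [Set.indicator_of_mem hz, ← lintegral_indicator hA]
          congr 1 with x
          by_cases hx : x ∈ A
          · rw [Set.indicator_of_mem hx, ← lintegral_indicator hA']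
            congr 1 with x'
            by_cases hx' : x' ∈ A' <;> simp [hI, hz, hx, hx']
          · simp [hI, hx]
        · simp [hI, hz]
    _ ≤ ∫⁻ _ in B, W := setLIntegral_mono' hB hW
    _ = W * volume B := setLIntegral_const _ _

/-- The form on indicator functions, given restricted estimates in both pairs of variables. -/
lemma quadForm_indicator_le_rpow {Φ : E → F} (hΦ : Continuous Φ) {Λ : ℝ} {U V : Set E} {C : ℝ≥0∞}
    {e : ℝ}
    (hU : ∀ z ∈ V, ∀ A A' : Set E, MeasurableSet A → MeasurableSet A' → A ⊆ U → A' ⊆ U →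
      ∫⁻ x in A, ∫⁻ x' in A', ENNReal.ofReal (gaussKer Λ (defect Φ z x x')) ≤
        C * (volume A * volume A') ^ e)
    (hV : ∀ z ∈ U, ∀ A A' : Set E, MeasurableSet A → MeasurableSet A' → A ⊆ V → A' ⊆ V →
      ∫⁻ x in A, ∫⁻ x' in A', ENNReal.ofReal (gaussKer Λ (defect Φ z x x')) ≤
        C * (volume A * volume A') ^ e)
    {A A' B B' : Set E} (hA : MeasurableSet A) (hA' : MeasurableSet A') (hB : MeasurableSet B)
    (hB' : MeasurableSet B') (hAU : A ⊆ U) (hA'U : A' ⊆ U) (hBV : B ⊆ V) (hB'V : B' ⊆ V) :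
    quadForm Φ Λ (A.indicator 1) (B.indicator 1) (A'.indicator 1) (B'.indicator 1) ≤
      C * (((volume A * volume A') ^ (e / 2) * (min (volume A) (volume A')) ^ (1 / 2 : ℝ)) *
        ((volume B * volume B') ^ (e / 2) * (min (volume B) (volume B')) ^ (1 / 2 : ℝ))) := by
  have hA1 : Measurable (A.indicator (1 : E → ℝ≥0∞)) := measurable_one.indicator hA
  have hA1' : Measurable (A'.indicator (1 : E → ℝ≥0∞)) := measurable_one.indicator hA'
  have hB1 : Measurable (B.indicator (1 : E → ℝ≥0∞)) := measurable_one.indicator hB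
  have hB1' : Measurable (B'.indicator (1 : E → ℝ≥0∞)) := measurable_one.indicator hB'
  set Q := quadForm Φ Λ (A.indicator 1) (B.indicator 1) (A'.indicator 1) (B'.indicator 1) with hQ
  have h1 : Q ≤ C * (volume A * volume A') ^ e * volume B :=
    quadForm_indicator_le hΦ Λ hA hA' hB _ fun z hz => hU z (hBV hz) A A' hA hA' hAU hA'U
  have h2 : Q ≤ C * (volume A * volume A') ^ e * volume B' := by
    rw [hQ, quadForm_swap hΦ Λ hA1 hB1 hA1' hB1', mul_comm (volume A)]
    exact quadForm_indicator_le hΦ Λ hA' hA hB' _ fun z hz => hU z (hB'V hz) A' A hA' hA hA'U hAU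
  have h3 : Q ≤ C * (volume B * volume B') ^ e * volume A := by
    rw [hQ, quadForm_reflect]
    exact quadForm_indicator_le hΦ Λ hB hB' hA _ fun z hz => hV z (hAU hz) B B' hB hB' hBV hB'V
  have h4 : Q ≤ C * (volume B * volume B') ^ e * volume A' := by
    rw [hQ, quadForm_reflect, quadForm_swap hΦ Λ hB1 hA1 hB1' hA1', mul_comm (volume B)]
    exact quadForm_indicator_le hΦ Λ hB' hB hA' _ fun z hz => hV z (hA'U hz) B' B hB' hB hB'V hBV
  have h5 : Q ≤ C * (volume A * volume A') ^ e * min (volume B) (volume B') := by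
    rcases min_choice (volume B) (volume B') with h | h <;> rw [h] <;> assumption
  have h6 : Q ≤ C * (volume B * volume B') ^ e * min (volume A) (volume A') := by
    rcases min_choice (volume A) (volume A') with h | h <;> rw [h] <;> assumption
  have hsq : ∀ x : ℝ≥0∞, (x * x) ^ (1 / 2 : ℝ) = x := fun x => by
    rw [← pow_two, ← ENNReal.rpow_natCast, ← ENNReal.rpow_mul]
    norm_num
  have hhalf : ∀ x : ℝ≥0∞, (x ^ e) ^ (1 / 2 : ℝ) = x ^ (e / 2) := fun x => by
    rw [← ENNReal.rpow_mul]
    congr 1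
    ring
  -- The geometric mean of `h5` and `h6` distributes the gain evenly: each pair of sets receives the
  -- square root of its smaller measure.
  rw [← hsq Q]
  calc (Q * Q) ^ (1 / 2 : ℝ)
      ≤ ((C * (volume A * volume A') ^ e * min (volume B) (volume B')) *
        (C * (volume B * volume B') ^ e * min (volume A) (volume A'))) ^ (1 / 2 : ℝ) := by gcongr
    _ = ((C * C) * (((volume A * volume A') ^ e * min (volume A) (volume A')) *
        ((volume B * volume B') ^ e * min (volume B) (volume B')))) ^ (1 / 2 : ℝ) := by
        congr 1
        ring
    _ = _ := by
        have hmul : ∀ x y : ℝ≥0∞, (x * y) ^ (1 / 2 : ℝ) = x ^ (1 / 2 : ℝ) * y ^ (1 / 2 : ℝ) :=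
          fun x y => ENNReal.mul_rpow_of_nonneg _ _ (by norm_num)
        rw [hmul (C * C), hsq, hmul (_ * min _ _), hmul (_ ^ e), hmul (_ ^ e), hhalf, hhalf]

end QuadForm

/-! ### Summation over dyadic levels, from restricted to strong type. -/

section Dyadic

/-- Each product is at most `max ^ (b + c)`, and as `b + c ≥ 1` one power of the maximum is summed
while the others are bounded by the total. The bound is uniform in the shift `n`, so any geometric
gain in `n` survives. -/
lemma tsum_rpow_mul_rpow_le (m : ℤ → ℝ≥0∞) {b c : ℝ} (hb : 0 ≤ b) (hc : 0 ≤ c) (hbc : 1 ≤ b + c)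
    (n : ℕ) : ∑' i, m i ^ b * m (i + n) ^ c ≤ 2 * (∑' i, m i) ^ (b + c) := by
  set M := ∑' i, m i with hM
  have hs : ∀ x ≤ M, x ^ (b + c) ≤ x * M ^ (b + c - 1) := by
    intro x hx
    calc x ^ (b + c) = x ^ (1 + (b + c - 1)) := by congr 1; ring
      _ = x * x ^ (b + c - 1) := by
        rw [ENNReal.rpow_add_of_nonneg _ _ zero_le_one (by linarith), ENNReal.rpow_one]
      _ ≤ x * M ^ (b + c - 1) := by
        gcongr
  have hle : ∀ i, m i ≤ M := fun i => ENNReal.le_tsum i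
  have hpt : ∀ i, m i ^ b * m (i + n) ^ c ≤ (m i + m (i + n)) * M ^ (b + c - 1) := by
    intro i
    rcases le_total (m i) (m (i + n)) with h | h
    · calc m i ^ b * m (i + n) ^ c ≤ m (i + n) ^ b * m (i + n) ^ c := by gcongr
        _ = m (i + n) ^ (b + c) := (ENNReal.rpow_add_of_nonneg _ _ hb hc).symm
        _ ≤ m (i + n) * M ^ (b + c - 1) := hs _ (hle _)
        _ ≤ _ := by gcongr; exact le_add_self
    · calc m i ^ b * m (i + n) ^ c ≤ m i ^ b * m i ^ c := by gcongr
        _ = m i ^ (b + c) := (ENNReal.rpow_add_of_nonneg _ _ hb hc).symm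
        _ ≤ m i * M ^ (b + c - 1) := hs _ (hle _)
        _ ≤ _ := by gcongr; exact le_self_add
  calc ∑' i, m i ^ b * m (i + n) ^ c ≤ ∑' i, (m i + m (i + n)) * M ^ (b + c - 1) :=
        ENNReal.tsum_le_tsum hpt
    _ = (M + M) * M ^ (b + c - 1) := by
        rw [ENNReal.tsum_mul_right, ENNReal.tsum_add]
        congr 2
        exact (Equiv.addRight (n : ℤ)).tsum_eq m
    _ = 2 * M ^ (b + c) := by
        have h1 : M ^ (b + c) = M * M ^ (b + c - 1) := by
          conv_rhs => rw [← ENNReal.rpow_one M, ← ENNReal.rpow_mul, one_mul]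
          rw [← ENNReal.rpow_add_of_nonneg _ _ zero_le_one (by linarith)]
          congr 1
          ring
        rw [h1, ← two_mul, mul_assoc]

/-- The off-diagonal gain makes the dyadic double sum converge. -/
lemma exists_tsum_dyadic_le {b : ℝ} (hb : 1 / 4 ≤ b) :
    ∃ C : ℝ≥0, ∀ α : ℤ → ℝ≥0∞,
      ∑' i : ℤ, ∑' i' : ℤ, (2 : ℝ≥0∞) ^ (i : ℝ) * 2 ^ (i' : ℝ) *
        ((α i * α i') ^ b * (min (α i) (α i')) ^ (1 / 2 : ℝ)) ≤
      C * (∑' i : ℤ, (2 : ℝ≥0∞) ^ ((i : ℝ) * (b + 1 / 4)⁻¹) * α i) ^ (2 * b + 1 / 2) := by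
  set p := (b + 1 / 4)⁻¹ with hp
  have hp0 : 0 < p := by positivity
  have hpb : p * (b + 1 / 4) = 1 := inv_mul_cancel₀ (by positivity)
  -- Since `p (2b + 1/2) = 2`, the powers of `2 ^ i` cancel once `α` is normalised to `m i = 2 ^ (i
  -- p) α i`. At offset `n` there remains `n (1 - p (b + 1/2)) = -n p / 4`.
  set r : ℝ≥0∞ := 2 ^ (-(p / 4)) with hr
  have hr1 : r < 1 := ENNReal.rpow_lt_one_of_one_lt_of_neg (by norm_num) (by linarith)
  have hgeo : (1 - r)⁻¹ ≠ ⊤ := ENNReal.inv_ne_top.2 (tsub_pos_of_lt hr1).ne'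
  refine ⟨4 * ((1 - r)⁻¹).toNNReal, fun α => ?_⟩
  have h20 : (2 : ℝ≥0∞) ≠ 0 := by norm_num
  have h2t : (2 : ℝ≥0∞) ≠ ⊤ := by norm_num
  obtain ⟨m, hm⟩ : ∃ m : ℤ → ℝ≥0∞, ∀ i, m i = (2 : ℝ≥0∞) ^ ((i : ℝ) * p) * α i :=
    ⟨_, fun _ => rfl⟩
  have hα : ∀ i, α i = 2 ^ (-((i : ℝ) * p)) * m i := fun i => by
    rw [hm, ← mul_assoc, ← ENNReal.rpow_add _ _ h20 h2t, neg_add_cancel, ENNReal.rpow_zero, one_mul]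
  set T : ℤ → ℤ → ℝ≥0∞ := fun i i' => (2 : ℝ≥0∞) ^ (i : ℝ) * 2 ^ (i' : ℝ) *
    (α i ^ b * α i' ^ (b + 1 / 2)) with hT
  have hb0 : 0 ≤ b := by linarith
  have hTn : ∀ (i : ℤ) (n : ℕ), T i (i + n) = r ^ n * (m i ^ b * m (i + n) ^ (b + 1 / 2)) := by
    intro i n
    simp only [hT]
    conv_lhs => rw [hα i, hα (i + n)]
    rw [ENNReal.mul_rpow_of_nonneg _ _ hb0,
      ENNReal.mul_rpow_of_nonneg _ _ (by linarith), ← ENNReal.rpow_mul, ← ENNReal.rpow_mul]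
    have h1 : ∀ w x y z u v : ℝ≥0∞, w * x * (y * z * (u * v)) = (w * x * y * u) * (z * v) := by
      intros; ring
    rw [h1, ← ENNReal.rpow_add _ _ h20 h2t, ← ENNReal.rpow_add _ _ h20 h2t,
      ← ENNReal.rpow_add _ _ h20 h2t, hr, ← ENNReal.rpow_natCast, ← ENNReal.rpow_mul]
    congr 2
    push_cast
    linear_combination (-2 * (i : ℝ) - n) * hpb
  -- The minimum is replaced by the measure at `i'`. This is used only for `i ≤ i'`, where the
  -- higher level carries the extra `1/2` and the geometric gain appears; the other half of the sum
  -- follows by symmetry.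
  have hX : ∀ i i' : ℤ, (2 : ℝ≥0∞) ^ (i : ℝ) * 2 ^ (i' : ℝ) *
      ((α i * α i') ^ b * (min (α i) (α i')) ^ (1 / 2 : ℝ)) ≤ T i i' := by
    intro i i'
    simp only [hT]
    refine mul_le_mul' le_rfl ?_
    rw [ENNReal.mul_rpow_of_nonneg _ _ hb0, mul_assoc,
      ENNReal.rpow_add_of_nonneg _ _ hb0 (by norm_num)]
    gcongr
    exact min_le_right _ _
  have hsym : ∀ i i' : ℤ, (2 : ℝ≥0∞) ^ (i : ℝ) * 2 ^ (i' : ℝ) *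
      ((α i * α i') ^ b * (min (α i) (α i')) ^ (1 / 2 : ℝ)) =
      (2 : ℝ≥0∞) ^ (i' : ℝ) * 2 ^ (i : ℝ) *
      ((α i' * α i) ^ b * (min (α i') (α i)) ^ (1 / 2 : ℝ)) := by
    intro i i'
    rw [mul_comm (α i), min_comm (α i), mul_comm ((2 : ℝ≥0∞) ^ (i : ℝ))]
  set D : ℤ → ℤ → ℝ≥0∞ := fun i i' => if i ≤ i' then T i i' else 0 with hD
  have hXD : ∀ i i' : ℤ, (2 : ℝ≥0∞) ^ (i : ℝ) * 2 ^ (i' : ℝ) *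
      ((α i * α i') ^ b * (min (α i) (α i')) ^ (1 / 2 : ℝ)) ≤ D i i' + D i' i := by
    intro i i'
    rcases le_total i i' with h | h
    · refine (hX i i').trans ?_
      simp only [hD, if_pos h]
      exact le_self_add
    · rw [hsym]
      refine (hX i' i).trans ?_
      simp only [hD, if_pos h]
      exact le_add_self
  have hDn : ∀ i : ℤ, ∑' i', D i i' = ∑' n : ℕ, T i (i + n) := by
    intro i
    have hinj : Function.Injective fun n : ℕ => i + (n : ℤ) := fun a b h => by simpa using h
    have hsupp : Function.support (D i) ⊆ Set.range fun n : ℕ => i + (n : ℤ) := by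
      intro i' hi'
      have hle : i ≤ i' := by
        by_contra hcon
        exact hi' (by simp [hD, hcon])
      exact ⟨(i' - i).toNat, by
        simp only
        rw [Int.toNat_of_nonneg (by linarith)]
        ring⟩
    rw [← hinj.tsum_eq hsupp]
    congr 1 with n
    simp [hD]
  have hDsum : ∑' i, ∑' i', D i i' ≤
      2 * (1 - r)⁻¹ * (∑' i, m i) ^ (2 * b + 1 / 2) := by
    simp_rw [hDn, hTn]
    rw [ENNReal.tsum_comm]
    simp_rw [ENNReal.tsum_mul_left]
    calc ∑' n : ℕ, r ^ n * ∑' i : ℤ, m i ^ b * m (i + n) ^ (b + 1 / 2)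
        ≤ ∑' n : ℕ, r ^ n * (2 * (∑' i, m i) ^ (b + (b + 1 / 2))) := by
          gcongr with n
          exact tsum_rpow_mul_rpow_le m hb0 (by linarith) (by linarith) n
      _ = _ := by
        rw [ENNReal.tsum_mul_right, ENNReal.tsum_geometric,
          show b + (b + 1 / 2) = 2 * b + 1 / 2 by ring]
        ring
  calc _ ≤ ∑' i, ∑' i', (D i i' + D i' i) :=
        ENNReal.tsum_le_tsum fun i => ENNReal.tsum_le_tsum fun i' => hXD i i'
    _ = (∑' i, ∑' i', D i i') + ∑' i, ∑' i', D i' i := by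
        simp_rw [ENNReal.tsum_add]
    _ = (∑' i, ∑' i', D i i') + ∑' i, ∑' i', D i i' := by
        congr 1
        rw [ENNReal.tsum_comm]
    _ ≤ 2 * (1 - r)⁻¹ * (∑' i, m i) ^ (2 * b + 1 / 2) +
        2 * (1 - r)⁻¹ * (∑' i, m i) ^ (2 * b + 1 / 2) := add_le_add hDsum hDsum
    _ = _ := by
        simp only [hm]
        push_cast
        rw [ENNReal.coe_toNNReal hgeo]
        ring

end Dyadic

/-! ### Layer decomposition of the quadrilinear form. -/

section Layers

variable {E F : Type*} [NormedAddCommGroup E] [InnerProductSpace ℝ E] [FiniteDimensional ℝ E]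
  [MeasurableSpace E] [BorelSpace E]
  [NormedAddCommGroup F] [InnerProductSpace ℝ F] [FiniteDimensional ℝ F]
  [MeasurableSpace F] [BorelSpace F]

/-- The dyadic level set `{2^i ≤ f < 2^(i+1)}`. -/
def dyadicLayer {α : Type*} (f : α → ℝ≥0∞) (i : ℤ) : Set α :=
  f ⁻¹' Set.Ico ((2 : ℝ≥0∞) ^ i) ((2 : ℝ≥0∞) ^ (i + 1))

lemma measurableSet_dyadicLayer {α : Type*} [MeasurableSpace α] {f : α → ℝ≥0∞} (hf : Measurable f)
    (i : ℤ) : MeasurableSet (dyadicLayer f i) :=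
  hf measurableSet_Ico

lemma dyadicLayer_subset {α : Type*} {f : α → ℝ≥0∞} {U : Set α} (hU : ∀ x ∉ U, f x = 0) (i : ℤ) :
    dyadicLayer f i ⊆ U := by
  intro x hx
  by_contra hxU
  have h1 : (2 : ℝ≥0∞) ^ i ≤ f x := hx.1
  rw [hU x hxU, nonpos_iff_eq_zero] at h1
  exact (ENNReal.zpow_pos (by norm_num) (by norm_num) i).ne' h1

lemma le_tsum_dyadicLayer {α : Type*} {f : α → ℝ≥0∞} (hf : ∀ x, f x ≠ ⊤) (x : α) :
    f x ≤ ∑' i : ℤ, 2 * 2 ^ (i : ℝ) * (dyadicLayer f i).indicator 1 x := by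
  rcases eq_or_ne (f x) 0 with h0 | h0
  · rw [h0]
    exact zero_le
  · obtain ⟨n, hn⟩ := ENNReal.exists_mem_Ico_zpow h0 (hf x) (by norm_num : (1 : ℝ≥0∞) < 2)
      (by norm_num)
    refine le_trans ?_ (ENNReal.le_tsum n)
    have hx : x ∈ dyadicLayer f n := hn
    rw [Set.indicator_of_mem hx, Pi.one_apply, mul_one, ENNReal.rpow_intCast]
    refine hn.2.le.trans_eq ?_
    rw [ENNReal.zpow_add (by norm_num) (by norm_num), zpow_one, mul_comm]

lemma tsum_dyadicLayer_le {α : Type*} [MeasurableSpace α] {μ : Measure α} {f : α → ℝ≥0∞}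
    (hf : Measurable f) {p : ℝ} (hp : 0 ≤ p) :
    ∑' i : ℤ, (2 : ℝ≥0∞) ^ ((i : ℝ) * p) * μ (dyadicLayer f i) ≤ ∫⁻ x, f x ^ p ∂μ := by
  have hmono : Monotone fun i : ℤ => (2 : ℝ≥0∞) ^ i := fun i j hij =>
    ENNReal.zpow_le_of_le (by norm_num) hij
  have hdisj : Pairwise (Function.onFun Disjoint (dyadicLayer f)) := fun i j hij =>
    Disjoint.preimage f (hmono.pairwise_disjoint_on_Ico_succ hij)
  calc ∑' i : ℤ, (2 : ℝ≥0∞) ^ ((i : ℝ) * p) * μ (dyadicLayer f i)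
      ≤ ∑' i : ℤ, ∫⁻ x in dyadicLayer f i, f x ^ p ∂μ := by
        refine ENNReal.tsum_le_tsum fun i => ?_
        rw [← setLIntegral_const]
        refine setLIntegral_mono' (measurableSet_dyadicLayer hf i) fun x hx => ?_
        rw [ENNReal.rpow_mul, ENNReal.rpow_intCast]
        exact ENNReal.rpow_le_rpow hx.1 hp
    _ = ∫⁻ x in ⋃ i, dyadicLayer f i, f x ^ p ∂μ :=
        (lintegral_iUnion (measurableSet_dyadicLayer hf) hdisj _).symm
    _ ≤ ∫⁻ x, f x ^ p ∂μ := setLIntegral_le_lintegral _ _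

/-- By positivity `f` and `g` may be replaced by multiples of their dyadic layers. The bound on
indicators is a product of a term in the levels of `f` and one in the levels of `g`, so the
quadruple sum splits into two double sums of the dyadic lemma; `e ≥ 1/2` is its condition `b ≥ 1/4`
with `b = e / 2`. -/
theorem exists_quadForm_le_of_restricted {e : ℝ} (he : 1 / 2 ≤ e) :
    ∃ K : ℝ≥0, ∀ {Φ : E → F}, Continuous Φ → ∀ (Λ : ℝ) {U V : Set E} {C : ℝ≥0},
    (∀ z ∈ V, ∀ A A' : Set E, MeasurableSet A → MeasurableSet A' → A ⊆ U → A' ⊆ U →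
      ∫⁻ x in A, ∫⁻ x' in A', ENNReal.ofReal (gaussKer Λ (defect Φ z x x')) ≤
        C * (volume A * volume A') ^ e) →
    (∀ z ∈ U, ∀ A A' : Set E, MeasurableSet A → MeasurableSet A' → A ⊆ V → A' ⊆ V →
      ∫⁻ x in A, ∫⁻ x' in A', ENNReal.ofReal (gaussKer Λ (defect Φ z x x')) ≤
        C * (volume A * volume A') ^ e) →
    ∀ {f g : E → ℝ≥0∞}, Measurable f → Measurable g → (∀ x, f x ≠ ⊤) → (∀ x, g x ≠ ⊤) →
      (∀ x ∉ U, f x = 0) → (∀ x ∉ V, g x = 0) →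
      quadForm Φ Λ f g f g ≤ (K * C : ℝ≥0) * ((∫⁻ x, f x ^ (e / 2 + 1 / 4)⁻¹) ^ (e + 1 / 2) *
        (∫⁻ x, g x ^ (e / 2 + 1 / 4)⁻¹) ^ (e + 1 / 2)) := by
  obtain ⟨K, hK⟩ := exists_tsum_dyadic_le (b := e / 2) (by linarith)
  refine ⟨16 * (K * K), fun {Φ} hΦ Λ {U V C} hU hV {f g} hf hg hft hgt hfU hgV => ?_⟩
  set u : ℤ → E → ℝ≥0∞ := fun i => (dyadicLayer f i).indicator 1 with hu
  set v : ℤ → E → ℝ≥0∞ := fun i => (dyadicLayer g i).indicator 1 with hv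
  have hum : ∀ i, Measurable (u i) := fun i => measurable_one.indicator (measurableSet_dyadicLayer hf i)
  have hvm : ∀ i, Measurable (v i) := fun i => measurable_one.indicator (measurableSet_dyadicLayer hg i)
  have hp : 0 ≤ (e / 2 + 1 / 4)⁻¹ := by positivity
  set X : (E → ℝ≥0∞) → ℤ → ℤ → ℝ≥0∞ := fun f i i' =>
    (volume (dyadicLayer f i) * volume (dyadicLayer f i')) ^ (e / 2) *
      (min (volume (dyadicLayer f i)) (volume (dyadicLayer f i'))) ^ (1 / 2 : ℝ) with hX
  have hS : ∀ f : E → ℝ≥0∞, Measurable f → ∑' i : ℤ, ∑' i' : ℤ, (2 : ℝ≥0∞) ^ (i : ℝ) *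
      2 ^ (i' : ℝ) * X f i i' ≤ K * (∫⁻ x, f x ^ (e / 2 + 1 / 4)⁻¹) ^ (e + 1 / 2) := by
    intro f hf
    refine (hK fun i => volume (dyadicLayer f i)).trans ?_
    rw [show 2 * (e / 2) + 1 / 2 = e + 1 / 2 by ring]
    gcongr
    exact tsum_dyadicLayer_le hf hp
  calc quadForm Φ Λ f g f g
      ≤ quadForm Φ Λ (fun x => ∑' i : ℤ, 2 * 2 ^ (i : ℝ) * u i x)
        (fun x => ∑' i : ℤ, 2 * 2 ^ (i : ℝ) * v i x) (fun x => ∑' i : ℤ, 2 * 2 ^ (i : ℝ) * u i x)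
        (fun x => ∑' i : ℤ, 2 * 2 ^ (i : ℝ) * v i x) :=
        quadForm_mono Φ Λ (le_tsum_dyadicLayer hft) (le_tsum_dyadicLayer hgt)
          (le_tsum_dyadicLayer hft) (le_tsum_dyadicLayer hgt)
    _ = ∑' i : ℤ, ∑' j : ℤ, ∑' i' : ℤ, ∑' j' : ℤ, 2 * 2 ^ (i : ℝ) * (2 * 2 ^ (j : ℝ) *
        (2 * 2 ^ (i' : ℝ) * (2 * 2 ^ (j' : ℝ) * quadForm Φ Λ (u i) (v j) (u i') (v j')))) :=
        quadForm_tsum hΦ Λ (fun i => 2 * 2 ^ (i : ℝ)) hum hvm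
    _ ≤ ∑' i : ℤ, ∑' j : ℤ, ∑' i' : ℤ, ∑' j' : ℤ, (16 * C : ℝ≥0∞) *
        (((2 : ℝ≥0∞) ^ (i : ℝ) * 2 ^ (i' : ℝ) * X f i i') *
          (2 ^ (j : ℝ) * 2 ^ (j' : ℝ) * X g j j')) := by
        refine ENNReal.tsum_le_tsum fun i => ENNReal.tsum_le_tsum fun j =>
          ENNReal.tsum_le_tsum fun i' => ENNReal.tsum_le_tsum fun j' => ?_
        have h1 := quadForm_indicator_le_rpow hΦ (Λ := Λ) hU hV
          (measurableSet_dyadicLayer hf i) (measurableSet_dyadicLayer hf i')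
          (measurableSet_dyadicLayer hg j) (measurableSet_dyadicLayer hg j')
          (dyadicLayer_subset hfU i) (dyadicLayer_subset hfU i')
          (dyadicLayer_subset hgV j) (dyadicLayer_subset hgV j')
        calc _ ≤ 2 * 2 ^ (i : ℝ) * (2 * 2 ^ (j : ℝ) * (2 * 2 ^ (i' : ℝ) * (2 * 2 ^ (j' : ℝ) *
              (C * (X f i i' * X g j j'))))) := by
              gcongr
          _ = _ := by ring
    _ = (16 * C : ℝ≥0∞) * ((∑' i : ℤ, ∑' i' : ℤ, (2 : ℝ≥0∞) ^ (i : ℝ) * 2 ^ (i' : ℝ) * X f i i') *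
        ∑' j : ℤ, ∑' j' : ℤ, (2 : ℝ≥0∞) ^ (j : ℝ) * 2 ^ (j' : ℝ) * X g j j') := by
        have h2 : ∀ a b : ℤ → ℤ → ℝ≥0∞, ∑' i : ℤ, ∑' j : ℤ, ∑' i' : ℤ, ∑' j' : ℤ, a i i' * b j j' =
            (∑' i : ℤ, ∑' i' : ℤ, a i i') * ∑' j : ℤ, ∑' j' : ℤ, b j j' := by
          intro a b
          simp_rw [ENNReal.tsum_mul_left, ENNReal.tsum_mul_right, ENNReal.tsum_mul_left,
            ENNReal.tsum_mul_right]
        simp_rw [ENNReal.tsum_mul_left (a := (16 * C : ℝ≥0∞))]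
        rw [h2 (fun i i' => (2 : ℝ≥0∞) ^ (i : ℝ) * 2 ^ (i' : ℝ) * X f i i')
          (fun j j' => (2 : ℝ≥0∞) ^ (j : ℝ) * 2 ^ (j' : ℝ) * X g j j')]
    _ ≤ (16 * C : ℝ≥0∞) * ((K * (∫⁻ x, f x ^ (e / 2 + 1 / 4)⁻¹) ^ (e + 1 / 2)) *
        (K * (∫⁻ x, g x ^ (e / 2 + 1 / 4)⁻¹) ^ (e + 1 / 2))) := by
        gcongr
        · exact hS f hf
        · exact hS g hg
    _ = _ := by
        push_cast
        ring

lemma Nondegenerate.finrank_le [Nontrivial F] {D : E →L[ℝ] F} {H : E →L[ℝ] E →L[ℝ] F}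
    (h : Nondegenerate D H) : Module.finrank ℝ F ≤ Module.finrank ℝ E := by
  obtain ⟨J, hJ⟩ := h.exists_rightInverse
  refine LinearMap.finrank_le_finrank_of_injective (f := (J : F →ₗ[ℝ] E)) fun y y' h => ?_
  have h2 : D (J y) = D (J y') := congrArg D h
  rwa [hJ, hJ] at h2

/-- The exponent `d / (d + k)` of the restricted estimates. -/
noncomputable def restrExp (E F : Type*) [AddCommGroup E] [Module ℝ E] [AddCommGroup F]
    [Module ℝ F] : ℝ :=
  (Module.finrank ℝ E : ℝ) / (Module.finrank ℝ E + Module.finrank ℝ F)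

/-- The critical exponent `4 (d + k) / (3 d + k)` for the bound into `L²`. -/
noncomputable def critExp (E F : Type*) [AddCommGroup E] [Module ℝ E] [AddCommGroup F]
    [Module ℝ F] : ℝ :=
  (restrExp E F / 2 + 1 / 4)⁻¹

/-- The restricted estimate is needed with `z` near `ν₂` and averages near `ν₁`, and with the roles
exchanged; these use the second derivative at `ν₂` and at `ν₁` respectively. Surjectivity of the
first-derivative difference gives `k ≤ d`, hence `restrExp ≥ 1/2`. -/
theorem exists_quadForm_estimate {Φ : E → F} (hΦ : ContDiff ℝ ∞ Φ) {ν₁ ν₂ : E} [Nontrivial F]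
    (h₁ : Nondegenerate (fderiv ℝ Φ ν₂ - fderiv ℝ Φ ν₁) (fderiv ℝ (fderiv ℝ Φ) ν₂))
    (h₂ : Nondegenerate (fderiv ℝ Φ ν₁ - fderiv ℝ Φ ν₂) (fderiv ℝ (fderiv ℝ Φ) ν₁)) :
    ∃ ρ > 0, ∃ C : ℝ≥0, ∀ Λ : ℝ, 0 < Λ → ∀ {f g : E → ℝ≥0∞}, Measurable f → Measurable g →
      (∀ x, f x ≠ ⊤) → (∀ x, g x ≠ ⊤) → (∀ x ∉ Metric.closedBall ν₁ ρ, f x = 0) →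
      (∀ x ∉ Metric.closedBall ν₂ ρ, g x = 0) →
      quadForm Φ Λ f g f g ≤ C * ((∫⁻ x, f x ^ critExp E F) ^ (restrExp E F + 1 / 2) *
        (∫⁻ x, g x ^ critExp E F) ^ (restrExp E F + 1 / 2)) := by
  obtain ⟨ρ₁, hρ₁, H₁⟩ := exists_restricted_estimate hΦ h₁
  obtain ⟨ρ₂, hρ₂, H₂⟩ := exists_restricted_estimate hΦ h₂
  obtain ⟨C₁, hC₁⟩ := H₁ (min ρ₁ ρ₂) (lt_min hρ₁ hρ₂) (min_le_left _ _)
  obtain ⟨C₂, hC₂⟩ := H₂ (min ρ₁ ρ₂) (lt_min hρ₁ hρ₂) (min_le_right _ _)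
  have hn : (0 : ℝ) < Module.finrank ℝ F := by exact_mod_cast Module.finrank_pos
  have hle : (Module.finrank ℝ F : ℝ) ≤ Module.finrank ℝ E := by exact_mod_cast h₁.finrank_le
  have he : 1 / 2 ≤ restrExp E F := by
    unfold restrExp
    rw [div_le_div_iff₀ (by norm_num) (by linarith)]
    linarith
  obtain ⟨K, hK⟩ := exists_quadForm_le_of_restricted (E := E) (F := F) he
  refine ⟨min ρ₁ ρ₂, lt_min hρ₁ hρ₂, K * max C₁ C₂, fun Λ hΛ f g hf hg hft hgt hfU hgV => ?_⟩
  refine hK hΦ.continuous Λ (U := Metric.closedBall ν₁ (min ρ₁ ρ₂))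
    (V := Metric.closedBall ν₂ (min ρ₁ ρ₂)) ?_ ?_ hf hg hft hgt hfU hgV
  · intro z hz A A' hA hA' hAU hAU'
    refine (hC₁ z hz A A' hA hA' hAU hAU' Λ hΛ).trans ?_
    unfold restrExp
    gcongr
    exact le_max_left _ _
  · intro z hz A A' hA hA' hAU hAU'
    refine (hC₂ z hz A A' hA hA' hAU hAU' Λ hΛ).trans ?_
    unfold restrExp
    gcongr
    exact le_max_right _ _

end Layers

/-! ### From the L² norm of the product to the quadrilinear form. -/

section Plancherel

variable {E F : Type*} [NormedAddCommGroup E] [InnerProductSpace ℝ E] [FiniteDimensional ℝ E]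
  [MeasurableSpace E] [BorelSpace E]
  [NormedAddCommGroup F] [InnerProductSpace ℝ F] [FiniteDimensional ℝ F]
  [MeasurableSpace F] [BorelSpace F]

@[fun_prop]
lemma measurable_gaussMul (Λ : ℝ) : Measurable (gaussMul Λ : F → ℝ) :=
  (continuous_gaussMul Λ).measurable

/-- Gaussian-weighted `L²` bound for a Fourier integral with an arbitrary frequency map. -/
theorem lintegral_gaussMul_mul_sq_le {X : Type*} [MeasurableSpace X] {μ : Measure X} [SFinite μ]
    {ψ : X → F} (hψ : Measurable ψ) (h : X → ℂ) {Λ : ℝ} (hΛ : 0 < Λ) :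
    ∫⁻ t, ENNReal.ofReal (gaussMul Λ t) * ‖∫ x, h x * phase (inner ℝ t (ψ x)) ∂μ‖ₑ ^ 2 ≤
      ∫⁻ x, ∫⁻ x', ‖h x‖ₑ * ‖h x'‖ₑ * ENNReal.ofReal (gaussKer Λ (ψ x - ψ x')) ∂μ ∂μ := by
  have hpm : ∀ t : F, Measurable fun x => phase (inner ℝ t (ψ x)) := fun t =>
    (continuous_phase.comp (by fun_prop : Continuous fun u : F => (inner ℝ t u : ℝ))).measurable.comp hψ
  -- The phases are unimodular, so without integrability of `h` every integral on the left takes the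
  -- default value `0`. This allows `h` to be a slice whose integrability is not known for each
  -- parameter.
  by_cases hint : Integrable h μ
  swap
  · have h0 : ∀ t : F, ∫ x, h x * phase (inner ℝ t (ψ x)) ∂μ = 0 := by
      intro t
      refine integral_undef fun hcon => hint ?_
      have h1 : Integrable (fun x => h x * phase (inner ℝ t (ψ x)) *
          (starRingEnd ℂ) (phase (inner ℝ t (ψ x)))) μ :=
        hcon.mul_bdd (c := 1) (Complex.continuous_conj.measurable.comp (hpm t)).aestronglyMeasurable
          (Filter.Eventually.of_forall fun x => by simp)
      refine h1.congr (Filter.Eventually.of_forall fun x => ?_)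
      simp only
      rw [mul_assoc, Complex.mul_conj, Complex.normSq_eq_norm_sq, norm_phase]
      simp
    simp [h0]
  set G : F → ℂ := fun t => ∫ x, h x * phase (inner ℝ t (ψ x)) ∂μ with hG
  set J : X × X → ℂ := fun p => h p.1 * (starRingEnd ℂ) (h p.2) with hJ
  have hJi : Integrable J (μ.prod μ) := hint.mul_prod (Complex.conjCLE.integrable_comp_iff.2 hint)
  have hpp : Measurable fun q : F × X × X => phase (inner ℝ q.1 (ψ q.2.1 - ψ q.2.2)) := by
    have h1 : Continuous fun r : F × F => phase (inner ℝ r.1 r.2) :=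
      continuous_phase.comp (by fun_prop)
    exact h1.measurable.comp
      (by fun_prop : Measurable fun q : F × X × X => (q.1, ψ q.2.1 - ψ q.2.2))
  have hbig : Integrable (fun q : F × X × X => (gaussMul Λ q.1 : ℂ) * J q.2 *
      phase (inner ℝ q.1 (ψ q.2.1 - ψ q.2.2))) (volume.prod (μ.prod μ)) :=
    ((integrable_gaussMul hΛ).ofReal.mul_prod hJi).mul_bdd (c := 1) hpp.aestronglyMeasurable
      (Filter.Eventually.of_forall fun q => (norm_phase _).le)
  have hGG : ∀ t, G t * (starRingEnd ℂ) (G t) =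
      ∫ p, J p * phase (inner ℝ t (ψ p.1 - ψ p.2)) ∂(μ.prod μ) := by
    intro t
    simp only [hG]
    rw [← integral_conj, ← integral_prod_mul]
    congr 1 with p
    rw [inner_sub_right, phase_sub, map_mul]
    ring
  have hreal : ∀ t, ((gaussMul Λ t * ‖G t‖ ^ 2 : ℝ) : ℂ) =
      ∫ p, (gaussMul Λ t : ℂ) * J p * phase (inner ℝ t (ψ p.1 - ψ p.2)) ∂(μ.prod μ) := by
    intro t
    simp_rw [mul_assoc]
    rw [integral_const_mul, ← hGG, Complex.mul_conj, Complex.normSq_eq_norm_sq]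
    push_cast
    ring
  have hri : Integrable fun t => gaussMul Λ t * ‖G t‖ ^ 2 := by
    have h1 := hbig.integral_prod_left
    simp_rw [← hreal] at h1
    exact h1.re.congr (Filter.Eventually.of_forall fun t => RCLike.ofReal_re (K := ℂ) _)
  -- Integrating the expanded square in `t` turns the Gaussian multiplier into its positive kernel
  -- at `ψ x - ψ x'`; only then are absolute values taken.
  have hswap : ((∫ t, gaussMul Λ t * ‖G t‖ ^ 2 : ℝ) : ℂ) =
      ∫ p, J p * (gaussKer Λ (ψ p.1 - ψ p.2) : ℂ) ∂(μ.prod μ) := by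
    rw [← integral_complex_ofReal]
    simp_rw [hreal]
    rw [integral_integral_swap hbig]
    congr 1 with p
    rw [← multiplierKernel_gaussMul hΛ, multiplierKernel, ← integral_const_mul]
    congr 1 with t
    ring
  calc ∫⁻ t, ENNReal.ofReal (gaussMul Λ t) * ‖G t‖ₑ ^ 2
      = ∫⁻ t, ENNReal.ofReal (gaussMul Λ t * ‖G t‖ ^ 2) := by
        congr 1 with t
        rw [ENNReal.ofReal_mul (gaussMul_pos _ _).le, ENNReal.ofReal_pow (norm_nonneg _),
          ofReal_norm]
    _ = ENNReal.ofReal (∫ t, gaussMul Λ t * ‖G t‖ ^ 2) :=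
        (ofReal_integral_eq_lintegral_ofReal hri (Filter.Eventually.of_forall fun t =>
          mul_nonneg (gaussMul_pos _ _).le (sq_nonneg _))).symm
    _ = ‖((∫ t, gaussMul Λ t * ‖G t‖ ^ 2 : ℝ) : ℂ)‖ₑ := by
        rw [← ofReal_norm, Complex.norm_real, Real.norm_of_nonneg]
        exact integral_nonneg fun t => mul_nonneg (gaussMul_pos _ _).le (sq_nonneg _)
    _ ≤ ∫⁻ p, ‖J p * (gaussKer Λ (ψ p.1 - ψ p.2) : ℂ)‖ₑ ∂(μ.prod μ) := by
        rw [hswap]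
        exact enorm_integral_le_lintegral_enorm _
    _ = ∫⁻ p, ‖h p.1‖ₑ * ‖h p.2‖ₑ * ENNReal.ofReal (gaussKer Λ (ψ p.1 - ψ p.2)) ∂(μ.prod μ) := by
        congr 1 with p
        simp only [hJ]
        rw [enorm_mul, enorm_mul, RCLike.enorm_conj, ← ofReal_norm (gaussKer _ _ : ℂ), Complex.norm_real,
          Real.norm_of_nonneg (gaussKer_nonneg hΛ.le _)]
    _ = _ := by
        refine lintegral_prod _ ?_
        have hk : Measurable fun p : X × X => ENNReal.ofReal (gaussKer Λ (ψ p.1 - ψ p.2)) :=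
          ((continuous_gaussKer Λ).measurable.comp (by fun_prop)).ennreal_ofReal
        have h1 : AEMeasurable (fun x => ‖h x‖ₑ) μ := hint.1.enorm
        exact (h1.comp_fst.mul h1.comp_snd).mul hk.aemeasurable

lemma exists_lintegral_gaussKer_le : ∃ C : ℝ≥0, ∀ Λ : ℝ, 0 < Λ →
    ∫⁻ u : F, ENNReal.ofReal (gaussKer Λ u) ≤ C := by
  have hfin : ∫⁻ u : F, ENNReal.ofReal (gaussMul 1 u) ≠ ⊤ := by
    have := (integrable_gaussMul (F := F) one_pos).2
    rw [hasFiniteIntegral_iff_ofReal (Filter.Eventually.of_forall fun u => (gaussMul_pos _ _).le)]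
      at this
    exact this.ne
  refine ⟨(∫⁻ u : F, ENNReal.ofReal (gaussMul 1 u)).toNNReal, fun Λ hΛ => ?_⟩
  rw [ENNReal.coe_toNNReal hfin]
  have h1 : ∀ u : F, ENNReal.ofReal (gaussKer Λ u) =
      ENNReal.ofReal (Λ ^ Module.finrank ℝ F) * ENNReal.ofReal (gaussMul 1 (Λ • u)) := by
    intro u
    rw [← ENNReal.ofReal_mul (by positivity)]
    unfold gaussKer gaussMul
    rw [norm_smul, Real.norm_of_nonneg hΛ.le, inv_one, one_mul]
  have hm : Measurable fun u : F => ENNReal.ofReal (gaussMul 1 u) :=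
    (continuous_gaussMul 1).measurable.ennreal_ofReal
  simp_rw [h1]
  rw [lintegral_const_mul _ (by fun_prop), ← lintegral_map hm (measurable_const_smul Λ),
    Measure.map_addHaar_smul volume hΛ.ne', lintegral_smul_measure, abs_of_nonneg (by positivity),
    smul_eq_mul, ← mul_assoc, ← ENNReal.ofReal_mul (by positivity), mul_inv_cancel₀ (by positivity)]
  simp

/-- Schur's test from `ab ≤ a² + b²`, with evenness of `K` used for the second variable. The factor
`2` is harmless. -/
lemma lintegral_schur_le {K : F → ℝ≥0∞} (hK : Measurable K) (hKn : ∀ u, K (-u) = K u)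
    {h : F → ℝ≥0∞} (hh : Measurable h) :
    ∫⁻ x, ∫⁻ x', h x * h x' * K (x - x') ≤ 2 * (∫⁻ u, K u) * ∫⁻ x, h x ^ 2 := by
  have hab : ∀ a b : ℝ≥0∞, a * b ≤ a ^ 2 + b ^ 2 := by
    intro a b
    rcases le_total a b with hle | hle
    · calc a * b ≤ b * b := by gcongr
        _ = b ^ 2 := (sq b).symm
        _ ≤ _ := le_add_self
    · calc a * b ≤ a * a := by gcongr
        _ = a ^ 2 := (sq a).symm
        _ ≤ _ := le_self_add
  have hconv : ∀ x : F, ∫⁻ x', K (x - x') = ∫⁻ u, K u := fun x => lintegral_sub_left_eq_self K x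
  have hA : ∫⁻ x, ∫⁻ x', h x ^ 2 * K (x - x') = (∫⁻ u, K u) * ∫⁻ x, h x ^ 2 := by
    have : ∀ x, ∫⁻ x', h x ^ 2 * K (x - x') = (∫⁻ u, K u) * h x ^ 2 := fun x => by
      rw [lintegral_const_mul _ (by fun_prop), hconv, mul_comm]
    simp_rw [this]
    exact lintegral_const_mul _ (by fun_prop)
  have hB : ∫⁻ x, ∫⁻ x', h x' ^ 2 * K (x - x') = (∫⁻ u, K u) * ∫⁻ x, h x ^ 2 := by
    rw [lintegral_lintegral_swap (by fun_prop), ← hA]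
    congr 1 with x
    congr 1 with x'
    rw [← hKn, neg_sub]
  calc ∫⁻ x, ∫⁻ x', h x * h x' * K (x - x')
      ≤ ∫⁻ x, ∫⁻ x', (h x ^ 2 * K (x - x') + h x' ^ 2 * K (x - x')) := by
        refine lintegral_mono fun x => lintegral_mono fun x' => ?_
        simp only
        rw [← add_mul]
        gcongr
        exact hab _ _
    _ = ∫⁻ x, (∫⁻ x', h x ^ 2 * K (x - x')) + ∫⁻ x', h x' ^ 2 * K (x - x') := by
        congr 1 with x
        exact lintegral_add_left (by fun_prop) _
    _ = 2 * (∫⁻ u, K u) * ∫⁻ x, h x ^ 2 := by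
        rw [lintegral_add_left, hA, hB]
        · ring
        · exact (by fun_prop : Measurable fun p : F × F => h p.1 ^ 2 * K (p.1 - p.2)).lintegral_prod_right'

/-- The extension operator, without restriction to a set. -/
noncomputable def extFun (Φ : E → F) (f : E → ℂ) (z : E × F) : ℂ :=
  ∫ ξ, f ξ * phase (inner ℝ z.1 ξ + inner ℝ z.2 (Φ ξ))

lemma stronglyMeasurable_extFun {Φ : E → F} (hΦ : Continuous Φ) {f : E → ℂ} (hf : Measurable f) :
    StronglyMeasurable (extFun Φ f) := by
  have hp : Continuous fun q : (E × F) × E => phase (inner ℝ q.1.1 q.2 + inner ℝ q.1.2 (Φ q.2)) :=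
    continuous_phase.comp (by fun_prop)
  have hm : Measurable fun q : (E × F) × E => f q.2 * phase (inner ℝ q.1.1 q.2 + inner ℝ q.1.2 (Φ q.2)) :=
    (hf.comp measurable_snd).mul hp.measurable
  exact hm.stronglyMeasurable.integral_prod_right'

/-- For fixed `t`, the function whose Fourier integral in `x` is the product of two extensions. -/
noncomputable def twistedConv (Φ : E → F) (f g : E → ℂ) (t : F) (η : E) : ℂ :=
  ∫ ξ, f ξ * g (η - ξ) * phase (inner ℝ t (Φ ξ + Φ (η - ξ)))

lemma measurable_twistedConv {Φ : E → F} (hΦ : Continuous Φ) {f g : E → ℂ} (hf : Measurable f)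
    (hg : Measurable g) : Measurable fun q : F × E => twistedConv Φ f g q.1 q.2 := by
  have hp : Continuous fun q : (F × E) × E => phase (inner ℝ q.1.1 (Φ q.2 + Φ (q.1.2 - q.2))) :=
    continuous_phase.comp (by fun_prop)
  have hm : Measurable fun q : (F × E) × E => f q.2 * g (q.1.2 - q.2) *
      phase (inner ℝ q.1.1 (Φ q.2 + Φ (q.1.2 - q.2))) := by
    have := hp.measurable
    fun_prop
  exact hm.stronglyMeasurable.integral_prod_right'.measurable

/-- For fixed `t` the product is the Fourier integral in `x` of a convolution. The identity map is
displayed so that the weighted bound applies with frequency map `ψ = id`. -/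
lemma extFun_mul_extFun {Φ : E → F} (hΦ : Continuous Φ) {f g : E → ℂ} (hf : Integrable f)
    (hg : Integrable g) (x : E) (t : F) :
    extFun Φ f (x, t) * extFun Φ g (x, t) =
      ∫ η, twistedConv Φ f g t η * phase (inner ℝ x (id η)) := by
  have hp : Continuous fun ξ : E => phase (inner ℝ x ξ + inner ℝ t (Φ ξ)) :=
    continuous_phase.comp (by fun_prop)
  have hi : ∀ {f : E → ℂ}, Integrable f →
      Integrable fun ξ => f ξ * phase (inner ℝ x ξ + inner ℝ t (Φ ξ)) := fun hf =>
    hf.mul_bdd (c := 1) hp.aestronglyMeasurable (Filter.Eventually.of_forall fun _ => (norm_phase _).le)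
  have h := integral_convolution (ContinuousLinearMap.mul ℝ ℂ) (μ := volume) (ν := volume) (hi hf) (hi hg)
  rw [ContinuousLinearMap.mul_apply'] at h
  unfold extFun
  simp only
  rw [← h]
  congr 1 with η
  rw [convolution_def, twistedConv, ← integral_mul_const]
  congr 1 with ξ
  rw [ContinuousLinearMap.mul_apply', id]
  have h1 : inner ℝ x η = inner ℝ x ξ + inner ℝ x (η - ξ) := by
    rw [← inner_add_right, add_sub_cancel]
  rw [h1, inner_add_right]
  simp only [phase_add]
  ring

/-- The weighted bound is used twice. In `x`, with `ψ = id`, it combines with Schur's test and the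
uniform mass of the Gaussian into one half of Plancherel. In `t`, for fixed `η`, with `ψ ξ = Φ ξ + Φ
(η - ξ)`, it produces `quadForm`. -/
theorem exists_lintegral_extFun_weighted_le : ∃ C : ℝ≥0, ∀ {Φ : E → F}, Continuous Φ →
    ∀ {f g : E → ℂ}, Measurable f → Measurable g → Integrable f → Integrable g →
    ∀ {Λ : ℝ}, 0 < Λ →
    ∫⁻ z : E × F, ENNReal.ofReal (gaussMul Λ z.2) * (ENNReal.ofReal (gaussMul Λ z.1) *
      ‖extFun Φ f z * extFun Φ g z‖ₑ ^ 2) ≤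
      C * quadForm Φ Λ (fun x => ‖f x‖ₑ) (fun x => ‖g x‖ₑ) (fun x => ‖f x‖ₑ) (fun x => ‖g x‖ₑ) := by
  obtain ⟨C, hC⟩ := exists_lintegral_gaussKer_le (F := E)
  refine ⟨2 * C, fun {Φ} hΦ {f g} hf hg hfi hgi {Λ} hΛ => ?_⟩
  have hEm : Measurable fun z : E × F => ‖extFun Φ f z * extFun Φ g z‖ₑ ^ 2 := by
    have h1 := (stronglyMeasurable_extFun hΦ hf).measurable
    have h2 := (stronglyMeasurable_extFun hΦ hg).measurable
    fun_prop
  have hEm' : ∀ t : F, Measurable fun x => ‖extFun Φ f (x, t) * extFun Φ g (x, t)‖ₑ ^ 2 := fun t =>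
    hEm.comp (by fun_prop : Measurable fun x : E => ((x, t) : E × F))
  have hTm := measurable_twistedConv hΦ hf hg
  have hTm' : ∀ t, Measurable fun η => twistedConv Φ f g t η := fun t =>
    hTm.comp (by fun_prop : Measurable fun η : E => ((t, η) : F × E))
  have hinner : ∀ t : F, ∫⁻ x, ENNReal.ofReal (gaussMul Λ x) *
      ‖extFun Φ f (x, t) * extFun Φ g (x, t)‖ₑ ^ 2 ≤ 2 * C * ∫⁻ η, ‖twistedConv Φ f g t η‖ₑ ^ 2 := by
    intro t
    simp_rw [extFun_mul_extFun hΦ hfi hgi]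
    refine (lintegral_gaussMul_mul_sq_le measurable_id _ hΛ).trans ?_
    refine (lintegral_schur_le (K := fun u => ENNReal.ofReal (gaussKer Λ u))
      (continuous_gaussKer Λ).measurable.ennreal_ofReal (fun u => by rw [gaussKer_neg])
      (hTm' t).enorm).trans ?_
    gcongr
    exact hC Λ hΛ
  calc ∫⁻ z : E × F, ENNReal.ofReal (gaussMul Λ z.2) * (ENNReal.ofReal (gaussMul Λ z.1) *
        ‖extFun Φ f z * extFun Φ g z‖ₑ ^ 2)
      = ∫⁻ t, ∫⁻ x, ENNReal.ofReal (gaussMul Λ t) * (ENNReal.ofReal (gaussMul Λ x) *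
        ‖extFun Φ f (x, t) * extFun Φ g (x, t)‖ₑ ^ 2) := by
        rw [Measure.volume_eq_prod]
        exact lintegral_prod_symm' _ (by fun_prop)
    _ ≤ ∫⁻ t, ENNReal.ofReal (gaussMul Λ t) * (2 * C * ∫⁻ η, ‖twistedConv Φ f g t η‖ₑ ^ 2) := by
        refine lintegral_mono fun t => ?_
        simp only
        have hm : Measurable fun x => ENNReal.ofReal (gaussMul Λ x) *
            ‖extFun Φ f (x, t) * extFun Φ g (x, t)‖ₑ ^ 2 :=
          (measurable_gaussMul Λ).ennreal_ofReal.mul (hEm' t)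
        rw [lintegral_const_mul _ hm]
        gcongr
        exact hinner t
    _ = 2 * C * ∫⁻ t, ∫⁻ η, ENNReal.ofReal (gaussMul Λ t) * ‖twistedConv Φ f g t η‖ₑ ^ 2 := by
        rw [← lintegral_const_mul _ (Measurable.lintegral_prod_right' (f := fun q : F × E =>
          ENNReal.ofReal (gaussMul Λ q.1) * ‖twistedConv Φ f g q.1 q.2‖ₑ ^ 2) (by fun_prop))]
        congr 1 with t
        simp only
        rw [lintegral_const_mul _ ((hTm' t).enorm.pow_const 2)]
        ring
    _ = 2 * C * ∫⁻ η, ∫⁻ t, ENNReal.ofReal (gaussMul Λ t) * ‖twistedConv Φ f g t η‖ₑ ^ 2 := by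
        rw [lintegral_lintegral_swap]
        exact Measurable.aemeasurable (by
          simp only [Function.uncurry_def]
          fun_prop)
    _ ≤ 2 * C * quadForm Φ Λ (fun x => ‖f x‖ₑ) (fun x => ‖g x‖ₑ) (fun x => ‖f x‖ₑ)
        (fun x => ‖g x‖ₑ) := by
        unfold quadForm
        gcongr with η
        refine (lintegral_gaussMul_mul_sq_le (μ := volume) (ψ := fun ξ => Φ ξ + Φ (η - ξ))
          (by fun_prop) (fun ξ => f ξ * g (η - ξ)) hΛ).trans_eq ?_
        congr 1 with x
        congr 1 with x'
        unfold quadWeight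
        rw [enorm_mul, enorm_mul]
        congr 3
        abel
    _ = _ := by push_cast; rfl

lemma tendsto_gaussMul (t : F) :
    Filter.Tendsto (fun n : ℕ => gaussMul ((n : ℝ) + 1) t) Filter.atTop (nhds 1) := by
  have h1 : Filter.Tendsto (fun n : ℕ => ((n : ℝ) + 1)⁻¹) Filter.atTop (nhds 0) := by
    simpa using tendsto_one_div_add_atTop_nhds_zero_nat (𝕜 := ℝ)
  have h2 : Continuous fun r : ℝ => Real.exp (-Real.pi * (r * ‖t‖) ^ 2) := by fun_prop
  have h3 := (h2.tendsto 0).comp h1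
  simpa [gaussMul, Function.comp_def] using h3

/-- All bounds are uniform in `Λ`, and the Gaussian weights tend to `1` as `Λ → ∞`; Fatou's lemma
removes them. -/
theorem exists_local_extFun_estimate {Φ : E → F} (hΦ : ContDiff ℝ ∞ Φ) {ν₁ ν₂ : E} [Nontrivial F]
    (h₁ : Nondegenerate (fderiv ℝ Φ ν₂ - fderiv ℝ Φ ν₁) (fderiv ℝ (fderiv ℝ Φ) ν₂))
    (h₂ : Nondegenerate (fderiv ℝ Φ ν₁ - fderiv ℝ Φ ν₂) (fderiv ℝ (fderiv ℝ Φ) ν₁)) :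
    ∃ ρ > 0, ∃ C : ℝ≥0, ∀ {f g : E → ℂ}, Measurable f → Measurable g →
      Integrable f → Integrable g → (∀ x ∉ Metric.closedBall ν₁ ρ, f x = 0) →
      (∀ x ∉ Metric.closedBall ν₂ ρ, g x = 0) →
      ∫⁻ z : E × F, ‖extFun Φ f z * extFun Φ g z‖ₑ ^ 2 ≤
        C * ((∫⁻ x, ‖f x‖ₑ ^ critExp E F) ^ (restrExp E F + 1 / 2) *
          (∫⁻ x, ‖g x‖ₑ ^ critExp E F) ^ (restrExp E F + 1 / 2)) := by
  obtain ⟨ρ, hρ, C, hC⟩ := exists_quadForm_estimate hΦ h₁ h₂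
  obtain ⟨C', hC'⟩ := exists_lintegral_extFun_weighted_le (E := E) (F := F)
  refine ⟨ρ, hρ, C' * C, fun {f g} hf hg hfi hgi hfU hgV => ?_⟩
  have hEm : Measurable fun z : E × F => ‖extFun Φ f z * extFun Φ g z‖ₑ ^ 2 := by
    have h1 := (stronglyMeasurable_extFun hΦ.continuous hf).measurable
    have h2 := (stronglyMeasurable_extFun hΦ.continuous hg).measurable
    fun_prop
  have hbound : ∀ n : ℕ, ∫⁻ z : E × F, ENNReal.ofReal (gaussMul ((n : ℝ) + 1) z.2) *
      (ENNReal.ofReal (gaussMul ((n : ℝ) + 1) z.1) * ‖extFun Φ f z * extFun Φ g z‖ₑ ^ 2) ≤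
      (C' * C : ℝ≥0) * ((∫⁻ x, ‖f x‖ₑ ^ critExp E F) ^ (restrExp E F + 1 / 2) *
          (∫⁻ x, ‖g x‖ₑ ^ critExp E F) ^ (restrExp E F + 1 / 2)) := by
    intro n
    refine (hC' hΦ.continuous hf hg hfi hgi (by positivity)).trans ?_
    push_cast
    rw [mul_assoc]
    gcongr
    exact hC _ (by positivity) hf.enorm hg.enorm (fun _ => enorm_ne_top) (fun _ => enorm_ne_top)
      (fun x hx => by rw [hfU x hx, enorm_zero]) (fun x hx => by rw [hgV x hx, enorm_zero])
  have hlim : ∀ z : E × F, Filter.liminf (fun n : ℕ => ENNReal.ofReal (gaussMul ((n : ℝ) + 1) z.2) *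
      (ENNReal.ofReal (gaussMul ((n : ℝ) + 1) z.1) * ‖extFun Φ f z * extFun Φ g z‖ₑ ^ 2))
      Filter.atTop = ‖extFun Φ f z * extFun Φ g z‖ₑ ^ 2 := by
    intro z
    refine Filter.Tendsto.liminf_eq ?_
    have hfin : ‖extFun Φ f z * extFun Φ g z‖ₑ ^ 2 ≠ ⊤ := ENNReal.pow_ne_top enorm_ne_top
    have t1 := ENNReal.tendsto_ofReal (tendsto_gaussMul z.1)
    have t2 := ENNReal.tendsto_ofReal (tendsto_gaussMul z.2)
    have t3 := ENNReal.Tendsto.mul_const t1 (Or.inr hfin)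
    have t4 := ENNReal.Tendsto.mul t2 (Or.inl (by simp)) t3 (Or.inr (by simp))
    simpa using t4
  calc ∫⁻ z : E × F, ‖extFun Φ f z * extFun Φ g z‖ₑ ^ 2
      = ∫⁻ z : E × F, Filter.liminf (fun n : ℕ => ENNReal.ofReal (gaussMul ((n : ℝ) + 1) z.2) *
        (ENNReal.ofReal (gaussMul ((n : ℝ) + 1) z.1) * ‖extFun Φ f z * extFun Φ g z‖ₑ ^ 2))
        Filter.atTop := by simp_rw [hlim]
    _ ≤ Filter.liminf (fun n : ℕ => ∫⁻ z : E × F, ENNReal.ofReal (gaussMul ((n : ℝ) + 1) z.2) *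
        (ENNReal.ofReal (gaussMul ((n : ℝ) + 1) z.1) * ‖extFun Φ f z * extFun Φ g z‖ₑ ^ 2))
        Filter.atTop := by
        exact lintegral_liminf_le fun n => by fun_prop
    _ ≤ _ := Filter.liminf_le_of_frequently_le' (Filter.Frequently.of_forall hbound)

end Plancherel

/-! ### Patching local estimates over compact sets. -/

section Globalize

variable {E F : Type*} [NormedAddCommGroup E] [InnerProductSpace ℝ E] [FiniteDimensional ℝ E]
  [MeasurableSpace E] [BorelSpace E]
  [NormedAddCommGroup F] [InnerProductSpace ℝ F] [FiniteDimensional ℝ F]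
  [MeasurableSpace F] [BorelSpace F]

lemma integrable_mul_phase {Φ : E → F} (hΦ : Continuous Φ) {f : E → ℂ} (hf : Integrable f)
    (z : E × F) : Integrable fun ξ => f ξ * phase (inner ℝ z.1 ξ + inner ℝ z.2 (Φ ξ)) := by
  have hp : Continuous fun ξ : E => phase (inner ℝ z.1 ξ + inner ℝ z.2 (Φ ξ)) :=
    continuous_phase.comp (by fun_prop)
  exact hf.mul_bdd (c := 1) hp.aestronglyMeasurable
    (Filter.Eventually.of_forall fun _ => (norm_phase _).le)

lemma extFun_add {Φ : E → F} (hΦ : Continuous Φ) {f g : E → ℂ} (hf : Integrable f)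
    (hg : Integrable g) (z : E × F) :
    extFun Φ (fun x => f x + g x) z = extFun Φ f z + extFun Φ g z := by
  unfold extFun
  simp_rw [add_mul]
  exact integral_add (integrable_mul_phase hΦ hf z) (integrable_mul_phase hΦ hg z)

/-- The bilinear `L^p × L^p → L²` estimate at the critical exponent, for functions supported in
`A` and `B`. -/
def CritEstimate (Φ : E → F) (A B : Set E) : Prop :=
  ∃ C : ℝ≥0, ∀ {f g : E → ℂ}, Measurable f → Measurable g → Integrable f → Integrable g →
    (∀ x ∉ A, f x = 0) → (∀ x ∉ B, g x = 0) →
    ∫⁻ z : E × F, ‖extFun Φ f z * extFun Φ g z‖ₑ ^ 2 ≤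
      C * ((∫⁻ x, ‖f x‖ₑ ^ critExp E F) ^ (restrExp E F + 1 / 2) *
        (∫⁻ x, ‖g x‖ₑ ^ critExp E F) ^ (restrExp E F + 1 / 2))

lemma CritEstimate.mono {Φ : E → F} {A A' B B' : Set E} (h : CritEstimate Φ A' B') (hA : A ⊆ A')
    (hB : B ⊆ B') : CritEstimate Φ A B := by
  obtain ⟨C, hC⟩ := h
  exact ⟨C, fun hf hg hfi hgi hfA hgB => hC hf hg hfi hgi (fun x hx => hfA x fun h => hx (hA h))
    fun x hx => hgB x fun h => hx (hB h)⟩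

lemma CritEstimate.symm {Φ : E → F} {A B : Set E} (h : CritEstimate Φ A B) :
    CritEstimate Φ B A := by
  obtain ⟨C, hC⟩ := h
  refine ⟨C, fun {f g} hf hg hfi hgi hfA hgB => ?_⟩
  simp_rw [mul_comm (extFun Φ f _)]
  rw [mul_comm (_ ^ _ : ℝ≥0∞)]
  exact hC hg hf hgi hfi hgB hfA

lemma critEstimate_empty (Φ : E → F) (B : Set E) : CritEstimate Φ ∅ B := by
  refine ⟨0, fun {f g} _ _ _ _ hf _ => ?_⟩
  have hf0 : f = 0 := funext fun x => hf x (Set.notMem_empty x)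
  simp [hf0, extFun]

lemma restrExp_nonneg : 0 ≤ restrExp E F := by unfold restrExp; positivity

lemma critExp_pos : 0 < critExp E F := by
  have := restrExp_nonneg (E := E) (F := F)
  unfold critExp
  positivity

/-- The function is split along `A₁` and its complement, so only `A₁` must be measurable; the second
piece lives in `A₂`. -/
lemma CritEstimate.union {Φ : E → F} (hΦ : Continuous Φ) {A₁ A₂ B : Set E} (hA₁ : MeasurableSet A₁)
    (h₁ : CritEstimate Φ A₁ B) (h₂ : CritEstimate Φ A₂ B) : CritEstimate Φ (A₁ ∪ A₂) B := by
  obtain ⟨C₁, hC₁⟩ := h₁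
  obtain ⟨C₂, hC₂⟩ := h₂
  refine ⟨4 * (C₁ + C₂), fun {f g} hf hg hfi hgi hfA hgB => ?_⟩
  have hexp : 0 ≤ restrExp E F + 1 / 2 := by
    have := restrExp_nonneg (E := E) (F := F)
    positivity
  set N := (∫⁻ x, ‖f x‖ₑ ^ critExp E F) ^ (restrExp E F + 1 / 2) *
        (∫⁻ x, ‖g x‖ₑ ^ critExp E F) ^ (restrExp E F + 1 / 2) with hN
  have hle : ∀ A : Set E, (∫⁻ x, ‖A.indicator f x‖ₑ ^ critExp E F) ^ (restrExp E F + 1 / 2) *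
        (∫⁻ x, ‖g x‖ₑ ^ critExp E F) ^ (restrExp E F + 1 / 2) ≤ N := by
    intro A
    simp only [hN]
    gcongr with x
    · exact critExp_pos.le
    · exact enorm_indicator_le_enorm_self f x
  have hsplit : ∀ z, extFun Φ f z = extFun Φ (A₁.indicator f) z + extFun Φ (A₁ᶜ.indicator f) z := by
    intro z
    rw [← extFun_add hΦ (hfi.indicator hA₁) (hfi.indicator hA₁.compl)]
    congr 1
    ext x
    exact (congrFun (Set.indicator_self_add_compl A₁ f) x).symm
  have hsq : ∀ a b : ℝ≥0∞, (a + b) ^ 2 ≤ 4 * (a ^ 2 + b ^ 2) := by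
    intro a b
    rcases le_total a b with hab | hab
    · calc (a + b) ^ 2 ≤ (b + b) ^ 2 := by gcongr
        _ = 4 * b ^ 2 := by ring
        _ ≤ _ := by gcongr; exact le_add_self
    · calc (a + b) ^ 2 ≤ (a + a) ^ 2 := by gcongr
        _ = 4 * a ^ 2 := by ring
        _ ≤ _ := by gcongr; exact le_self_add
  have hm : ∀ {f : E → ℂ}, Measurable f →
      Measurable fun z : E × F => ‖extFun Φ f z * extFun Φ g z‖ₑ ^ 2 := by
    intro f hf
    have h1 := (stronglyMeasurable_extFun hΦ hf).measurable
    have h2 := (stronglyMeasurable_extFun hΦ hg).measurable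
    fun_prop
  calc ∫⁻ z : E × F, ‖extFun Φ f z * extFun Φ g z‖ₑ ^ 2
      ≤ ∫⁻ z : E × F, 4 * (‖extFun Φ (A₁.indicator f) z * extFun Φ g z‖ₑ ^ 2 +
        ‖extFun Φ (A₁ᶜ.indicator f) z * extFun Φ g z‖ₑ ^ 2) := by
        refine lintegral_mono fun z => ?_
        simp only
        rw [hsplit, add_mul]
        refine le_trans ?_ (hsq _ _)
        gcongr
        exact enorm_add_le _ _
    _ = 4 * ((∫⁻ z : E × F, ‖extFun Φ (A₁.indicator f) z * extFun Φ g z‖ₑ ^ 2) +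
        ∫⁻ z : E × F, ‖extFun Φ (A₁ᶜ.indicator f) z * extFun Φ g z‖ₑ ^ 2) := by
        rw [lintegral_const_mul' _ _ (by norm_num), lintegral_add_left (hm (hf.indicator hA₁))]
    _ ≤ 4 * (C₁ * N + C₂ * N) := by
        gcongr
        · refine (hC₁ (hf.indicator hA₁) hg (hfi.indicator hA₁) hgi
            (fun x hx => Set.indicator_of_notMem hx _) hgB).trans ?_
          gcongr
          exact hle _
        · refine (hC₂ (hf.indicator hA₁.compl) hg (hfi.indicator hA₁.compl) hgi
            (fun x hx => ?_) hgB).trans ?_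
          · by_cases hx1 : x ∈ A₁
            · simp [hx1]
            · rw [Set.indicator_of_mem (by exact hx1)]
              exact hfA x fun h => h.elim hx1 hx
          · gcongr
            exact hle _
    _ = _ := by push_cast; ring

/-- Local estimates near all pairs of points of two compact sets give a global one. -/
theorem critEstimate_of_isCompact {Φ : E → F} (hΦ : ContDiff ℝ ∞ Φ) [Nontrivial F] {S₁ S₂ : Set E}
    (hS₁ : IsCompact S₁) (hS₂ : IsCompact S₂)
    (h : ∀ ν₁ ∈ S₁, ∀ ν₂ ∈ S₂,
      Nondegenerate (fderiv ℝ Φ ν₂ - fderiv ℝ Φ ν₁) (fderiv ℝ (fderiv ℝ Φ) ν₂) ∧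
      Nondegenerate (fderiv ℝ Φ ν₁ - fderiv ℝ Φ ν₂) (fderiv ℝ (fderiv ℝ Φ) ν₁)) :
    CritEstimate Φ S₁ S₂ := by
  -- The neighbourhood of `ν₁` may shrink with `ν₂`, so `S₂` is covered first with `ν₁` fixed,
  -- intersecting finitely many neighbourhoods. Measurable enlargements are carried along because
  -- the union lemma needs a measurable piece.
  have hloc : ∀ ν₁ ∈ S₁, ∃ B', S₂ ⊆ B' ∧ MeasurableSet B' ∧ ∃ A' ∈ nhds ν₁, MeasurableSet A' ∧
      CritEstimate Φ A' B' := by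
    intro ν₁ hν₁
    refine hS₂.induction_on (p := fun B => ∃ B', B ⊆ B' ∧ MeasurableSet B' ∧ ∃ A' ∈ nhds ν₁,
      MeasurableSet A' ∧ CritEstimate Φ A' B') ?_ ?_ ?_ ?_
    · exact ⟨∅, subset_rfl, .empty, Set.univ, Filter.univ_mem, .univ,
        (critEstimate_empty Φ _).symm⟩
    · rintro s t hst ⟨B', hB', h'⟩
      exact ⟨B', hst.trans hB', h'⟩
    · rintro s t ⟨B₁, hB₁, hB₁m, A₁, hA₁, hA₁m, h₁⟩ ⟨B₂, hB₂, hB₂m, A₂, hA₂, hA₂m, h₂⟩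
      refine ⟨B₁ ∪ B₂, Set.union_subset_union hB₁ hB₂, hB₁m.union hB₂m, A₁ ∩ A₂,
        Filter.inter_mem hA₁ hA₂, hA₁m.inter hA₂m, ?_⟩
      exact (CritEstimate.union hΦ.continuous hB₁m (h₁.mono Set.inter_subset_left subset_rfl).symm
        (h₂.mono Set.inter_subset_right subset_rfl).symm).symm
    · intro ν₂ hν₂
      obtain ⟨ρ, hρ, C, hC⟩ := exists_local_extFun_estimate hΦ (h ν₁ hν₁ ν₂ hν₂).1 (h ν₁ hν₁ ν₂ hν₂).2
      exact ⟨Metric.closedBall ν₂ ρ, mem_nhdsWithin_of_mem_nhds (Metric.closedBall_mem_nhds _ hρ),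
        Metric.closedBall ν₂ ρ, subset_rfl, measurableSet_closedBall, Metric.closedBall ν₁ ρ,
        Metric.closedBall_mem_nhds _ hρ, measurableSet_closedBall, C, hC⟩
  obtain ⟨A', hA', -, hAB⟩ : ∃ A', S₁ ⊆ A' ∧ MeasurableSet A' ∧ CritEstimate Φ A' S₂ := by
    refine hS₁.induction_on (p := fun A => ∃ A', A ⊆ A' ∧ MeasurableSet A' ∧
      CritEstimate Φ A' S₂) ?_ ?_ ?_ ?_
    · exact ⟨∅, subset_rfl, .empty, critEstimate_empty Φ _⟩
    · rintro s t hst ⟨A', hA', h'⟩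
      exact ⟨A', hst.trans hA', h'⟩
    · rintro s t ⟨A₁, hA₁, hA₁m, h₁⟩ ⟨A₂, hA₂, hA₂m, h₂⟩
      exact ⟨A₁ ∪ A₂, Set.union_subset_union hA₁ hA₂, hA₁m.union hA₂m,
        CritEstimate.union hΦ.continuous hA₁m h₁ h₂⟩
    · intro ν₁ hν₁
      obtain ⟨B', hB', -, A', hA', hA'm, h'⟩ := hloc ν₁ hν₁
      exact ⟨A', mem_nhdsWithin_of_mem_nhds hA', A', subset_rfl, hA'm, h'.mono subset_rfl hB'⟩
  exact hAB.mono hA' subset_rfl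

end Globalize

/-! ### Complex interpolation of the bilinear estimate. -/

section PowPhase

/-- The number with the argument of `a` and the modulus `‖a‖ ^ α`. -/
noncomputable def powPhase (α a : ℂ) : ℂ :=
  if a = 0 then 0 else a / ‖a‖ * Complex.exp (Real.log ‖a‖ * α)

@[simp] lemma powPhase_zero (α : ℂ) : powPhase α 0 = 0 := by simp [powPhase]

lemma norm_powPhase (α : ℂ) {a : ℂ} (ha : a ≠ 0) : ‖powPhase α a‖ = ‖a‖ ^ α.re := by
  have h : 0 < ‖a‖ := norm_pos_iff.2 ha
  rw [powPhase, if_neg ha, norm_mul, norm_div, Complex.norm_real, norm_norm, div_self h.ne', one_mul,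
    Complex.norm_exp, Complex.re_ofReal_mul, Real.rpow_def_of_pos h]

lemma enorm_powPhase {α : ℂ} (hα : 0 < α.re) (a : ℂ) : ‖powPhase α a‖ₑ = ‖a‖ₑ ^ α.re := by
  by_cases ha : a = 0
  · simp [ha, hα]
  · rw [← ofReal_norm, norm_powPhase _ ha, ← ofReal_norm,
      ENNReal.ofReal_rpow_of_pos (norm_pos_iff.2 ha)]

@[simp] lemma powPhase_one (a : ℂ) : powPhase 1 a = a := by
  by_cases ha : a = 0
  · simp [ha]
  · have h : 0 < ‖a‖ := norm_pos_iff.2 ha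
    rw [powPhase, if_neg ha, mul_one, ← Complex.ofReal_exp, Real.exp_log h, div_mul_cancel₀]
    exact_mod_cast h.ne'

lemma differentiable_powPhase (a : ℂ) : Differentiable ℂ fun α => powPhase α a := by
  unfold powPhase
  split_ifs <;> fun_prop

lemma norm_powPhase_le {α : ℂ} {R : ℝ} (hα : |α.re| ≤ R) (a : ℂ) :
    ‖powPhase α a‖ ≤ Real.exp (|Real.log ‖a‖| * R) := by
  by_cases ha : a = 0
  · simp [ha]
  · rw [norm_powPhase _ ha, Real.rpow_def_of_pos (norm_pos_iff.2 ha)]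
    refine Real.exp_le_exp.2 ((le_abs_self _).trans ?_)
    rw [abs_mul]
    gcongr

lemma measurable_powPhase (α : ℂ) : Measurable (powPhase α) := by
  unfold powPhase
  exact Measurable.ite (measurableSet_singleton 0) measurable_const (by fun_prop)

/-- This identifies the extremal function of `L^q` duality, used with `r = q`. -/
lemma mul_conj_powPhase (r : ℝ) (a : ℂ) (hr : 0 < r) :
    (starRingEnd ℂ) (powPhase ((r - 1 : ℝ) : ℂ) a) * a = ((‖a‖ ^ r : ℝ) : ℂ) := by
  by_cases ha : a = 0
  · simp [ha, Real.zero_rpow hr.ne']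
  · have h : 0 < ‖a‖ := norm_pos_iff.2 ha
    have h' : (‖a‖ : ℂ) ≠ 0 := by exact_mod_cast h.ne'
    rw [powPhase, if_neg ha, ← Complex.ofReal_mul, ← Complex.ofReal_exp, map_mul, map_div₀,
      Complex.conj_ofReal, Complex.conj_ofReal, ← Real.rpow_def_of_pos h,
      show r = 1 + (r - 1) by ring, Real.rpow_add h, Real.rpow_one, add_sub_cancel_left]
    have h2 : (starRingEnd ℂ) a * a = ‖a‖ * ‖a‖ := by
      rw [mul_comm, Complex.mul_conj, Complex.normSq_eq_norm_sq]
      push_cast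
      ring
    push_cast
    calc (starRingEnd ℂ) a / ‖a‖ * ((‖a‖ ^ (r - 1) : ℝ) : ℂ) * a
        = ((starRingEnd ℂ) a * a) / ‖a‖ * ((‖a‖ ^ (r - 1) : ℝ) : ℂ) := by ring
      _ = _ := by
        rw [h2]
        field_simp

end PowPhase

section ThreeLines

lemma enorm_le_of_three_lines {G : ℂ → ℂ} (hG : Differentiable ℂ G) {R : ℝ}
    (hR : ∀ z : ℂ, 0 ≤ z.re → z.re ≤ 1 → ‖G z‖ ≤ R) {M₀ M₁ : ℝ≥0∞} (hM₀ : M₀ ≠ ⊤) (hM₁ : M₁ ≠ ⊤)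
    (h₀ : ∀ z : ℂ, z.re = 0 → ‖G z‖ₑ ≤ M₀) (h₁ : ∀ z : ℂ, z.re = 1 → ‖G z‖ₑ ≤ M₁)
    {θ : ℝ} (hθ : 0 ≤ θ) (hθ1 : θ ≤ 1) : ‖G θ‖ₑ ≤ M₀ ^ (1 - θ) * M₁ ^ θ := by
  have hreal : ∀ {M : ℝ≥0∞} {w : ℂ}, M ≠ ⊤ → ‖w‖ₑ ≤ M → ‖w‖ ≤ M.toReal := fun hM h => by
    rw [← toReal_enorm]
    exact ENNReal.toReal_mono hM h
  have h := Complex.HadamardThreeLines.norm_le_interp_of_mem_verticalClosedStrip' (f := G)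
    (z := (θ : ℂ)) (a := M₀.toReal) (b := M₁.toReal) (l := 0) (u := 1) one_pos
    (by simp [Complex.HadamardThreeLines.verticalClosedStrip, hθ, hθ1]) hG.diffContOnCl
    ⟨R, by
      rintro _ ⟨z, hz, rfl⟩
      exact hR z hz.1 hz.2⟩
    (fun z hz => hreal hM₀ (h₀ z hz)) (fun z hz => hreal hM₁ (h₁ z hz))
  simp only [Complex.ofReal_re, sub_zero, div_one] at h
  rw [← ofReal_norm]
  refine (ENNReal.ofReal_le_ofReal h).trans_eq ?_
  rw [ENNReal.ofReal_mul (by positivity), ENNReal.toReal_rpow, ENNReal.toReal_rpow,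
    ENNReal.ofReal_toReal (ENNReal.rpow_ne_top_of_nonneg (by linarith) hM₀),
    ENNReal.ofReal_toReal (ENNReal.rpow_ne_top_of_nonneg hθ hM₁)]

lemma integral_map_mul_eq_sum {X : Type*} [MeasurableSpace X] {μ : Measure X} {f : SimpleFunc X ℂ}
    (hf : f.FinMeasSupp μ) {φ : ℂ → ℂ} (hφ : φ 0 = 0) {k : X → ℂ} (hk : AEStronglyMeasurable k μ)
    {R : ℝ} (hR : ∀ x, ‖k x‖ ≤ R) :
    ∫ x, φ (f x) * k x ∂μ = ∑ a ∈ f.range.erase 0, φ a * ∫ x in f ⁻¹' {a}, k x ∂μ := by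
  classical
  have hpt : ∀ x, φ (f x) * k x = ∑ a ∈ f.range.erase 0, φ a * (f ⁻¹' {a}).indicator k x := by
    intro x
    by_cases hx : f x = 0
    · rw [hx, hφ, zero_mul]
      refine (Finset.sum_eq_zero fun a ha => ?_).symm
      have : x ∉ f ⁻¹' {a} := fun h => (Finset.ne_of_mem_erase ha) (by rw [← h, hx])
      rw [Set.indicator_of_notMem this, mul_zero]
    · rw [Finset.sum_eq_single (f x)]
      · rw [Set.indicator_of_mem (by simp)]
      · intro a _ ha
        rw [Set.indicator_of_notMem (fun h => ha (by rw [← h])), mul_zero]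
      · intro h
        exact absurd (Finset.mem_erase.2 ⟨hx, f.mem_range_self x⟩) h
  simp_rw [hpt]
  rw [integral_finsetSum]
  · refine Finset.sum_congr rfl fun a _ => ?_
    rw [integral_const_mul, integral_indicator (f.measurableSet_fiber a)]
  · intro a ha
    refine Integrable.const_mul ?_ _
    rw [integrable_indicator_iff (f.measurableSet_fiber a)]
    have hfin := SimpleFunc.finMeasSupp_iff.1 hf a (Finset.ne_of_mem_erase ha)
    exact IntegrableOn.of_bound hfin hk.restrict R (Filter.Eventually.of_forall hR)

end ThreeLines

section Interpolation

variable {E F : Type*} [NormedAddCommGroup E] [InnerProductSpace ℝ E] [FiniteDimensional ℝ E]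
  [MeasurableSpace E] [BorelSpace E]
  [NormedAddCommGroup F] [InnerProductSpace ℝ F] [FiniteDimensional ℝ F]
  [MeasurableSpace F] [BorelSpace F]

lemma enorm_extFun_le (Φ : E → F) (f : E → ℂ) (z : E × F) :
    ‖extFun Φ f z‖ₑ ≤ ∫⁻ ξ, ‖f ξ‖ₑ := by
  refine (enorm_integral_le_lintegral_enorm _).trans_eq ?_
  congr 1 with ξ
  rw [enorm_mul, ← ofReal_norm (phase _), norm_phase, ENNReal.ofReal_one, mul_one]

/-- The extension of an indicator function. -/
noncomputable def extSet (Φ : E → F) (A : Set E) (z : E × F) : ℂ :=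
  ∫ ξ in A, phase (inner ℝ z.1 ξ + inner ℝ z.2 (Φ ξ))

lemma stronglyMeasurable_extSet {Φ : E → F} (hΦ : Continuous Φ) (A : Set E) :
    StronglyMeasurable (extSet Φ A) := by
  have hp : Continuous fun q : (E × F) × E => phase (inner ℝ q.1.1 q.2 + inner ℝ q.1.2 (Φ q.2)) :=
    continuous_phase.comp (by fun_prop)
  exact hp.measurable.stronglyMeasurable.integral_prod_right'

lemma norm_extSet_le (Φ : E → F) (A : Set E) (z : E × F) :
    ‖extSet Φ A z‖ ≤ (volume A).toReal := by
  refine (norm_integral_le_integral_norm _).trans_eq ?_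
  simp [Measure.real]

lemma extFun_map_eq_sum {Φ : E → F} (hΦ : Continuous Φ) {f : SimpleFunc E ℂ}
    (hf : f.FinMeasSupp volume) {φ : ℂ → ℂ} (hφ : φ 0 = 0) (z : E × F) :
    extFun Φ (f.map φ) z = ∑ a ∈ f.range.erase 0, φ a * extSet Φ (f ⁻¹' {a}) z := by
  have hp : Continuous fun ξ : E => phase (inner ℝ z.1 ξ + inner ℝ z.2 (Φ ξ)) :=
    continuous_phase.comp (by fun_prop)
  exact integral_map_mul_eq_sum hf hφ hp.aestronglyMeasurable (R := 1) fun x => (norm_phase _).le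

/-- Simple functions take finitely many values, so the pairing is a finite sum of coefficients times
integrals independent of `φ` and `χ`. With complex powers for `φ` and `χ` it is therefore entire in
the exponent. -/
lemma integral_map_mul_extFun_eq_sum {Φ : E → F} (hΦ : Continuous Φ) {f g : SimpleFunc E ℂ}
    (hf : f.FinMeasSupp volume) (hg : g.FinMeasSupp volume) {h : SimpleFunc (E × F) ℂ}
    (hh : h.FinMeasSupp volume) {φ χ : ℂ → ℂ} (hφ : φ 0 = 0) (hχ : χ 0 = 0) :
    ∫ w, χ (h w) * (extFun Φ (f.map φ) w * extFun Φ (g.map φ) w) =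
      ∑ c ∈ h.range.erase 0, ∑ a ∈ f.range.erase 0, ∑ b ∈ g.range.erase 0,
        χ c * φ a * φ b * ∫ w in h ⁻¹' {c}, extSet Φ (f ⁻¹' {a}) w * extSet Φ (g ⁻¹' {b}) w := by
  have hem : ∀ A B : Set E, AEStronglyMeasurable (fun w => extSet Φ A w * extSet Φ B w) volume :=
    fun A B => ((stronglyMeasurable_extSet hΦ A).mul (stronglyMeasurable_extSet hΦ B)).aestronglyMeasurable
  have hbd : ∀ A B : Set E, ∀ w, ‖extSet Φ A w * extSet Φ B w‖ ≤
      (volume A).toReal * (volume B).toReal := fun A B w => by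
    rw [norm_mul]
    exact mul_le_mul (norm_extSet_le Φ A w) (norm_extSet_le Φ B w) (norm_nonneg _) ENNReal.toReal_nonneg
  have hprod : ∀ w, extFun Φ (f.map φ) w * extFun Φ (g.map φ) w =
      ∑ a ∈ f.range.erase 0, ∑ b ∈ g.range.erase 0, φ a * φ b *
        (extSet Φ (f ⁻¹' {a}) w * extSet Φ (g ⁻¹' {b}) w) := by
    intro w
    rw [extFun_map_eq_sum hΦ hf hφ, extFun_map_eq_sum hΦ hg hφ, Finset.sum_mul_sum]
    refine Finset.sum_congr rfl fun a _ => Finset.sum_congr rfl fun b _ => ?_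
    ring
  have hpi : ∀ A B : Set E, Integrable fun w => χ (h w) * (extSet Φ A w * extSet Φ B w) := by
    intro A B
    have h1 : Integrable (h.map χ) := SimpleFunc.integrable_iff_finMeasSupp.2 (hh.map hχ)
    exact h1.mul_bdd (hem A B) (Filter.Eventually.of_forall (hbd A B))
  have hexp : ∀ w, χ (h w) * (extFun Φ (f.map φ) w * extFun Φ (g.map φ) w) =
      ∑ a ∈ f.range.erase 0, ∑ b ∈ g.range.erase 0, φ a * φ b *
        (χ (h w) * (extSet Φ (f ⁻¹' {a}) w * extSet Φ (g ⁻¹' {b}) w)) := by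
    intro w
    rw [hprod, Finset.mul_sum]
    refine Finset.sum_congr rfl fun a _ => ?_
    rw [Finset.mul_sum]
    refine Finset.sum_congr rfl fun b _ => ?_
    ring
  simp_rw [hexp]
  rw [integral_finsetSum _ fun a _ => integrable_finsetSum _ fun b _ => (hpi _ _).const_mul _]
  rw [Finset.sum_comm' (t' := f.range.erase 0) (s' := fun _ => h.range.erase 0) (by simp [and_comm])]
  refine Finset.sum_congr rfl fun a _ => ?_
  rw [integral_finsetSum _ fun b _ => (hpi _ _).const_mul _]
  rw [Finset.sum_comm' (t' := g.range.erase 0) (s' := fun _ => h.range.erase 0) (by simp [and_comm])]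
  refine Finset.sum_congr rfl fun b _ => ?_
  rw [integral_const_mul, integral_map_mul_eq_sum hh hχ (hem _ _) (hbd _ _), Finset.mul_sum]
  refine Finset.sum_congr rfl fun c _ => ?_
  ring

lemma lintegral_enorm_rpow_ne_top {X : Type*} [MeasurableSpace X] {μ : Measure X} {f : SimpleFunc X ℂ}
    (hf : f.FinMeasSupp μ) {p : ℝ} (hp : 0 < p) : ∫⁻ x, ‖f x‖ₑ ^ p ∂μ ≠ ⊤ := by
  have h1 : (f.map fun a => ‖a‖ₑ ^ p).FinMeasSupp μ := hf.map (by simp [hp])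
  have h2 := h1.lintegral_lt_top (Filter.Eventually.of_forall fun x => by
    simp [hp.le])
  rw [← SimpleFunc.lintegral_eq_lintegral] at h2
  exact h2.ne

/-- Riesz–Thorin interpolation between `L¹ × L¹ → L^∞` and `L^p₀ × L^p₀ → L²` in dual form. -/
theorem enorm_integral_mul_extFun_le {Φ : E → F} (hΦ : Continuous Φ) {S₁ S₂ : Set E} {C : ℝ≥0}
    (hC : ∀ {f g : E → ℂ}, Measurable f → Measurable g → Integrable f → Integrable g →
      (∀ x ∉ S₁, f x = 0) → (∀ x ∉ S₂, g x = 0) →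
      ∫⁻ z : E × F, ‖extFun Φ f z * extFun Φ g z‖ₑ ^ 2 ≤
        C * ((∫⁻ x, ‖f x‖ₑ ^ critExp E F) ^ (restrExp E F + 1 / 2) *
          (∫⁻ x, ‖g x‖ₑ ^ critExp E F) ^ (restrExp E F + 1 / 2)))
    {θ p s : ℝ} (hθ : 0 ≤ θ) (hθ1 : θ ≤ 1) (hp0 : 0 < p) (hs0 : 0 < s)
    (hp : p * (1 + θ * ((critExp E F)⁻¹ - 1)) = 1) (hs : s * (1 - θ / 2) = 1)
    {f g : SimpleFunc E ℂ} (hf : f.FinMeasSupp volume) (hg : g.FinMeasSupp volume)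
    (hfS : ∀ x ∉ S₁, f x = 0) (hgS : ∀ x ∉ S₂, g x = 0)
    {h : SimpleFunc (E × F) ℂ} (hh : h.FinMeasSupp volume) :
    ‖∫ w, h w * (extFun Φ f w * extFun Φ g w)‖ₑ ≤ C ^ (θ / 2) *
      ((∫⁻ x, ‖f x‖ₑ ^ p) ^ p⁻¹ * (∫⁻ x, ‖g x‖ₑ ^ p) ^ p⁻¹) * (∫⁻ w, ‖h w‖ₑ ^ s) ^ s⁻¹ := by
  set r := (critExp E F)⁻¹ with hr
  have hr0 : 0 < r := inv_pos.2 critExp_pos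
  have hre : restrExp E F + 1 / 2 = 2 * r := by
    rw [hr, critExp, inv_inv]
    ring
  -- The exponents have real parts `p` and `s` on `Re z = 0`, putting all three functions in `L¹`.
  -- On `Re z = 1` they are `p r` and `s / 2`, matching `L^{p₀}` and `L²`; at `z = θ` both equal `1`
  -- and the original functions return.
  set α : ℂ → ℂ := fun z => (p : ℂ) * (1 + z * ((r - 1 : ℝ) : ℂ)) with hα
  set β : ℂ → ℂ := fun z => (s : ℂ) * (1 - z / 2) with hβ
  have hαre : ∀ z, (α z).re = p * (1 + z.re * (r - 1)) := by
    intro z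
    simp only [hα]
    rw [Complex.re_ofReal_mul, Complex.add_re, Complex.one_re, Complex.re_mul_ofReal]
  have hβre : ∀ z, (β z).re = s * (1 - z.re / 2) := by
    intro z
    simp only [hβ]
    rw [Complex.re_ofReal_mul, Complex.sub_re, Complex.one_re]
    congr 2
    exact Complex.div_ofNat_re z 2
  set A := ∫⁻ x, ‖f x‖ₑ ^ p with hA
  set B := ∫⁻ x, ‖g x‖ₑ ^ p with hB
  set H := ∫⁻ w, ‖h w‖ₑ ^ s with hH
  have hAt : A ≠ ⊤ := lintegral_enorm_rpow_ne_top hf hp0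
  have hBt : B ≠ ⊤ := lintegral_enorm_rpow_ne_top hg hp0
  have hHt : H ≠ ⊤ := lintegral_enorm_rpow_ne_top hh hs0
  set G : ℂ → ℂ := fun z => ∫ w, powPhase (β z) (h w) *
    (extFun Φ (f.map (powPhase (α z))) w * extFun Φ (g.map (powPhase (α z))) w) with hG
  have hGsum : ∀ z, G z = ∑ c ∈ h.range.erase 0, ∑ a ∈ f.range.erase 0, ∑ b ∈ g.range.erase 0,
      powPhase (β z) c * powPhase (α z) a * powPhase (α z) b *
        ∫ w in h ⁻¹' {c}, extSet Φ (f ⁻¹' {a}) w * extSet Φ (g ⁻¹' {b}) w := fun z =>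
    integral_map_mul_extFun_eq_sum hΦ hf hg hh (powPhase_zero _) (powPhase_zero _)
  have hαd : Differentiable ℂ α := by simp only [hα]; fun_prop
  have hβd : Differentiable ℂ β := by simp only [hβ]; fun_prop
  have hGd : Differentiable ℂ G := by
    have hG' : G = _ := funext hGsum
    rw [hG']
    refine Differentiable.fun_sum fun c _ => Differentiable.fun_sum fun a _ =>
      Differentiable.fun_sum fun b _ => ?_
    exact ((((differentiable_powPhase c).comp hβd).mul ((differentiable_powPhase a).comp hαd)).mul
      ((differentiable_powPhase b).comp hαd)).mul_const _
  -- The three lines theorem needs some bound in the strip; its size does not enter the conclusion.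
  have hGb : ∀ z : ℂ, 0 ≤ z.re → z.re ≤ 1 → ‖G z‖ ≤ ∑ c ∈ h.range.erase 0, ∑ a ∈ f.range.erase 0,
      ∑ b ∈ g.range.erase 0, Real.exp (|Real.log ‖c‖| * s) *
        Real.exp (|Real.log ‖a‖| * (p * (1 + |r - 1|))) * Real.exp (|Real.log ‖b‖| * (p * (1 + |r - 1|))) *
        ‖∫ w in h ⁻¹' {c}, extSet Φ (f ⁻¹' {a}) w * extSet Φ (g ⁻¹' {b}) w‖ := by
    intro z hz0 hz1
    have hα1 : |(α z).re| ≤ p * (1 + |r - 1|) := by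
      rw [hαre, abs_mul, abs_of_pos hp0]
      gcongr
      refine (abs_add_le _ _).trans ?_
      rw [abs_one, abs_mul, abs_of_nonneg hz0]
      gcongr
      exact mul_le_of_le_one_left (abs_nonneg _) hz1
    have hβ1 : |(β z).re| ≤ s := by
      rw [hβre, abs_mul, abs_of_pos hs0, abs_of_nonneg (by linarith)]
      exact mul_le_of_le_one_right hs0.le (by linarith)
    rw [hGsum]
    refine norm_sum_le_of_le _ fun c _ => norm_sum_le_of_le _ fun a _ => norm_sum_le_of_le _ fun b _ => ?_
    rw [norm_mul, norm_mul, norm_mul]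
    gcongr
    · exact norm_powPhase_le hβ1 c
    · exact norm_powPhase_le hα1 a
    · exact norm_powPhase_le hα1 b
  have h0 : ∀ z : ℂ, z.re = 0 → ‖G z‖ₑ ≤ A * B * H := by
    intro z hz
    have hαz : (α z).re = p := by rw [hαre, hz]; ring
    have hβz : (β z).re = s := by rw [hβre, hz]; ring
    have hef : ∀ (f : SimpleFunc E ℂ) w, ‖extFun Φ (f.map (powPhase (α z))) w‖ₑ ≤
        ∫⁻ x, ‖f x‖ₑ ^ p := by
      intro f w
      refine (enorm_extFun_le Φ _ w).trans_eq ?_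
      congr 1 with x
      rw [SimpleFunc.map_apply, enorm_powPhase (by rw [hαz]; exact hp0), hαz]
    calc ‖G z‖ₑ ≤ ∫⁻ w, ‖powPhase (β z) (h w) *
          (extFun Φ (f.map (powPhase (α z))) w * extFun Φ (g.map (powPhase (α z))) w)‖ₑ :=
          enorm_integral_le_lintegral_enorm _
      _ ≤ ∫⁻ w, ‖h w‖ₑ ^ s * (A * B) := by
          refine lintegral_mono fun w => ?_
          simp only
          rw [enorm_mul, enorm_mul, enorm_powPhase (by rw [hβz]; exact hs0), hβz]
          gcongr
          · exact hef f w
          · exact hef g w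
      _ = A * B * H := by
          rw [lintegral_mul_const' _ _ (ENNReal.mul_ne_top hAt hBt), mul_comm]
  have h1 : ∀ z : ℂ, z.re = 1 → ‖G z‖ₑ ≤ (C : ℝ≥0∞) ^ (1 / 2 : ℝ) * (A ^ r * B ^ r) * H ^ (1 / 2 : ℝ) := by
    intro z hz
    have hαz : (α z).re = p * r := by rw [hαre, hz]; ring
    have hβz : (β z).re = s / 2 := by rw [hβre, hz]; ring
    have hfz : ∀ f : SimpleFunc E ℂ, ∫⁻ x, ‖f.map (powPhase (α z)) x‖ₑ ^ critExp E F =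
        ∫⁻ x, ‖f x‖ₑ ^ p := by
      intro f
      congr 1 with x
      rw [SimpleFunc.map_apply, enorm_powPhase (by rw [hαz]; positivity), hαz, ← ENNReal.rpow_mul,
        mul_assoc, hr, inv_mul_cancel₀ critExp_pos.ne', mul_one]
    have hint : ∀ {f : SimpleFunc E ℂ}, f.FinMeasSupp volume →
        Integrable (f.map (powPhase (α z))) := fun hf =>
      SimpleFunc.integrable_iff_finMeasSupp.2 (hf.map (powPhase_zero _))
    have hL2 := hC (f.map (powPhase (α z))).measurable (g.map (powPhase (α z))).measurable
      (hint hf) (hint hg) (fun x hx => by rw [SimpleFunc.map_apply, hfS x hx, powPhase_zero])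
      (fun x hx => by rw [SimpleFunc.map_apply, hgS x hx, powPhase_zero])
    rw [hfz, hfz, hre] at hL2
    have hm1 : Measurable fun w => ‖powPhase (β z) (h w)‖ₑ :=
      ((measurable_powPhase _).comp h.measurable).enorm
    have hm2 : Measurable fun w => ‖extFun Φ (f.map (powPhase (α z))) w *
        extFun Φ (g.map (powPhase (α z))) w‖ₑ :=
      ((stronglyMeasurable_extFun hΦ (SimpleFunc.measurable _)).measurable.mul
        (stronglyMeasurable_extFun hΦ (SimpleFunc.measurable _)).measurable).enorm
    calc ‖G z‖ₑ ≤ ∫⁻ w, ‖powPhase (β z) (h w) *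
          (extFun Φ (f.map (powPhase (α z))) w * extFun Φ (g.map (powPhase (α z))) w)‖ₑ :=
          enorm_integral_le_lintegral_enorm _
      _ = ∫⁻ w, ((fun w => ‖powPhase (β z) (h w)‖ₑ) * fun w =>
          ‖extFun Φ (f.map (powPhase (α z))) w * extFun Φ (g.map (powPhase (α z))) w‖ₑ) w := by
          congr 1 with w
          rw [enorm_mul, Pi.mul_apply]
      _ ≤ (∫⁻ w, ‖powPhase (β z) (h w)‖ₑ ^ (2 : ℝ)) ^ (1 / 2 : ℝ) *
          (∫⁻ w, ‖extFun Φ (f.map (powPhase (α z))) w *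
            extFun Φ (g.map (powPhase (α z))) w‖ₑ ^ (2 : ℝ)) ^ (1 / 2 : ℝ) :=
          ENNReal.lintegral_mul_le_Lp_mul_Lq _ Real.HolderConjugate.two_two hm1.aemeasurable
            hm2.aemeasurable
      _ ≤ H ^ (1 / 2 : ℝ) * (C * (A ^ (2 * r) * B ^ (2 * r))) ^ (1 / 2 : ℝ) := by
          gcongr
          · refine le_of_eq ?_
            rw [hH]
            congr 1 with w
            rw [enorm_powPhase (by rw [hβz]; positivity), hβz, ← ENNReal.rpow_mul]
            congr 1
            ring
          · simp_rw [ENNReal.rpow_two]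
            exact hL2
      _ = _ := by
          rw [ENNReal.mul_rpow_of_nonneg _ _ (by norm_num), ENNReal.mul_rpow_of_nonneg _ _ (by norm_num),
            ← ENNReal.rpow_mul, ← ENNReal.rpow_mul, show 2 * r * (1 / 2) = r by ring, mul_comm]
  have hM0 : A * B * H ≠ ⊤ := ENNReal.mul_ne_top (ENNReal.mul_ne_top hAt hBt) hHt
  have hM1 : (C : ℝ≥0∞) ^ (1 / 2 : ℝ) * (A ^ r * B ^ r) * H ^ (1 / 2 : ℝ) ≠ ⊤ := by
    refine ENNReal.mul_ne_top (ENNReal.mul_ne_top ?_ (ENNReal.mul_ne_top ?_ ?_)) ?_ <;>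
      exact ENNReal.rpow_ne_top_of_nonneg (by positivity) (by first | assumption | exact ENNReal.coe_ne_top)
  have hmain := enorm_le_of_three_lines hGd hGb hM0 hM1 h0 h1 hθ hθ1
  have hαθ : α θ = 1 := by
    simp only [hα]
    rw [← Complex.ofReal_mul, ← Complex.ofReal_one, ← Complex.ofReal_add, ← Complex.ofReal_mul, hp]
  have hβθ : β θ = 1 := by
    simp only [hβ]
    have h2 : ((s * (1 - θ / 2) : ℝ) : ℂ) = 1 := by rw [hs, Complex.ofReal_one]
    push_cast at h2
    exact h2
  have hGθ : G θ = ∫ w, h w * (extFun Φ f w * extFun Φ g w) := by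
    have hmap : ∀ f : SimpleFunc E ℂ, ⇑(f.map (powPhase 1)) = f := fun f => by
      ext x
      rw [SimpleFunc.map_apply, powPhase_one]
    simp only [hG, hαθ, hβθ, powPhase_one, hmap]
  rw [hGθ] at hmain
  refine hmain.trans_eq ?_
  have hpinv : (1 - θ) + r * θ = p⁻¹ := by
    refine eq_inv_of_mul_eq_one_left ?_
    linear_combination hp
  have hsinv : (1 - θ) + 1 / 2 * θ = s⁻¹ := by
    refine eq_inv_of_mul_eq_one_left ?_
    linear_combination hs
  have hθ' : 0 ≤ 1 - θ := by linarith
  have hmul : ∀ x y : ℝ≥0∞, (x * y) ^ (1 - θ) = x ^ (1 - θ) * y ^ (1 - θ) := fun x y =>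
    ENNReal.mul_rpow_of_nonneg _ _ hθ'
  have hmul' : ∀ x y : ℝ≥0∞, (x * y) ^ θ = x ^ θ * y ^ θ := fun x y =>
    ENNReal.mul_rpow_of_nonneg _ _ hθ
  rw [← hpinv, ← hsinv, ENNReal.rpow_add_of_nonneg _ _ hθ' (by positivity),
    ENNReal.rpow_add_of_nonneg _ _ hθ' (by positivity),
    ENNReal.rpow_add_of_nonneg _ _ hθ' (by positivity), hmul, hmul, hmul', hmul', hmul',
    ← ENNReal.rpow_mul, ← ENNReal.rpow_mul, ← ENNReal.rpow_mul, ← ENNReal.rpow_mul,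
    show 1 / 2 * θ = θ / 2 by ring]
  ring

end Interpolation

/-! ### Recovering the L^q norm from pairings with simple functions. -/

section Duality

variable {W : Type*} [MeasurableSpace W] {μ : Measure W}

/-- The canonical approximation of a measurable function by simple functions. -/
noncomputable def simpleApprox {v : W → ℂ} (hv : Measurable v) (n : ℕ) : SimpleFunc W ℂ :=
  SimpleFunc.approxOn v hv Set.univ 0 (Set.mem_univ _) n

lemma tendsto_simpleApprox {v : W → ℂ} (hv : Measurable v) (w : W) :
    Filter.Tendsto (fun n => simpleApprox hv n w) Filter.atTop (nhds (v w)) :=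
  SimpleFunc.tendsto_approxOn hv (Set.mem_univ _) (by simp)

lemma norm_simpleApprox_le {v : W → ℂ} (hv : Measurable v) (n : ℕ) (w : W) :
    ‖simpleApprox hv n w‖ ≤ 2 * ‖v w‖ := by
  rw [two_mul]
  exact SimpleFunc.norm_approxOn_zero_le hv (Set.mem_univ _) w n

lemma enorm_simpleApprox_le {v : W → ℂ} (hv : Measurable v) (n : ℕ) (w : W) :
    ‖simpleApprox hv n w‖ₑ ≤ 2 * ‖v w‖ₑ := by
  rw [← ofReal_norm, ← ofReal_norm, ← ENNReal.ofReal_ofNat 2, ← ENNReal.ofReal_mul (by norm_num)]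
  exact ENNReal.ofReal_le_ofReal (norm_simpleApprox_le hv n w)

lemma simpleApprox_eq_zero {v : W → ℂ} (hv : Measurable v) (n : ℕ) {w : W} (hw : v w = 0) :
    simpleApprox hv n w = 0 := by
  have h := norm_simpleApprox_le hv n w
  rw [hw, norm_zero, mul_zero] at h
  exact norm_le_zero_iff.1 h

lemma finMeasSupp_simpleApprox {v : W → ℂ} (hv : Measurable v) (n : ℕ) {K : Set W} (hK : μ K < ⊤)
    (hvK : ∀ w ∉ K, v w = 0) : (simpleApprox hv n).FinMeasSupp μ := by
  rw [SimpleFunc.finMeasSupp_iff_support]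
  refine (measure_mono fun w hw => ?_).trans_lt hK
  by_contra hwK
  exact hw (simpleApprox_eq_zero hv n (hvK w hwK))

/-- Test against the extremal function `v`, whose product with `u` is `|u| ^ q` on `K`. Boundedness
of `u` and finiteness of `μ K` make the left side finite in advance, so it can be divided out. The
simple approximations converge in both norms, hence no constant is lost. -/
theorem setLIntegral_rpow_le_of_forall_simpleFunc {u : W → ℂ} (hu : Measurable u) {R : ℝ}
    (hR : ∀ w, ‖u w‖ ≤ R) {q s : ℝ} (hqs : q.HolderConjugate s) {M : ℝ≥0∞}
    (H : ∀ h : SimpleFunc W ℂ, h.FinMeasSupp μ →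
      ‖∫ w, h w * u w ∂μ‖ₑ ≤ M * (∫⁻ w, ‖h w‖ₑ ^ s ∂μ) ^ s⁻¹)
    {K : Set W} (hK : MeasurableSet K) (hKt : μ K < ⊤) :
    (∫⁻ w in K, ‖u w‖ₑ ^ q ∂μ) ^ q⁻¹ ≤ M := by
  rcases eq_or_ne M ⊤ with rfl | hM
  · exact le_top
  rcases isEmpty_or_nonempty W with hW | ⟨⟨w₀⟩⟩
  · have : μ = 0 := Measure.eq_zero_of_isEmpty μ
    simp [this, hqs.pos]
  have hR0 : 0 ≤ R := (norm_nonneg _).trans (hR w₀)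
  have hq1 : 0 < q - 1 := hqs.sub_one_pos
  set v : W → ℂ := K.indicator fun w => (starRingEnd ℂ) (powPhase ((q - 1 : ℝ) : ℂ) (u w)) with hv
  have hvm : Measurable v :=
    (Complex.continuous_conj.measurable.comp ((measurable_powPhase _).comp hu)).indicator hK
  have hvK : ∀ w ∉ K, v w = 0 := fun w hw => Set.indicator_of_notMem hw _
  have hve : ∀ w, ‖v w‖ₑ = K.indicator (fun w => ‖u w‖ₑ ^ (q - 1)) w := by
    intro w
    by_cases hw : w ∈ K
    · simp only [hv]
      rw [Set.indicator_of_mem hw, Set.indicator_of_mem hw, RCLike.enorm_conj,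
        enorm_powPhase (by rwa [Complex.ofReal_re]), Complex.ofReal_re]
    · rw [hvK w hw, Set.indicator_of_notMem hw, enorm_zero]
  have hvs : ∀ w, ‖v w‖ₑ ^ s = K.indicator (fun w => ‖u w‖ₑ ^ q) w := by
    intro w
    rw [hve]
    by_cases hw : w ∈ K
    · rw [Set.indicator_of_mem hw, Set.indicator_of_mem hw, ← ENNReal.rpow_mul, hqs.sub_one_mul_conj]
    · rw [Set.indicator_of_notMem hw, Set.indicator_of_notMem hw, ENNReal.zero_rpow_of_pos hqs.symm.pos]
  have hvu : ∀ w, v w * u w = K.indicator (fun w => ((‖u w‖ ^ q : ℝ) : ℂ)) w := by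
    intro w
    by_cases hw : w ∈ K
    · simp only [hv]
      rw [Set.indicator_of_mem hw, Set.indicator_of_mem hw, mul_conj_powPhase _ _ hqs.pos]
    · rw [hvK w hw, Set.indicator_of_notMem hw, zero_mul]
  have hub : ∀ w, ‖u w‖ₑ ≤ ENNReal.ofReal R := fun w => by
    rw [← ofReal_norm]
    exact ENNReal.ofReal_le_ofReal (hR w)
  set X := ∫⁻ w in K, ‖u w‖ₑ ^ q ∂μ with hX
  have hXt : X ≠ ⊤ := by
    refine ne_top_of_le_ne_top ?_ (setLIntegral_mono' hK (g := fun _ => ENNReal.ofReal R ^ q)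
      fun w _ => ENNReal.rpow_le_rpow (hub w) hqs.pos.le)
    rw [setLIntegral_const]
    exact ENNReal.mul_ne_top (ENNReal.rpow_ne_top_of_nonneg hqs.pos.le ENNReal.ofReal_ne_top) hKt.ne
  have hXv : ∫⁻ w, ‖v w‖ₑ ^ s ∂μ = X := by
    simp_rw [hvs]
    exact lintegral_indicator hK _
  have hvi : Integrable v μ := by
    have hfin : ∀ w, ‖v w‖ ≤ K.indicator (fun _ => R ^ (q - 1)) w := by
      intro w
      by_cases hw : w ∈ K
      · rw [Set.indicator_of_mem hw]
        have h1 : ENNReal.ofReal ‖v w‖ ≤ ENNReal.ofReal (R ^ (q - 1)) := by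
          rw [ofReal_norm, hve, Set.indicator_of_mem hw, ← ENNReal.ofReal_rpow_of_nonneg hR0 hq1.le]
          exact ENNReal.rpow_le_rpow (hub w) hq1.le
        exact (ENNReal.ofReal_le_ofReal_iff (by positivity)).1 h1
      · rw [hvK w hw, norm_zero, Set.indicator_of_notMem hw]
    refine Integrable.mono' ?_ hvm.aestronglyMeasurable (Filter.Eventually.of_forall hfin)
    rw [integrable_indicator_iff hK]
    exact integrableOn_const hKt.ne
  have hmain : ‖∫ w, v w * u w ∂μ‖ₑ ≤ M * X ^ s⁻¹ := by
    have l1 : Filter.Tendsto (fun n => ‖∫ w, simpleApprox hvm n w * u w ∂μ‖ₑ) Filter.atTop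
        (nhds ‖∫ w, v w * u w ∂μ‖ₑ) := by
      refine (continuous_enorm.tendsto _).comp ?_
      refine tendsto_integral_of_dominated_convergence (fun w => 2 * ‖v w‖ * R)
        (fun n => ((simpleApprox hvm n).measurable.mul hu).aestronglyMeasurable)
        ((hvi.norm.const_mul 2).mul_const R) (fun n => Filter.Eventually.of_forall fun w => ?_)
        (Filter.Eventually.of_forall fun w => (tendsto_simpleApprox hvm w).mul_const _)
      rw [norm_mul]
      exact mul_le_mul (norm_simpleApprox_le hvm n w) (hR w) (norm_nonneg _) (by positivity)
    have l2 : Filter.Tendsto (fun n => ∫⁻ w, ‖simpleApprox hvm n w‖ₑ ^ s ∂μ) Filter.atTop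
        (nhds (∫⁻ w, ‖v w‖ₑ ^ s ∂μ)) := by
      refine tendsto_lintegral_of_dominated_convergence (fun w => 2 ^ s * ‖v w‖ₑ ^ s)
        (fun n => (simpleApprox hvm n).measurable.enorm.pow_const _)
        (fun n => Filter.Eventually.of_forall fun w => ?_) ?_
        (Filter.Eventually.of_forall fun w => ?_)
      · simp only
        rw [← ENNReal.mul_rpow_of_nonneg _ _ hqs.symm.pos.le]
        exact ENNReal.rpow_le_rpow (enorm_simpleApprox_le hvm n w) hqs.symm.pos.le
      · rw [lintegral_const_mul' _ _ (by finiteness), hXv]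
        exact ENNReal.mul_ne_top (by finiteness) hXt
      · exact ((ENNReal.continuous_rpow_const.comp continuous_enorm).tendsto _).comp
          (tendsto_simpleApprox hvm w)
    rw [hXv] at l2
    have l3 := ENNReal.Tendsto.const_mul (a := M)
      (((ENNReal.continuous_rpow_const (y := s⁻¹)).tendsto _).comp l2) (Or.inr hM)
    exact le_of_tendsto_of_tendsto' l1 l3 fun n => H _ (finMeasSupp_simpleApprox hvm n hKt hvK)
  have hlhs : ‖∫ w, v w * u w ∂μ‖ₑ = X := by
    simp_rw [hvu]
    rw [integral_indicator hK, integral_complex_ofReal, ← ofReal_norm, Complex.norm_real,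
      Real.norm_of_nonneg (integral_nonneg fun w => by positivity),
      ofReal_integral_eq_lintegral_ofReal]
    · rw [hX]
      congr 1 with w
      rw [← ENNReal.ofReal_rpow_of_nonneg (norm_nonneg _) hqs.pos.le, ofReal_norm]
    · refine IntegrableOn.of_bound hKt
        (hu.norm.pow_const q).aestronglyMeasurable (R ^ q) (Filter.Eventually.of_forall fun w => ?_)
      rw [Real.norm_of_nonneg (by positivity)]
      exact Real.rpow_le_rpow (norm_nonneg _) (hR w) hqs.pos.le
    · exact Filter.Eventually.of_forall fun w => by positivity
  rw [hlhs] at hmain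
  -- The inequality now reads `X ≤ M * X ^ s⁻¹`; cancelling `X ^ s⁻¹` requires `0 < X < ∞`.
  rcases eq_or_ne X 0 with h0 | h0
  · rw [h0, ENNReal.zero_rpow_of_pos (inv_pos.2 hqs.pos)]
    exact zero_le
  · have hsplit : X ^ q⁻¹ * X ^ s⁻¹ = X := by
      rw [← ENNReal.rpow_add _ _ h0 hXt, hqs.inv_add_inv_eq_one, ENNReal.rpow_one]
    have hs0 : X ^ s⁻¹ ≠ 0 := (ENNReal.rpow_pos (pos_iff_ne_zero.2 h0) hXt).ne'
    have hst : X ^ s⁻¹ ≠ ⊤ := ENNReal.rpow_ne_top_of_nonneg (inv_nonneg.2 hqs.symm.pos.le) hXt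
    rw [← ENNReal.mul_le_mul_iff_left hs0 hst, hsplit]
    exact hmain

/-- The `L^q` norm of a bounded function is controlled by pairing with simple functions. -/
theorem lintegral_rpow_le_of_forall_simpleFunc [SigmaFinite μ] {u : W → ℂ} (hu : Measurable u) {R : ℝ}
    (hR : ∀ w, ‖u w‖ ≤ R) {q s : ℝ} (hqs : q.HolderConjugate s) {M : ℝ≥0∞}
    (H : ∀ h : SimpleFunc W ℂ, h.FinMeasSupp μ →
      ‖∫ w, h w * u w ∂μ‖ₑ ≤ M * (∫⁻ w, ‖h w‖ₑ ^ s ∂μ) ^ s⁻¹) :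
    (∫⁻ w, ‖u w‖ₑ ^ q ∂μ) ^ q⁻¹ ≤ M := by
  have h1 : ∫⁻ w, ‖u w‖ₑ ^ q ∂μ = ⨆ n, ∫⁻ w in spanningSets μ n, ‖u w‖ₑ ^ q ∂μ := by
    rw [← setLIntegral_univ, ← iUnion_spanningSets μ]
    exact setLIntegral_iUnion_of_directed _ (monotone_spanningSets μ).directed_le
  rw [h1, ENNReal.rpow_inv_le_iff hqs.pos]
  refine iSup_le fun n => ?_
  rw [← ENNReal.rpow_inv_le_iff hqs.pos]
  exact setLIntegral_rpow_le_of_forall_simpleFunc hu hR hqs H (measurableSet_spanningSets μ n)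
    (measure_spanningSets_lt_top μ n)

end Duality

/-! ### The interpolated estimate for general functions. -/

section Extension

variable {E F : Type*} [NormedAddCommGroup E] [InnerProductSpace ℝ E] [FiniteDimensional ℝ E]
  [MeasurableSpace E] [BorelSpace E]
  [NormedAddCommGroup F] [InnerProductSpace ℝ F] [FiniteDimensional ℝ F]
  [MeasurableSpace F] [BorelSpace F]

/-- The interpolated estimate on the critical line. -/
theorem CritEstimate.exists_lintegral_rpow_le {Φ : E → F} (hΦ : Continuous Φ) {S₁ S₂ : Set E}
    (hS₁ : volume S₁ < ⊤) (hS₂ : volume S₂ < ⊤) (hcrit : CritEstimate Φ S₁ S₂) {p q : ℝ} (hq : 2 ≤ q)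
    (hp0 : 0 < p) (hp : p⁻¹ = 1 + 2 / q * ((critExp E F)⁻¹ - 1)) :
    ∃ C : ℝ≥0, ∀ {f g : E → ℂ}, Measurable f → Measurable g → Integrable f → Integrable g →
      (∀ x ∉ S₁, f x = 0) → (∀ x ∉ S₂, g x = 0) →
      (∫⁻ z : E × F, ‖extFun Φ f z * extFun Φ g z‖ₑ ^ q) ^ q⁻¹ ≤
        C * ((∫⁻ x, ‖f x‖ₑ ^ p) ^ p⁻¹ * (∫⁻ x, ‖g x‖ₑ ^ p) ^ p⁻¹) := by
  obtain ⟨C, hC⟩ := hcrit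
  have hq0 : 0 < q := by linarith
  have hqs : q.HolderConjugate (q / (q - 1)) := Real.HolderConjugate.conjExponent (by linarith)
  set s := q / (q - 1) with hs
  -- The interpolation parameter is `θ = 2 / q`, and `q ≥ 2` is what makes `θ ≤ 1`.
  have hs1 : s * (1 - 2 / q / 2) = 1 := by
    have : q - 1 ≠ 0 := by linarith
    rw [hs]
    field_simp
  have hsimple : ∀ {f g : SimpleFunc E ℂ}, f.FinMeasSupp volume → g.FinMeasSupp volume →
      (∀ x ∉ S₁, f x = 0) → (∀ x ∉ S₂, g x = 0) →
      (∫⁻ z : E × F, ‖extFun Φ f z * extFun Φ g z‖ₑ ^ q) ^ q⁻¹ ≤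
        C ^ (2 / q / 2) * ((∫⁻ x, ‖f x‖ₑ ^ p) ^ p⁻¹ * (∫⁻ x, ‖g x‖ₑ ^ p) ^ p⁻¹) := by
    intro f g hf hg hfS hgS
    have hbd : ∀ {f : SimpleFunc E ℂ}, f.FinMeasSupp volume → ∀ z : E × F,
        ‖extFun Φ f z‖ ≤ (∫⁻ ξ, ‖f ξ‖ₑ).toReal := by
      intro f hf z
      rw [← toReal_enorm]
      exact ENNReal.toReal_mono (SimpleFunc.integrable_iff_finMeasSupp.2 hf).2.ne
        (enorm_extFun_le Φ f z)
    refine lintegral_rpow_le_of_forall_simpleFunc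
      ((stronglyMeasurable_extFun hΦ f.measurable).measurable.mul
        (stronglyMeasurable_extFun hΦ g.measurable).measurable)
      (R := (∫⁻ ξ, ‖f ξ‖ₑ).toReal * (∫⁻ ξ, ‖g ξ‖ₑ).toReal) (fun z => ?_) hqs fun h hh => ?_
    · rw [Pi.mul_apply, norm_mul]
      exact mul_le_mul (hbd hf z) (hbd hg z) (norm_nonneg _) ENNReal.toReal_nonneg
    · refine enorm_integral_mul_extFun_le hΦ hC (by positivity) ?_ hp0 hqs.symm.pos ?_ hs1 hf hg hfS
        hgS hh
      · rw [div_le_one hq0]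
        exact hq
      · rw [← hp, mul_inv_cancel₀ hp0.ne']
  -- The simple approximations are dominated by twice the function, so `f` and `g` cost a factor `2`
  -- each in passing to the limit by Fatou.
  refine ⟨4 * C ^ (2 / q / 2), fun {f g} hf hg hfi hgi hfS hgS => ?_⟩
  have htend : ∀ {f : E → ℂ} (hf : Measurable f), Integrable f → ∀ z : E × F,
      Filter.Tendsto (fun n => extFun Φ (simpleApprox hf n) z) Filter.atTop
        (nhds (extFun Φ f z)) := by
    intro f hf hfi z
    have hp : Continuous fun ξ : E => phase (inner ℝ z.1 ξ + inner ℝ z.2 (Φ ξ)) :=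
      continuous_phase.comp (by fun_prop)
    refine tendsto_integral_of_dominated_convergence (fun ξ => 2 * ‖f ξ‖)
      (fun n => ((simpleApprox hf n).measurable.mul hp.measurable).aestronglyMeasurable)
      (hfi.norm.const_mul 2) (fun n => Filter.Eventually.of_forall fun ξ => ?_)
      (Filter.Eventually.of_forall fun ξ => (tendsto_simpleApprox hf ξ).mul_const _)
    rw [norm_mul, norm_phase, mul_one]
    exact norm_simpleApprox_le hf n ξ
  have hnorm : ∀ {f : E → ℂ} (hf : Measurable f) (n : ℕ),
      (∫⁻ x, ‖simpleApprox hf n x‖ₑ ^ p) ^ p⁻¹ ≤ 2 * (∫⁻ x, ‖f x‖ₑ ^ p) ^ p⁻¹ := by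
    intro f hf n
    calc (∫⁻ x, ‖simpleApprox hf n x‖ₑ ^ p) ^ p⁻¹ ≤ (∫⁻ x, 2 ^ p * ‖f x‖ₑ ^ p) ^ p⁻¹ := by
          gcongr with x
          rw [← ENNReal.mul_rpow_of_nonneg _ _ hp0.le]
          exact ENNReal.rpow_le_rpow (enorm_simpleApprox_le hf n x) hp0.le
      _ = 2 * (∫⁻ x, ‖f x‖ₑ ^ p) ^ p⁻¹ := by
          rw [lintegral_const_mul' _ _ (by finiteness), ENNReal.mul_rpow_of_nonneg _ _ (by positivity),
            ← ENNReal.rpow_mul, mul_inv_cancel₀ hp0.ne', ENNReal.rpow_one]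
  rw [ENNReal.rpow_inv_le_iff hq0]
  have hlim : ∀ z : E × F, Filter.liminf (fun n => ‖extFun Φ (simpleApprox hf n) z *
      extFun Φ (simpleApprox hg n) z‖ₑ ^ q) Filter.atTop = ‖extFun Φ f z * extFun Φ g z‖ₑ ^ q := by
    intro z
    refine Filter.Tendsto.liminf_eq ?_
    exact ((ENNReal.continuous_rpow_const.comp continuous_enorm).tendsto _).comp
      ((htend hf hfi z).mul (htend hg hgi z))
  simp_rw [← hlim]
  refine (lintegral_liminf_le fun n => ?_).trans ?_
  · have h1 := (stronglyMeasurable_extFun hΦ (simpleApprox hf n).measurable).measurable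
    have h2 := (stronglyMeasurable_extFun hΦ (simpleApprox hg n).measurable).measurable
    fun_prop
  · refine Filter.liminf_le_of_frequently_le' (Filter.Frequently.of_forall fun n => ?_)
    rw [← ENNReal.rpow_inv_le_iff hq0]
    refine (hsimple (finMeasSupp_simpleApprox hf n hS₁ hfS) (finMeasSupp_simpleApprox hg n hS₂ hgS)
      (fun x hx => simpleApprox_eq_zero hf n (hfS x hx))
      (fun x hx => simpleApprox_eq_zero hg n (hgS x hx))).trans ?_
    calc (C : ℝ≥0∞) ^ (2 / q / 2) * ((∫⁻ x, ‖simpleApprox hf n x‖ₑ ^ p) ^ p⁻¹ *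
          (∫⁻ x, ‖simpleApprox hg n x‖ₑ ^ p) ^ p⁻¹)
        ≤ (C : ℝ≥0∞) ^ (2 / q / 2) * ((2 * (∫⁻ x, ‖f x‖ₑ ^ p) ^ p⁻¹) *
          (2 * (∫⁻ x, ‖g x‖ₑ ^ p) ^ p⁻¹)) := by
          gcongr
          · exact hnorm hf n
          · exact hnorm hg n
      _ = _ := by
          push_cast
          rw [ENNReal.coe_rpow_of_nonneg _ (by positivity)]
          ring

end Extension

/-! ### Matrices, coordinates and smooth extension of Φ. -/

section Coordinates

lemma Nondegenerate.neg {E F : Type*} [NormedAddCommGroup E] [InnerProductSpace ℝ E]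
    [FiniteDimensional ℝ E] [MeasurableSpace E] [BorelSpace E]
    [NormedAddCommGroup F] [InnerProductSpace ℝ F] [FiniteDimensional ℝ F]
    [MeasurableSpace F] [BorelSpace F] {D : E →L[ℝ] F}
    {H : E →L[ℝ] E →L[ℝ] F} (h : Nondegenerate D H) : Nondegenerate (-D) H := by
  intro σ hσ τ w hw hv
  have h1 := h σ hσ (-τ) w (by simpa using hw) fun v => by
    have := hv v
    rwa [neg_apply, inner_neg_right, ← inner_neg_left] at this
  exact ⟨neg_eq_zero.1 h1.1, h1.2⟩

lemma apply_eq_sum_single {d : ℕ} {G : Type*} [NormedAddCommGroup G] [NormedSpace ℝ G]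
    (L : EuclideanSpace ℝ (Fin d) →L[ℝ] G) (w : EuclideanSpace ℝ (Fin d)) :
    L w = ∑ j, w j • L (EuclideanSpace.single j 1) := by
  conv_lhs => rw [← (EuclideanSpace.basisFun (Fin d) ℝ).sum_repr w]
  simp [map_sum]

/-- The two equations of `Nondegenerate`, tested on basis vectors, say that `(τ, w)` lies in the
kernel of the bordered matrix. -/
lemma nondegenerate_of_det_ne_zero {d k : ℕ}
    {D : EuclideanSpace ℝ (Fin d) →L[ℝ] EuclideanSpace ℝ (Fin k)}
    {H : EuclideanSpace ℝ (Fin d) →L[ℝ] EuclideanSpace ℝ (Fin d) →L[ℝ] EuclideanSpace ℝ (Fin k)}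
    {A : Matrix (Fin k) (Fin d) ℝ} {B : Fin k → Matrix (Fin d) (Fin d) ℝ}
    (hA : ∀ i j, A i j = D (EuclideanSpace.single j 1) i)
    (hB : ∀ i a b, B i a b = H (EuclideanSpace.single a 1) (EuclideanSpace.single b 1) i)
    (hdet : ∀ σ : EuclideanSpace ℝ (Fin k), ‖σ‖ = 1 →
      (Matrix.fromBlocks 0 A Aᵀ (∑ i, σ i • B i)).det ≠ 0) : Nondegenerate D H := by
  intro σ hσ τ w hw hv
  have hD : ∀ w i, D w i = ∑ j, A i j * w j := by
    intro w i
    rw [apply_eq_sum_single D w]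
    simp [hA, mul_comm]
  have hH : ∀ a w i, H (EuclideanSpace.single a 1) w i = ∑ b, B i a b * w b := by
    intro a w i
    rw [apply_eq_sum_single (H _) w]
    simp [hB, mul_comm]
  have hzero : (Matrix.fromBlocks 0 A Aᵀ (∑ i, σ i • B i)) *ᵥ Sum.elim τ w = 0 := by
    rw [Matrix.fromBlocks_mulVec]
    ext x
    rcases x with i | a
    · have h1 : D w i = 0 := by rw [hw]; rfl
      rw [hD] at h1
      simpa [Matrix.mulVec, dotProduct] using h1
    · have h2 := hv (EuclideanSpace.single a 1)
      rw [PiLp.inner_apply, PiLp.inner_apply] at h2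
      simp only [hH, hD] at h2
      simp only [Matrix.mulVec, dotProduct, Sum.elim_inr, Sum.elim_comp_inl, Sum.elim_comp_inr,
        Pi.add_apply, Pi.zero_apply, Matrix.transpose_apply, Matrix.sum_apply, Matrix.smul_apply,
        smul_eq_mul]
      rw [← h2]
      congr 1
      · refine Finset.sum_congr rfl fun i _ => ?_
        simp
      · simp_rw [Finset.sum_mul]
        rw [Finset.sum_comm]
        refine Finset.sum_congr rfl fun i _ => ?_
        simp only [RCLike.inner_apply, conj_trivial, Finset.sum_mul]
        refine Finset.sum_congr rfl fun b _ => ?_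
        ring
  have h0 := Matrix.eq_zero_of_mulVec_eq_zero (hdet σ hσ) hzero
  constructor
  · ext i
    exact congrFun h0 (Sum.inl i)
  · ext a
    exact congrFun h0 (Sum.inr a)

variable {d k : ℕ} {Φ Ψ : EuclideanSpace ℝ (Fin d) → EuclideanSpace ℝ (Fin k)}
  {ν : EuclideanSpace ℝ (Fin d)}

lemma partialDeriv_eq (hΨ : ContDiff ℝ ∞ Ψ) (h : Φ =ᶠ[nhds ν] Ψ) (i : Fin k) (j : Fin d) :
    partialDeriv (fun ξ => Φ ξ i) j ν = fderiv ℝ Ψ ν (EuclideanSpace.single j 1) i := by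
  have h1 : (fun ξ => Φ ξ i) =ᶠ[nhds ν] fun ξ => Ψ ξ i := h.fun_comp fun y => y i
  have h2 : HasFDerivAt (fun ξ => Ψ ξ i) ((EuclideanSpace.proj i).comp (fderiv ℝ Ψ ν)) ν :=
    (EuclideanSpace.proj (𝕜 := ℝ) i).hasFDerivAt.comp ν (hΨ.differentiable (by simp) ν).hasFDerivAt
  rw [partialDeriv, h1.fderiv_eq, h2.fderiv]
  rfl

/-- Agreement of `Φ` and `Ψ` in a neighbourhood is essential, also at boundary points of the cube:
the first partial derivatives must agree near `ν` before they are differentiated again. -/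
lemma hessian_eq (hΨ : ContDiff ℝ ∞ Ψ) (h : Φ =ᶠ[nhds ν] Ψ) (i : Fin k) (a b : Fin d) :
    hessian (fun ξ => Φ ξ i) ν a b =
      fderiv ℝ (fderiv ℝ Ψ) ν (EuclideanSpace.single a 1) (EuclideanSpace.single b 1) i := by
  have h1 : partialDeriv (fun ξ => Φ ξ i) b =ᶠ[nhds ν]
      fun ξ => fderiv ℝ Ψ ξ (EuclideanSpace.single b 1) i :=
    h.eventuallyEq_nhds.mono fun ξ hξ => partialDeriv_eq hΨ hξ i b
  have hd : Differentiable ℝ (fderiv ℝ Ψ) :=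
    (hΨ.fderiv_right (m := ∞) (by simp)).differentiable (by simp)
  have h2 : HasFDerivAt (fun ξ => fderiv ℝ Ψ ξ (EuclideanSpace.single b 1) i)
      ((EuclideanSpace.proj i).comp ((ContinuousLinearMap.apply ℝ (EuclideanSpace ℝ (Fin k))
        (EuclideanSpace.single b (1 : ℝ))).comp (fderiv ℝ (fderiv ℝ Ψ) ν))) ν :=
    (EuclideanSpace.proj (𝕜 := ℝ) i).hasFDerivAt.comp ν
      ((ContinuousLinearMap.apply ℝ (EuclideanSpace ℝ (Fin k))
        (EuclideanSpace.single b (1 : ℝ))).hasFDerivAt.comp ν (hd ν).hasFDerivAt)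
  rw [hessian, Matrix.of_apply]
  nth_rewrite 1 [partialDeriv]
  rw [h1.fderiv_eq, h2.fderiv]
  rfl

lemma nondegenerate_of_borderedMatrix (hΨ : ContDiff ℝ ∞ Ψ) {ν₁ ν₂ : EuclideanSpace ℝ (Fin d)}
    (h₁ : Φ =ᶠ[nhds ν₁] Ψ) (h₂ : Φ =ᶠ[nhds ν₂] Ψ) (h : Φ =ᶠ[nhds ν] Ψ)
    (hdet : ∀ t : EuclideanSpace ℝ (Fin k), ‖t‖ = 1 → (borderedMatrix Φ t ν₁ ν₂ ν).det ≠ 0) :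
    Nondegenerate (fderiv ℝ Ψ ν₂ - fderiv ℝ Ψ ν₁) (fderiv ℝ (fderiv ℝ Ψ) ν) := by
  refine nondegenerate_of_det_ne_zero (A := gradDiff Φ ν₁ ν₂)
    (B := fun i => hessian (fun ξ => Φ ξ i) ν) (fun i j => ?_) (fun i a b => hessian_eq hΨ h i a b) hdet
  rw [gradDiff, Matrix.of_apply, partialDeriv_eq hΨ h₁, partialDeriv_eq hΨ h₂]
  rfl

lemma isCompact_unitCube (d : ℕ) : IsCompact (unitCube d) := by
  have h : unitCube d = (EuclideanSpace.equiv (Fin d) ℝ).toHomeomorph ⁻¹'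
      (Set.univ.pi fun _ => Set.Icc (-1 : ℝ) 1) := by
    ext ξ
    exact ⟨fun h j _ => h j, fun h j => h j trivial⟩
  rw [h]
  exact (Homeomorph.isCompact_preimage _).2 (isCompact_univ_pi fun _ => isCompact_Icc)

lemma IsClosedCube.isClosed {S : Set (EuclideanSpace ℝ (Fin d))} (hS : IsClosedCube S) :
    IsClosed S := by
  obtain ⟨a, s, -, rfl⟩ := hS
  have h : {ξ : EuclideanSpace ℝ (Fin d) | ∀ j, ξ j ∈ Set.Icc (a j) (a j + s)} =
      ⋂ j, EuclideanSpace.proj (𝕜 := ℝ) j ⁻¹' Set.Icc (a j) (a j + s) := by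
    ext ξ
    exact ⟨fun h => Set.mem_iInter.2 h, fun h => Set.mem_iInter.1 h⟩
  rw [h]
  refine isClosed_iInter fun j => ?_
  exact isClosed_Icc.preimage (EuclideanSpace.proj (𝕜 := ℝ) j).continuous

/-- A map that is smooth near a compact set agrees near that set with a globally smooth map. -/
lemma SmoothOnNhd.exists_contDiff {K : Set (EuclideanSpace ℝ (Fin d))} (hK : IsCompact K)
    (hΦ : SmoothOnNhd Φ K) : ∃ Ψ : EuclideanSpace ℝ (Fin d) → EuclideanSpace ℝ (Fin k),
      ContDiff ℝ ∞ Ψ ∧ ∀ ν ∈ K, Φ =ᶠ[nhds ν] Ψ := by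
  obtain ⟨U, hU, hKU, hΦU⟩ := hΦ
  obtain ⟨L, hL, hKL, hLU⟩ := exists_compact_between hK hU hKU
  obtain ⟨χ, hχ1, hχ0, -⟩ := exists_contMDiffMap_one_nhds_of_subset_interior (n := ⊤)
    (modelWithCornersSelf ℝ (EuclideanSpace ℝ (Fin d))) hK.isClosed hKL
  have hχ : ContDiff ℝ ∞ χ := χ.contMDiff.contDiff
  refine ⟨fun x => χ x • Φ x, ?_, fun ν hν => ?_⟩
  · rw [contDiff_iff_contDiffAt]
    intro x
    by_cases hx : x ∈ L
    · exact hχ.contDiffAt.smul (hΦU.contDiffAt (hU.mem_nhds (hLU hx)))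
    · have h0 : (fun x => χ x • Φ x) =ᶠ[nhds x] fun _ => 0 := by
        filter_upwards [hL.isClosed.isOpen_compl.mem_nhds hx] with y hy
        rw [hχ0 y hy, zero_smul]
      exact contDiffAt_const.congr_of_eventuallyEq h0
  · filter_upwards [(Filter.Eventually.filter_mono (nhds_le_nhdsSet hν) hχ1)] with y hy
    rw [hy, one_smul]

end Coordinates

/-! ### Exponents and the final assembly. -/

section Conclusion

/-- Hölder on a set of finite measure; it moves from the critical exponent to any larger one,
including `∞`. -/
lemma exists_eLpNorm_indicator_le {X : Type*} [MeasurableSpace X] {μ : Measure X} {S : Set X}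
    (hS : MeasurableSet S) (hSt : μ S ≠ ⊤) {p₁ p : ℝ≥0∞} (hp₁ : p₁ ≠ 0) (h : p₁ ≤ p) :
    ∃ K : ℝ≥0, ∀ f : X → ℂ, AEStronglyMeasurable f μ →
      eLpNorm (S.indicator f) p₁ μ ≤ K * eLpNorm f p μ := by
  have hexp : 0 ≤ 1 / p₁.toReal - 1 / p.toReal := by
    rcases eq_or_ne p ⊤ with rfl | hp
    · simp
    · have h1 : p₁ ≠ ⊤ := ne_top_of_le_ne_top hp h
      exact sub_nonneg.2 (one_div_le_one_div_of_le (ENNReal.toReal_pos hp₁ h1)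
        (ENNReal.toReal_mono hp h))
  have hfin : μ S ^ (1 / p₁.toReal - 1 / p.toReal) ≠ ⊤ := ENNReal.rpow_ne_top_of_nonneg hexp hSt
  refine ⟨(μ S ^ (1 / p₁.toReal - 1 / p.toReal)).toNNReal, fun f hf => ?_⟩
  rw [ENNReal.coe_toNNReal hfin, eLpNorm_indicator_eq_eLpNorm_restrict hS, mul_comm]
  refine (eLpNorm_le_eLpNorm_mul_rpow_measure_univ h hf.restrict).trans ?_
  rw [Measure.restrict_apply_univ]
  gcongr
  exact Measure.restrict_le_self

lemma extensionOp_eq_extFun {d k : ℕ} {Φ Ψ : EuclideanSpace ℝ (Fin d) → EuclideanSpace ℝ (Fin k)}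
    {S : Set (EuclideanSpace ℝ (Fin d))} (hS : MeasurableSet S) (h : ∀ ξ ∈ S, Φ ξ = Ψ ξ)
    {f f' : EuclideanSpace ℝ (Fin d) → ℂ} (hf : f =ᵐ[volume] f') :
    extensionOp Φ S f = extFun Ψ (S.indicator f') := by
  ext z
  have h1 : ∀ ξ, S.indicator f' ξ * phase (inner ℝ z.1 ξ + inner ℝ z.2 (Ψ ξ)) =
      S.indicator (fun ξ => f' ξ * phase (inner ℝ z.1 ξ + inner ℝ z.2 (Ψ ξ))) ξ := fun ξ =>
    (Set.indicator_mul_left (M₀ := ℂ) S f'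
      (fun ξ => phase (inner ℝ z.1 ξ + inner ℝ z.2 (Ψ ξ)))).symm
  unfold extensionOp extFun
  simp_rw [h1]
  rw [integral_indicator hS]
  refine integral_congr_ae ?_
  filter_upwards [ae_restrict_mem hS, ae_restrict_of_ae hf] with ξ hξ hfξ
  rw [h ξ hξ, hfξ, mul_comm, phase]
  congr 2
  push_cast
  ring

lemma critExp_inv_sub_one {d k : ℕ} (hk : 1 ≤ k) :
    (critExp (EuclideanSpace ℝ (Fin d)) (EuclideanSpace ℝ (Fin k)))⁻¹ - 1 =
      -((d + 3 * k) / (d + k) / 4 : ℝ) := by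
  have hk' : (1 : ℝ) ≤ k := by exact_mod_cast hk
  have h0 : (d + k : ℝ) ≠ 0 := by positivity
  rw [critExp, restrExp, inv_inv, finrank_euclideanSpace_fin, finrank_euclideanSpace_fin]
  field_simp
  ring

/-- The critical exponent `p` attached to `2 ≤ q < ∞` is at most every admissible one. -/
lemma exists_critical_exponent {d k : ℕ} (hk : 1 ≤ k) {p q : ℝ≥0∞} (hq : 2 ≤ q) (hqt : q ≠ ⊤)
    (hpq : 1 / p + ((d : ℝ≥0∞) + 3 * (k : ℝ≥0∞)) / ((d : ℝ≥0∞) + (k : ℝ≥0∞)) * (1 / (2 * q)) ≤ 1) :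
    ∃ P : ℝ, 0 < P ∧ ENNReal.ofReal P ≤ p ∧ P⁻¹ = 1 + 2 / q.toReal *
      ((critExp (EuclideanSpace ℝ (Fin d)) (EuclideanSpace ℝ (Fin k)))⁻¹ - 1) := by
  have hk' : (1 : ℝ) ≤ k := by exact_mod_cast hk
  set r := (critExp (EuclideanSpace ℝ (Fin d)) (EuclideanSpace ℝ (Fin k)))⁻¹ with hr
  have hr0 : 0 < r := inv_pos.2 critExp_pos
  have hr1 : r - 1 = -((d + 3 * k) / (d + k) / 4 : ℝ) := critExp_inv_sub_one hk
  have hQ : 2 ≤ q.toReal := by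
    have := ENNReal.toReal_mono hqt hq
    simpa using this
  have hθ1 : 2 / q.toReal ≤ 1 := (div_le_one (by linarith)).2 hQ
  have hθ0 : 0 < 2 / q.toReal := by positivity
  -- This is `(1 - θ) + θ r` with `0 < θ ≤ 1` and `r > 0`.
  have hpos : 0 < 1 + 2 / q.toReal * (r - 1) := by nlinarith
  refine ⟨(1 + 2 / q.toReal * (r - 1))⁻¹, inv_pos.2 hpos, ?_, inv_inv _⟩
  have hc : ((d : ℝ≥0∞) + 3 * (k : ℝ≥0∞)) / ((d : ℝ≥0∞) + (k : ℝ≥0∞)) * (1 / (2 * q)) =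
      ENNReal.ofReal ((d + 3 * k) / (d + k) * (1 / (2 * q.toReal)) : ℝ) := by
    rw [ENNReal.ofReal_mul (by positivity), ENNReal.ofReal_div_of_pos (by positivity),
      ENNReal.ofReal_add (by positivity) (by positivity), ENNReal.ofReal_mul (by norm_num),
      ENNReal.ofReal_add (by positivity) (by positivity), ENNReal.ofReal_div_of_pos (by positivity),
      ENNReal.ofReal_mul (by norm_num), ENNReal.ofReal_toReal hqt]
    simp
  rw [hc] at hpq
  -- In terms of reciprocals the claim `P ≤ p` is the hypothesis itself: `P⁻¹ = 1 - (d+3k)/(d+k) ·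
  -- 1/(2q)`.
  rw [← ENNReal.inv_le_inv, ← ENNReal.ofReal_inv_of_pos (inv_pos.2 hpos), inv_inv, ← one_div]
  refine (ENNReal.le_sub_of_add_le_right ENNReal.ofReal_ne_top hpq).trans_eq ?_
  rw [← ENNReal.ofReal_one, ← ENNReal.ofReal_sub _ (by positivity)]
  congr 1
  rw [hr1]
  have hQ0 : q.toReal ≠ 0 := by linarith
  have h0 : (d + k : ℝ) ≠ 0 := by positivity
  field_simp
  ring

end Conclusion

end BilinearExtension

open BilinearExtension

theorem proposition1p3 (d k : ℕ) (hk : 1 ≤ k)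
    (Φ : EuclideanSpace ℝ (Fin d) → EuclideanSpace ℝ (Fin k))
    (hΦ : BilinearExtension.SmoothOnNhd Φ (BilinearExtension.unitCube d))
    (S₁ S₂ : Set (EuclideanSpace ℝ (Fin d)))
    (hS₁ : BilinearExtension.IsClosedCube S₁) (hS₂ : BilinearExtension.IsClosedCube S₂)
    (hS₁I : S₁ ⊆ BilinearExtension.unitCube d) (hS₂I : S₂ ⊆ BilinearExtension.unitCube d)
    (hM : ∀ ν₁ ∈ S₁, ∀ ν₂ ∈ S₂, ∀ t : EuclideanSpace ℝ (Fin k), ‖t‖ = 1 →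
      ∀ ν : EuclideanSpace ℝ (Fin d), ν = ν₁ ∨ ν = ν₂ →
        (BilinearExtension.borderedMatrix Φ t ν₁ ν₂ ν).det ≠ 0)
    (p q : ℝ≥0∞) (hq : 2 ≤ q)
    (hpq : 1 / p + ((d : ℝ≥0∞) + 3 * (k : ℝ≥0∞)) / ((d : ℝ≥0∞) + (k : ℝ≥0∞)) * (1 / (2 * q)) ≤ 1) :
    ∃ C : ℝ≥0, ∀ f g : EuclideanSpace ℝ (Fin d) → ℂ,
      MemLp f p volume → MemLp g p volume →
        MemLp (fun z : EuclideanSpace ℝ (Fin d) × EuclideanSpace ℝ (Fin k) =>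
          BilinearExtension.extensionOp Φ S₁ f z * BilinearExtension.extensionOp Φ S₂ g z)
          q volume ∧
        eLpNorm (fun z : EuclideanSpace ℝ (Fin d) × EuclideanSpace ℝ (Fin k) =>
          BilinearExtension.extensionOp Φ S₁ f z * BilinearExtension.extensionOp Φ S₂ g z)
          q volume ≤ (C : ℝ≥0∞) * eLpNorm f p volume * eLpNorm g p volume := by
  have hkne : Nonempty (Fin k) := ⟨⟨0, hk⟩⟩
  obtain ⟨Ψ, hΨ, hΦΨ⟩ := hΦ.exists_contDiff (isCompact_unitCube d)
  have hc₁ : IsCompact S₁ := (isCompact_unitCube d).of_isClosed_subset hS₁.isClosed hS₁I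
  have hc₂ : IsCompact S₂ := (isCompact_unitCube d).of_isClosed_subset hS₂.isClosed hS₂I
  have hm₁ : MeasurableSet S₁ := hS₁.isClosed.measurableSet
  have hm₂ : MeasurableSet S₂ := hS₂.isClosed.measurableSet
  have hcrit : CritEstimate Ψ S₁ S₂ := by
    refine critEstimate_of_isCompact hΨ hc₁ hc₂ fun ν₁ hν₁ ν₂ hν₂ => ⟨?_, ?_⟩
    · exact nondegenerate_of_borderedMatrix hΨ (hΦΨ ν₁ (hS₁I hν₁)) (hΦΨ ν₂ (hS₂I hν₂))
        (hΦΨ ν₂ (hS₂I hν₂)) fun t ht => hM ν₁ hν₁ ν₂ hν₂ t ht ν₂ (Or.inr rfl)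
    -- Exchanging the two points only changes the sign of the first-derivative difference, which
    -- nondegeneracy ignores; the Hessian is now taken at `ν₁`.
    · rw [← neg_sub]
      exact (nondegenerate_of_borderedMatrix hΨ (hΦΨ ν₁ (hS₁I hν₁)) (hΦΨ ν₂ (hS₂I hν₂))
        (hΦΨ ν₁ (hS₁I hν₁)) fun t ht => hM ν₁ hν₁ ν₂ hν₂ t ht ν₁ (Or.inl rfl)).neg
  have hv₁ : volume S₁ < ⊤ := hc₁.measure_lt_top
  have hv₂ : volume S₂ < ⊤ := hc₂.measure_lt_top
  -- Hence functions in `L^p` are integrable on the cubes, so the extension operators are given by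
  -- convergent integrals.
  have hp1 : 1 ≤ p := by
    have h1 : 1 / p ≤ 1 := le_self_add.trans hpq
    rwa [one_div, ENNReal.inv_le_one] at h1
  obtain ⟨K₁, hK₁⟩ := exists_eLpNorm_indicator_le hm₁ hv₁.ne one_ne_zero hp1
  obtain ⟨K₂, hK₂⟩ := exists_eLpNorm_indicator_le hm₂ hv₂.ne one_ne_zero hp1
  suffices H : ∃ C : ℝ≥0, ∀ f g : EuclideanSpace ℝ (Fin d) → ℂ, Measurable f → Measurable g →
      MemLp f p volume → MemLp g p volume →
      eLpNorm (fun z : EuclideanSpace ℝ (Fin d) × EuclideanSpace ℝ (Fin k) =>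
        extFun Ψ (S₁.indicator f) z * extFun Ψ (S₂.indicator g) z) q volume ≤
        C * eLpNorm f p volume * eLpNorm g p volume by
    obtain ⟨C, hC⟩ := H
    refine ⟨C, fun f g hf hg => ?_⟩
    obtain ⟨f', hf', hff'⟩ := hf.1
    obtain ⟨g', hg', hgg'⟩ := hg.1
    have hfL : MemLp f' p volume := hf.ae_eq hff'
    have hgL : MemLp g' p volume := hg.ae_eq hgg'
    have hb := hC f' g' hf'.measurable hg'.measurable hfL hgL
    rw [extensionOp_eq_extFun hm₁ (fun ξ hξ => (hΦΨ ξ (hS₁I hξ)).eq_of_nhds) hff',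
      extensionOp_eq_extFun hm₂ (fun ξ hξ => (hΦΨ ξ (hS₂I hξ)).eq_of_nhds) hgg',
      eLpNorm_congr_ae hff', eLpNorm_congr_ae hgg']
    refine ⟨⟨?_, hb.trans_lt ?_⟩, hb⟩
    · exact ((stronglyMeasurable_extFun hΨ.continuous (hf'.measurable.indicator hm₁)).mul
        (stronglyMeasurable_extFun hΨ.continuous (hg'.measurable.indicator hm₂))).aestronglyMeasurable
    · exact ENNReal.mul_lt_top (ENNReal.mul_lt_top ENNReal.coe_lt_top hfL.2) hgL.2
  have hL1 : ∀ {S : Set (EuclideanSpace ℝ (Fin d))} (_ : MeasurableSet S) {K : ℝ≥0},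
      (∀ f : EuclideanSpace ℝ (Fin d) → ℂ, AEStronglyMeasurable f volume →
        eLpNorm (S.indicator f) 1 volume ≤ K * eLpNorm f p volume) →
      ∀ {f : EuclideanSpace ℝ (Fin d) → ℂ}, MemLp f p volume → Integrable (S.indicator f) := by
    intro S hS K hK f hf
    rw [← memLp_one_iff_integrable]
    exact ⟨hf.1.indicator hS, (hK f hf.1).trans_lt (ENNReal.mul_lt_top ENNReal.coe_lt_top hf.2)⟩
  -- For `q = ∞` each extension is bounded pointwise by an `L¹` norm over its cube; neither
  -- curvature nor interpolation is used.
  rcases eq_or_ne q ⊤ with rfl | hqt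
  · refine ⟨K₁ * K₂, fun f g hf hg hfL hgL => ?_⟩
    rw [eLpNorm_exponent_top]
    refine eLpNormEssSup_le_of_ae_enorm_bound (Filter.Eventually.of_forall fun z => ?_)
    rw [enorm_mul]
    calc ‖extFun Ψ (S₁.indicator f) z‖ₑ * ‖extFun Ψ (S₂.indicator g) z‖ₑ
        ≤ (K₁ * eLpNorm f p volume) * (K₂ * eLpNorm g p volume) := by
          have h1 := hK₁ f hfL.1
          have h2 := hK₂ g hgL.1
          rw [eLpNorm_one_eq_lintegral_enorm] at h1 h2
          exact mul_le_mul' ((enorm_extFun_le Ψ _ z).trans h1) ((enorm_extFun_le Ψ _ z).trans h2)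
      _ = _ := by
          push_cast
          ring
  · obtain ⟨P, hP0, hPp, hP⟩ := exists_critical_exponent hk hq hqt hpq
    have hQ : 2 ≤ q.toReal := by
      have := ENNReal.toReal_mono hqt hq
      simpa using this
    have hPne : ENNReal.ofReal P ≠ 0 := by simpa using hP0
    obtain ⟨C, hC⟩ := hcrit.exists_lintegral_rpow_le hΨ.continuous hv₁ hv₂ hQ hP0 hP
    obtain ⟨J₁, hJ₁⟩ := exists_eLpNorm_indicator_le hm₁ hv₁.ne hPne hPp
    obtain ⟨J₂, hJ₂⟩ := exists_eLpNorm_indicator_le hm₂ hv₂.ne hPne hPp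
    refine ⟨C * (J₁ * J₂), fun f g hf hg hfL hgL => ?_⟩
    have hmain := hC (hf.indicator hm₁) (hg.indicator hm₂) (hL1 hm₁ hK₁ hfL) (hL1 hm₂ hK₂ hgL)
      (fun x hx => Set.indicator_of_notMem hx _) (fun x hx => Set.indicator_of_notMem hx _)
    have h1 := hJ₁ f hfL.1
    have h2 := hJ₂ g hgL.1
    rw [eLpNorm_eq_lintegral_rpow_enorm_toReal hPne ENNReal.ofReal_ne_top,
      ENNReal.toReal_ofReal hP0.le, one_div] at h1 h2
    rw [eLpNorm_eq_lintegral_rpow_enorm_toReal (by positivity) hqt, one_div]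
    refine hmain.trans ?_
    calc (C : ℝ≥0∞) * ((∫⁻ x, ‖S₁.indicator f x‖ₑ ^ P) ^ P⁻¹ * (∫⁻ x, ‖S₂.indicator g x‖ₑ ^ P) ^ P⁻¹)
        ≤ C * ((J₁ * eLpNorm f p volume) * (J₂ * eLpNorm g p volume)) := by gcongr
      _ = _ := by
          push_cast
          ring
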